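/- Let $(N^n,g)$ be a smooth Riemannian manifold that is complete as a metric space, let $p$ be a smooth two-form on $N$ (the torsion potential), and let $\lambda, v_y\in\mathbb R$ be constants. In local coordinates let $\Gamma^A{}_{BC}$ be the Christoffel symbols of $g$ and put $Q^A{}_{BC}=\tfrac32\, g^{AD}\,\partial_{[D}p_{BC]}$, $\tilde\Gamma^A{}_{BC}=\Gamma^A{}_{BC}+Q^A{}_{BC}$, where the antisymmetrization is normalized so that $\partial_{[D}p_{BC]}=\tfrac13(\partial_D p_{BC}+\partial_B p_{CD}+\partial_C p_{DB})$. Let $\alpha,\beta$ run over $x,t$, let $\gamma^{\alpha\beta}$ be the $1+1$ Minkowski metric ($\gamma^{xx}=1$, $\gamma^{tt}=-1$, $\gamma^{xt}=\gamma^{tx}=0$) and $\epsilon^{\alpha\beta}$ the Levi-Civita tensor ($\epsilon^{xt}=1=-\epsilon^{tx}$, $\epsilon^{xx}=\epsilon^{tt}=0$). Let $\Sigma=\mathbb R$ or $\Sigma=\mathbb R/\ell\mathbb Z$ for some $\ell>0$, and let $t_0\in\mathbb R$. Then for all smooth maps $\hat\phi:\Sigma\to N$ and $\hat\theta:\Sigma\to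 TN$ with $\hat\theta(x)\in T_{\hat\phi(x)}N$ that are compactly supported (there is a compact set outside which $\hat\phi$ is equal to a constant and $\hat\theta$ is zero; on $\mathbb R/\ell\mathbb Z$ this is no restriction), there is a unique smooth map $\phi:\Sigma\times\mathbb R\to N$, $(x,t)\mapsto\phi(x,t)$, that satisfies, in all local coordinates of $N$ and at all points $(x,t)$ that $\phi$ maps into their domain, the equation $$\gamma^{\alpha\beta}\partial_\alpha\partial_\beta\phi^A+\tilde\Gamma^A{}_{BC}(\phi)\,\partial_\alpha\phi^B\,\partial_\beta\phi^C\,\big(\gamma^{\alpha\beta}+\lambda v_y\,\epsilon^{\alpha\beta}\big)=0$$ together with the initial conditions $\phi(x,t_0)=\hat\phi(x)$ and $\partial_t\phi(x,t_0)=\hat\theta(x)$ for all $x\in\Sigma$. -/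

import Mathlib

open Bundle Manifold
open scoped ContDiff

noncomputable section

/-- A smooth two-form on an `n`-dimensional smooth manifold `N`: a smooth section of the bundle of
bilinear forms on the tangent spaces, alternating at each point. -/
structure TwoForm (n : ℕ) (N : Type*) [TopologicalSpace N]
    [ChartedSpace (EuclideanSpace ℝ (Fin n)) N] [IsManifold (𝓡 n) ∞ N] where
  /-- The bilinear form on each tangent space. -/
  form (x : N) : TangentSpace (𝓡 n) x →L[ℝ] TangentSpace (𝓡 n) x →L[ℝ] ℝ
  alt (x : N) (v : TangentSpace (𝓡 n) x) : form x v v = 0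
  smooth : ContMDiff (𝓡 n)
    ((𝓡 n).prod 𝓘(ℝ, EuclideanSpace ℝ (Fin n) →L[ℝ] EuclideanSpace ℝ (Fin n) →L[ℝ] ℝ)) ∞
    (fun x : N => TotalSpace.mk'
      (EuclideanSpace ℝ (Fin n) →L[ℝ] EuclideanSpace ℝ (Fin n) →L[ℝ] ℝ)
      (E := fun x : N => TangentSpace (𝓡 n) x →L[ℝ] TangentSpace (𝓡 n) x →L[ℝ] ℝ) x (form x))

/-! ### Partial derivatives on the target coordinates and on the base -/

/-- The partial derivative `∂_A f` of a function on `ℝⁿ`. -/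
def coordDeriv {n : ℕ} (A : Fin n) (f : EuclideanSpace ℝ (Fin n) → ℝ)
    (z : EuclideanSpace ℝ (Fin n)) : ℝ :=
  fderiv ℝ f z (EuclideanSpace.single A 1)

/-- The coordinate directions of 1+1 Minkowski space: points are written `(x, t)`, the index `0`
stands for `x` and the index `1` for `t`. -/
def baseDir : Fin 2 → ℝ × ℝ := ![(1, 0), (0, 1)]

/-- The partial derivative `∂_α f` of a function of `(x, t)`. -/
def baseDeriv (α : Fin 2) (f : ℝ × ℝ → ℝ) (q : ℝ × ℝ) : ℝ :=
  fderiv ℝ f q (baseDir α)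

/-- The (inverse) 1+1 Minkowski metric, `γ^{xx} = 1`, `γ^{tt} = -1`. -/
def minkowski : Matrix (Fin 2) (Fin 2) ℝ := !![1, 0; 0, -1]

/-- The 1+1 Levi-Civita tensor, `ε^{xt} = 1 = -ε^{tx}`. -/
def leviCivita : Matrix (Fin 2) (Fin 2) ℝ := !![0, 1; -1, 0]

section Target

variable {n : ℕ} {N : Type*} [TopologicalSpace N] [ChartedSpace (EuclideanSpace ℝ (Fin n)) N]

/-- The coordinate vector field `∂_A` of the chart `e`, at the point with coordinates `z`. -/
def coordVec (e : OpenPartialHomeomorph N (EuclideanSpace ℝ (Fin n)))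
    (z : EuclideanSpace ℝ (Fin n)) (A : Fin n) : TangentSpace (𝓡 n) (e.symm z) :=
  mfderiv (𝓡 n) (𝓡 n) e.symm z (EuclideanSpace.single A (1 : ℝ) : EuclideanSpace ℝ (Fin n))

/-- The matrix `g_{AB}` of the Riemannian metric in the chart `e`. -/
def metricCoeff [RiemannianBundle (fun x : N => TangentSpace (𝓡 n) x)]
    (e : OpenPartialHomeomorph N (EuclideanSpace ℝ (Fin n)))
    (z : EuclideanSpace ℝ (Fin n)) : Matrix (Fin n) (Fin n) ℝ :=
  Matrix.of fun A B => inner ℝ (coordVec e z A) (coordVec e z B)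

/-- The Christoffel symbols
`Γ^A_{BC} = (1/2) g^{AD} (∂_B g_{DC} + ∂_C g_{DB} - ∂_D g_{BC})` of the Levi-Civita connection
in the chart `e`. -/
def christoffel [RiemannianBundle (fun x : N => TangentSpace (𝓡 n) x)]
    (e : OpenPartialHomeomorph N (EuclideanSpace ℝ (Fin n)))
    (z : EuclideanSpace ℝ (Fin n)) (A B C : Fin n) : ℝ :=
  ∑ D, 1 / 2 * (metricCoeff e z)⁻¹ A D *
    (coordDeriv B (fun w => metricCoeff e w D C) z
      + coordDeriv C (fun w => metricCoeff e w D B) z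
      - coordDeriv D (fun w => metricCoeff e w B C) z)

variable [IsManifold (𝓡 n) ∞ N]

/-- The components `p_{AB}` of a two-form in the chart `e`. -/
def TwoForm.coeff (p : TwoForm n N) (e : OpenPartialHomeomorph N (EuclideanSpace ℝ (Fin n)))
    (z : EuclideanSpace ℝ (Fin n)) (A B : Fin n) : ℝ :=
  p.form (e.symm z) (coordVec e z A) (coordVec e z B)

/-- The torsion tensor `Q^A_{BC} = (3/2) g^{AD} ∂_{[D} p_{BC]}` in the chart `e`. As `p` is skew,
the antisymmetrization over three indices (normalized to be a projection) is
`∂_{[D} p_{BC]} = (1/3) (∂_D p_{BC} + ∂_B p_{CD} + ∂_C p_{DB})`. -/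
def torsionCoeff [RiemannianBundle (fun x : N => TangentSpace (𝓡 n) x)] (p : TwoForm n N)
    (e : OpenPartialHomeomorph N (EuclideanSpace ℝ (Fin n)))
    (z : EuclideanSpace ℝ (Fin n)) (A B C : Fin n) : ℝ :=
  ∑ D, 3 / 2 * (metricCoeff e z)⁻¹ A D *
    (1 / 3 * (coordDeriv D (fun w => p.coeff e w B C) z
      + coordDeriv B (fun w => p.coeff e w C D) z
      + coordDeriv C (fun w => p.coeff e w D B) z))

/-- `φ : ℝ × ℝ → N`, a function of `(x, t)`, is a smooth solution on all of 1+1 Minkowski space of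
the reduced torsion wave map equation: in every chart of `N`, the coordinate functions `φ^A`
satisfy, wherever `φ` takes values in the domain of the chart,
`γ^{αβ} ∂_α ∂_β φ^A + (Γ^A_{BC} + Q^A_{BC})(φ) ∂_α φ^B ∂_β φ^C (γ^{αβ} + λ v_y ε^{αβ}) = 0`. -/
structure IsTorsionWaveMap [RiemannianBundle (fun x : N => TangentSpace (𝓡 n) x)]
    (p : TwoForm n N) (lam vy : ℝ) (φ : ℝ × ℝ → N) : Prop where
  smooth : ContMDiff 𝓘(ℝ, ℝ × ℝ) (𝓡 n) ∞ φ
  eqn : ∀ e ∈ IsManifold.maximalAtlas (𝓡 n) ∞ N, ∀ q : ℝ × ℝ, φ q ∈ e.source → ∀ A : Fin n,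
    (∑ α, ∑ β, minkowski α β * baseDeriv α (baseDeriv β (fun r => e (φ r) A)) q)
      + ∑ B, ∑ C, ∑ α, ∑ β,
          (christoffel e (e (φ q)) A B C + torsionCoeff p e (e (φ q)) A B C)
            * baseDeriv α (fun r => e (φ r) B) q * baseDeriv β (fun r => e (φ r) C) q
            * (minkowski α β + lam * vy * leviCivita α β) = 0

/-- The velocity `∂_t φ(x, t)` as a point of the tangent bundle, over `φ(x, t)`. -/
def timeVelocity (φ : ℝ × ℝ → N) (x t : ℝ) : TangentBundle (𝓡 n) N :=
  ⟨φ (x, t), mfderiv 𝓘(ℝ, ℝ) (𝓡 n) (fun s : ℝ => φ (x, s)) t (1 : ℝ)⟩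

/-- Smooth initial data: a smooth map `φ₀ : ℝ → N` and a smooth map `θ₀ : ℝ → TN` over it. -/
structure IsSmoothData (φ₀ : ℝ → N) (θ₀ : ℝ → TangentBundle (𝓡 n) N) : Prop where
  smooth_pos : ContMDiff 𝓘(ℝ, ℝ) (𝓡 n) ∞ φ₀
  smooth_vel : ContMDiff 𝓘(ℝ, ℝ) (𝓡 n).tangent ∞ θ₀
  proj_eq : ∀ x, (θ₀ x).proj = φ₀ x

/-- Compactly supported data on the line: outside a compact set, `φ₀` is constant and `θ₀`
vanishes. -/
def IsCompactlySupportedData (φ₀ : ℝ → N) (θ₀ : ℝ → TangentBundle (𝓡 n) N) : Prop :=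
  ∃ K : Set ℝ, IsCompact K ∧ ∃ c : N, ∀ x ∉ K, φ₀ x = c ∧ (θ₀ x).2 = 0

/-- `φ` is a smooth solution, for all `x` and all times, of the Cauchy problem for the reduced
torsion wave map equation with data `φ(x, t₀) = φ₀(x)` and `∂_t φ(x, t₀) = θ₀(x)`. -/
structure IsGlobalCauchySolution [RiemannianBundle (fun x : N => TangentSpace (𝓡 n) x)]
    (p : TwoForm n N) (lam vy t₀ : ℝ) (φ₀ : ℝ → N) (θ₀ : ℝ → TangentBundle (𝓡 n) N)
    (φ : ℝ × ℝ → N) : Prop where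
  waveMap : IsTorsionWaveMap p lam vy φ
  initial_pos : ∀ x, φ (x, t₀) = φ₀ x
  initial_vel : ∀ x, timeVelocity φ x t₀ = θ₀ x

end Target

end

/-! ### Diagonal first-order systems: mild solutions and a Gronwall inequality. -/

section FirstOrderSystems

open Set Filter Topology

variable {ι : Type*} [Fintype ι] {E : Type*} [NormedAddCommGroup E] [NormedSpace ℝ E]

/-! Put `c = lam * vy`, `a = ∂_t φ + ∂_x φ` and `b = ∂_t φ - ∂_x φ`. The symmetry of `Γ` and the
skewness of `Q` turn the equation into `(∂_t² - ∂_x²) φ^A = (-Γ^A_{BC} + c Q^A_{BC}) a^B b^C`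
(`chartEqAt_iff`). Invariantly, the covariant derivative of `a` along `∂_t - ∂_x`, and likewise that
of `b` along `∂_t + ∂_x`, equals `c Q(a, b)`. With its index lowered, `Q` is half the exterior
derivative of `p`, hence totally skew, so the right-hand side is orthogonal to both `a` and `b`.
Therefore `|a|²` is constant on the lines `x + t = const` and `|b|²` on the lines `x - t = const`
(`LoweredEqAt.energy_add`, `LoweredEqAt.energy_sub`, `IsSolutionOn.fderiv_energyDensity`). The first
derivatives of a solution are thus bounded, pointwise and for as long as it exists, by those of its
data.

Local theory. In a chart the triple `(ψ, a, b)` solves a diagonal first-order system with speeds of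
modulus at most 1. After the source is cut off to be globally Lipschitz, a weighted Picard iteration
solves it for all times (`exists_isMildAt`), and passing to the linearised system again and again
gives smoothness (`contDiff_of_isMildAt`). As long as the solution stays where the cut-off is 1, it
solves the original equation; this yields a diamond whose size depends only on bounds for the data
(`exists_local_waveOp_eq`). Gronwall along characteristics gives uniqueness on diamonds
(`eq_on_openDiamond`). The equation is tensorial (`LoweredEqAt.comp`), so solutions found in charts
are solutions in every chart.

Global theory. Everything is organised by triangles of dependence, on which the data determine the
solution (`IsSolutionOn.cone_subset_interior`). If a solution exists on a triangle without its apex,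
the energy bound makes it Lipschitz there. Completeness of `N` gives a limit at the apex, and in a
chart around the limit the local theory, started from a line close to the apex, reaches past it
(`IsSolutionOn.exists_openDiamond_solution`, `IsSolutionOn.exists_extension`). Induction along
triangles then covers the plane (`IsSmoothData.exists_isSolutionOn_univ`). On the circle, the
translate of the solution by `ℓ` has the same data, so uniqueness makes the solution periodic. -/

/-- The point at time `s` of the line with speed `-l` through `q`. -/
def charPt (l : ℝ) (q : ℝ × ℝ) (s : ℝ) : ℝ × ℝ := (q.1 + l * (q.2 - s), s)

@[fun_prop]
lemma continuous_charPt {X : Type*} [TopologicalSpace X] (l : ℝ) {f : X → ℝ × ℝ} {g : X → ℝ}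
    (hf : Continuous f) (hg : Continuous g) : Continuous fun x => charPt l (f x) (g x) := by
  unfold charPt; fun_prop

/-- `u` solves, in integrated form, the diagonal first-order system
`∂_t u_i - l_i ∂_x u_i = F_i(x, t, u)` with data `u(x, 0) = u₀(x)`, at the point `q`. -/
def IsMildAt (l : ι → ℝ) (F : ℝ × ℝ → (ι → E) → (ι → E)) (u₀ : ℝ → ι → E)
    (u : ℝ × ℝ → ι → E) (q : ℝ × ℝ) : Prop :=
  ∀ i, u q i = u₀ (q.1 + l i * q.2) i +
    ∫ s in (0 : ℝ)..q.2, F (charPt (l i) q s) (u (charPt (l i) q s)) i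

/-- Integration in the weight `e^{M|s|}` gains a factor `1 / M`. This makes the Picard map contract,
and lets the Gronwall integral be absorbed, without any restriction on the length of the time
interval. -/
lemma norm_integral_le_exp {V : Type*} [NormedAddCommGroup V] [NormedSpace ℝ V] {f : ℝ → V}
    {M α t : ℝ} (hM : 0 < M) (hα : 0 ≤ α)
    (h : ∀ s ∈ uIcc 0 t, ‖f s‖ ≤ α * Real.exp (M * |s|)) :
    ‖∫ s in (0 : ℝ)..t, f s‖ ≤ α / M * Real.exp (M * |t|) := by
  have key : ∀ (g : ℝ → V) (r : ℝ), 0 ≤ r → (∀ s ∈ Icc 0 r, ‖g s‖ ≤ α * Real.exp (M * s)) →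
      ‖∫ s in (0 : ℝ)..r, g s‖ ≤ α / M * Real.exp (M * r) := by
    intro g r hr hg
    have h1 : ‖∫ s in (0 : ℝ)..r, g s‖ ≤ ∫ s in (0 : ℝ)..r, α * Real.exp (M * s) :=
      intervalIntegral.norm_integral_le_of_norm_le hr
        (Eventually.of_forall fun s hs => hg s (Ioc_subset_Icc_self hs))
        (by apply Continuous.intervalIntegrable; fun_prop)
    have h2 : ∫ s in (0 : ℝ)..r, α * Real.exp (M * s)
        = α / M * Real.exp (M * r) - α / M * Real.exp (M * 0) := by
      apply intervalIntegral.integral_eq_sub_of_hasDerivAt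
        (f := fun s => α / M * Real.exp (M * s))
      · intro s _
        have := (((hasDerivAt_id s).const_mul M).exp).const_mul (α / M)
        convert! this using 1
        field_simp
        simp
      · apply Continuous.intervalIntegrable; fun_prop
    have h3 : 0 ≤ α / M * Real.exp (M * 0) := by positivity
    linarith
  rcases le_total 0 t with ht | ht
  · rw [abs_of_nonneg ht]
    apply key f t ht
    intro s hs
    have := h s (by rwa [uIcc_of_le ht])
    rwa [abs_of_nonneg hs.1] at this
  · rw [abs_of_nonpos ht]
    have := key (fun s => f (-s)) (-t) (by linarith) (by
      intro s hs
      have := h (-s) (by rw [uIcc_of_ge ht]; constructor <;> linarith [hs.1, hs.2])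
      rwa [abs_neg, abs_of_nonneg hs.1] at this)
    rwa [intervalIntegral.integral_comp_neg (f := f), neg_neg, neg_zero,
      intervalIntegral.integral_symm, norm_neg] at this

/-- Global existence of continuous mild solutions for a globally Lipschitz source and bounded
data. -/
theorem exists_isMildAt [CompleteSpace E] (l : ι → ℝ) {F : ℝ × ℝ → (ι → E) → (ι → E)}
    (hF : Continuous (Function.uncurry F)) {K C C₀ : ℝ}
    (hK : ∀ q v w, ‖F q v - F q w‖ ≤ K * ‖v - w‖) (hC : ∀ q, ‖F q 0‖ ≤ C)
    {u₀ : ℝ → ι → E} (hu₀ : Continuous u₀) (hC₀ : ∀ x, ‖u₀ x‖ ≤ C₀) :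
    ∃ u : ℝ × ℝ → ι → E, Continuous u ∧ ∀ q, IsMildAt l F u₀ u q := by
  wlog hK0 : 0 ≤ K generalizing K
  · exact this (K := |K|) (fun q v w => (hK q v w).trans
      (mul_le_mul_of_nonneg_right (le_abs_self K) (norm_nonneg _))) (abs_nonneg _)
  have hC' : 0 ≤ C := (norm_nonneg _).trans (hC 0)
  have hC₀' : 0 ≤ C₀ := (norm_nonneg _).trans (hC₀ 0)
  -- Then `K / M ≤ 1 / 2`, the contraction ratio; the `+ 1` keeps `M` positive when `K = 0`.
  set M : ℝ := 2 * K + 1 with hM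
  have hM0 : 0 < M := by positivity
  let B := BoundedContinuousFunction (ℝ × ℝ) (ι → E)
  -- The Picard map written for `w = e^{-M|t|} u`. The solution `u` may grow exponentially, but `w`
  -- stays bounded, so the fixed point can be sought among bounded continuous functions on the whole
  -- plane.
  let Φ : B → ℝ × ℝ → ι → E := fun w q i => Real.exp (-(M * |q.2|)) • (u₀ (q.1 + l i * q.2) i +
    ∫ s in (0 : ℝ)..q.2, F (charPt (l i) q s) (Real.exp (M * |s|) • w (charPt (l i) q s)) i)
  have hcont : ∀ w : B, ∀ i, Continuous fun p : (ℝ × ℝ) × ℝ =>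
      F (charPt (l i) p.1 p.2) (Real.exp (M * |p.2|) • w (charPt (l i) p.1 p.2)) i := by
    intro w i
    have hw := w.continuous
    have : Continuous fun p : (ℝ × ℝ) × ℝ => Function.uncurry F
      (charPt (l i) p.1 p.2, Real.exp (M * |p.2|) • w (charPt (l i) p.1 p.2)) := by fun_prop
    exact (continuous_apply i).comp this
  have hΦc : ∀ w, Continuous (Φ w) := by
    intro w
    refine continuous_pi fun i => ?_
    have h1 : Continuous fun q : ℝ × ℝ => ∫ s in (0 : ℝ)..q.2,
        F (charPt (l i) q s) (Real.exp (M * |s|) • w (charPt (l i) q s)) i :=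
      intervalIntegral.continuous_parametric_intervalIntegral_of_continuous (hcont w i)
        continuous_snd
    have h2 : Continuous fun q : ℝ × ℝ => u₀ (q.1 + l i * q.2) i := by fun_prop
    simp only [Φ]
    fun_prop
  have hexp : ∀ t : ℝ, Real.exp (-(M * |t|)) * Real.exp (M * |t|) = 1 := by
    intro t; rw [← Real.exp_add]; simp
  have hbd : ∀ w q, ‖Φ w q‖ ≤ C₀ + (C + K * ‖w‖) / M := by
    intro w q
    refine (pi_norm_le_iff_of_nonneg (by positivity)).2 fun i => ?_
    have h1 : ‖∫ s in (0 : ℝ)..q.2,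
        F (charPt (l i) q s) (Real.exp (M * |s|) • w (charPt (l i) q s)) i‖
        ≤ (C + K * ‖w‖) / M * Real.exp (M * |q.2|) := by
      refine norm_integral_le_exp hM0 (by positivity) fun s _ => ?_
      have e1 : (1 : ℝ) ≤ Real.exp (M * |s|) := Real.one_le_exp (by positivity)
      have h2 := hK (charPt (l i) q s) (Real.exp (M * |s|) • w (charPt (l i) q s)) 0
      have h3 := hC (charPt (l i) q s)
      have h4 := w.norm_coe_le_norm (charPt (l i) q s)
      rw [sub_zero, norm_smul, Real.norm_of_nonneg (Real.exp_pos _).le] at h2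
      refine (norm_le_pi_norm _ i).trans ?_
      have h5 := norm_le_norm_sub_add
        (F (charPt (l i) q s) (Real.exp (M * |s|) • w (charPt (l i) q s))) (F (charPt (l i) q s) 0)
      have h6 : K * (Real.exp (M * |s|) * ‖w (charPt (l i) q s)‖)
          ≤ K * ‖w‖ * Real.exp (M * |s|) := by
        rw [mul_assoc, mul_comm ‖w‖]; gcongr
      have h7 : C ≤ C * Real.exp (M * |s|) := le_mul_of_one_le_right hC' e1
      nlinarith
    simp only [Φ]
    rw [norm_smul, Real.norm_of_nonneg (Real.exp_pos _).le]
    have h2 : ‖u₀ (q.1 + l i * q.2) i‖ ≤ C₀ := (norm_le_pi_norm _ i).trans (hC₀ _)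
    have e2 : Real.exp (-(M * |q.2|)) ≤ 1 := Real.exp_le_one_iff.2 (by
      have : 0 ≤ M * |q.2| := by positivity
      linarith)
    calc _ ≤ Real.exp (-(M * |q.2|)) * (C₀ + (C + K * ‖w‖) / M * Real.exp (M * |q.2|)) := by
          gcongr; exact (norm_add_le _ _).trans (add_le_add h2 h1)
      _ = Real.exp (-(M * |q.2|)) * C₀ + (C + K * ‖w‖) / M *
            (Real.exp (-(M * |q.2|)) * Real.exp (M * |q.2|)) := by ring
      _ ≤ 1 * C₀ + (C + K * ‖w‖) / M * 1 := by rw [hexp]; gcongr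
      _ = _ := by ring
  let T : B → B := fun w => BoundedContinuousFunction.ofNormedAddCommGroup (Φ w) (hΦc w) _ (hbd w)
  have hT : ContractingWith (1 / 2) T := by
    refine ⟨by norm_num, LipschitzWith.of_dist_le_mul fun w w' => ?_⟩
    rw [dist_eq_norm, dist_eq_norm]
    refine (BoundedContinuousFunction.norm_le (by positivity)).2 fun q => ?_
    refine (pi_norm_le_iff_of_nonneg (by positivity)).2 fun i => ?_
    have h0 : (T w - T w') q i = Real.exp (-(M * |q.2|)) • ∫ s in (0 : ℝ)..q.2,
        (F (charPt (l i) q s) (Real.exp (M * |s|) • w (charPt (l i) q s)) i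
          - F (charPt (l i) q s) (Real.exp (M * |s|) • w' (charPt (l i) q s)) i) := by
      rw [intervalIntegral.integral_sub]
      · change Φ w q i - Φ w' q i = _
        simp only [Φ]
        rw [← smul_sub]; congr 1; abel
      · exact ((hcont w i).comp (Continuous.prodMk_right q)).intervalIntegrable _ _
      · exact ((hcont w' i).comp (Continuous.prodMk_right q)).intervalIntegrable _ _
    rw [h0, norm_smul, Real.norm_of_nonneg (Real.exp_pos _).le]
    have h1 : ‖∫ s in (0 : ℝ)..q.2,
        (F (charPt (l i) q s) (Real.exp (M * |s|) • w (charPt (l i) q s)) i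
          - F (charPt (l i) q s) (Real.exp (M * |s|) • w' (charPt (l i) q s)) i)‖
        ≤ (K * ‖w - w'‖) / M * Real.exp (M * |q.2|) := by
      refine norm_integral_le_exp hM0 (by positivity) fun s _ => ?_
      have h2 := hK (charPt (l i) q s) (Real.exp (M * |s|) • w (charPt (l i) q s))
        (Real.exp (M * |s|) • w' (charPt (l i) q s))
      have h4 := (w - w').norm_coe_le_norm (charPt (l i) q s)
      rw [← smul_sub, norm_smul, Real.norm_of_nonneg (Real.exp_pos _).le] at h2
      rw [← Pi.sub_apply]
      refine (norm_le_pi_norm _ i).trans (h2.trans ?_)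
      rw [mul_assoc, mul_comm ‖w - w'‖]
      gcongr
      exact h4
    calc _ ≤ Real.exp (-(M * |q.2|)) * ((K * ‖w - w'‖) / M * Real.exp (M * |q.2|)) := by gcongr
      _ = K / M * ‖w - w'‖ * (Real.exp (-(M * |q.2|)) * Real.exp (M * |q.2|)) := by ring
      _ ≤ 1 / 2 * ‖w - w'‖ := by
          rw [hexp, mul_one]
          refine mul_le_mul_of_nonneg_right ?_ (norm_nonneg _)
          rw [div_le_iff₀ hM0]; linarith
      _ = _ := by norm_num
  let w := ContractingWith.fixedPoint T hT
  have hw : T w = w := hT.fixedPoint_isFixedPt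
  refine ⟨fun q => Real.exp (M * |q.2|) • w q, ?_, fun q i => ?_⟩
  · have := w.continuous
    fun_prop
  · have h1 : w q i = Φ w q i := by
      conv_lhs => rw [← hw]
      rfl
    simp only [Pi.smul_apply]
    rw [h1]
    simp only [Φ]
    rw [smul_smul, mul_comm, hexp, one_smul]
    rfl

/-- The closed diamond of radius `R` centred at the origin. -/
def diamond (R : ℝ) : Set (ℝ × ℝ) := {q | |q.1| + |q.2| ≤ R}

lemma isCompact_diamond (R : ℝ) : IsCompact (diamond R) := by
  have h : IsClosed (diamond R) := isClosed_le (by fun_prop) (by fun_prop)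
  refine (isCompact_Icc (a := ((-R, -R) : ℝ × ℝ)) (b := (R, R))).of_isClosed_subset h ?_
  intro q hq
  have hq' : |q.1| + |q.2| ≤ R := hq
  have h1 := abs_le.1 (show |q.1| ≤ R by linarith [abs_nonneg q.2])
  have h2 := abs_le.1 (show |q.2| ≤ R by linarith [abs_nonneg q.1])
  exact ⟨⟨h1.1, h2.1⟩, ⟨h1.2, h2.2⟩⟩

lemma abs_sub_add_abs_of_mem_uIcc {s t : ℝ} (hs : s ∈ uIcc 0 t) : |t - s| + |s| = |t| := by
  rcases le_total 0 t with ht | ht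
  · rw [uIcc_of_le ht] at hs
    rw [abs_of_nonneg hs.1, abs_of_nonneg ht, abs_of_nonneg (by linarith [hs.2])]; ring
  · rw [uIcc_of_ge ht] at hs
    rw [abs_of_nonpos hs.2, abs_of_nonpos ht, abs_of_nonpos (by linarith [hs.1])]; ring

/-- Finite propagation speed: going back from time `t` to `s` moves `x` by at most `|t - s|`,
exactly what `|t|` loses when it becomes `|s|`. -/
lemma charPt_mem_diamond {l R : ℝ} (hl : |l| ≤ 1) {q : ℝ × ℝ} (hq : q ∈ diamond R) {s : ℝ}
    (hs : s ∈ uIcc 0 q.2) : charPt l q s ∈ diamond R := by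
  have hq' : |q.1| + |q.2| ≤ R := hq
  change |q.1 + l * (q.2 - s)| + |s| ≤ R
  have h1 := abs_sub_add_abs_of_mem_uIcc hs
  have h2 := abs_add_le q.1 (l * (q.2 - s))
  have h3 : |l * (q.2 - s)| ≤ |q.2 - s| := by
    rw [abs_mul]; exact mul_le_of_le_one_left (abs_nonneg _) hl
  linarith

lemma foot_mem {l R : ℝ} (hl : |l| ≤ 1) {q : ℝ × ℝ} (hq : q ∈ diamond R) :
    |q.1 + l * q.2| ≤ R := by
  have h : |q.1 + l * (q.2 - 0)| + |(0 : ℝ)| ≤ R := charPt_mem_diamond hl hq left_mem_uIcc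
  simpa using h

omit [NormedSpace ℝ E] in
/-- A Gronwall inequality along characteristics. -/
lemma norm_le_of_forall_le_integral {l : ι → ℝ} (hl : ∀ i, |l i| ≤ 1) {R α K : ℝ} (hα : 0 ≤ α)
    (hK : 0 ≤ K) {w : ℝ × ℝ → ι → E} (hw : ContinuousOn w (diamond R))
    (h : ∀ q ∈ diamond R, ∀ i,
      ‖w q i‖ ≤ α + |∫ s in (0 : ℝ)..q.2, K * ‖w (charPt (l i) q s)‖|) :
    ∀ q ∈ diamond R, ‖w q‖ ≤ 2 * α * Real.exp ((2 * K + 1) * |q.2|) := by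
  intro q₁ hq₁
  set M : ℝ := 2 * K + 1 with hM
  have hM0 : 0 < M := by positivity
  -- At a maximum point of the weighted norm, with maximum `S`, the hypothesis gives `S ≤ α + K S /
  -- M ≤ α + S / 2`, hence `S ≤ 2 α`.
  obtain ⟨q, hq, hmax⟩ := (isCompact_diamond R).exists_isMaxOn ⟨q₁, hq₁⟩
    (f := fun q => Real.exp (-(M * |q.2|)) * ‖w q‖) (by fun_prop)
  set S := Real.exp (-(M * |q.2|)) * ‖w q‖ with hS
  have hS0 : 0 ≤ S := by positivity
  have hexp : ∀ t : ℝ, Real.exp (-(M * |t|)) * Real.exp (M * |t|) = 1 := by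
    intro t; rw [← Real.exp_add]; simp
  have hle : ∀ p ∈ diamond R, ‖w p‖ ≤ S * Real.exp (M * |p.2|) := by
    intro p hp
    have h1 : Real.exp (-(M * |p.2|)) * ‖w p‖ ≤ S := hmax hp
    calc ‖w p‖ = (Real.exp (-(M * |p.2|)) * ‖w p‖) * Real.exp (M * |p.2|) := by
          rw [mul_right_comm, hexp, one_mul]
      _ ≤ _ := by gcongr
  have hwq : ‖w q‖ ≤ α + K * S / M * Real.exp (M * |q.2|) := by
    refine (pi_norm_le_iff_of_nonneg (by positivity)).2 fun i => (h q hq i).trans ?_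
    gcongr
    rw [← Real.norm_eq_abs]
    refine norm_integral_le_exp hM0 (by positivity) fun s hs => ?_
    have h2 := hle _ (charPt_mem_diamond (hl i) hq hs)
    rw [Real.norm_of_nonneg (by positivity), mul_assoc]
    gcongr
    exact h2
  have e2 : Real.exp (-(M * |q.2|)) ≤ 1 := Real.exp_le_one_iff.2 (by
      have : 0 ≤ M * |q.2| := by positivity
      linarith)
  have hS2 : S ≤ α + K * S / M := by
    calc S ≤ Real.exp (-(M * |q.2|)) * (α + K * S / M * Real.exp (M * |q.2|)) := by
          rw [hS]; gcongr
      _ = Real.exp (-(M * |q.2|)) * α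
          + K * S / M * (Real.exp (-(M * |q.2|)) * Real.exp (M * |q.2|)) := by ring
      _ ≤ 1 * α + K * S / M * 1 := by rw [hexp]; gcongr
      _ = _ := by ring
  have hS3 : K * S / M ≤ S / 2 := by
    rw [div_le_iff₀ hM0, hM]; nlinarith
  refine (hle q₁ hq₁).trans ?_
  gcongr
  linarith

end FirstOrderSystems

/-! ### Smoothness of mild solutions. -/

section Regularity

open Set Filter Topology

/-- Differentiability of a `C¹` function, uniformly on a compact set. -/
lemma exists_forall_norm_sub_sub_fderiv_le {X Y : Type*} [NormedAddCommGroup X] [NormedSpace ℝ X]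
    [NormedAddCommGroup Y] [NormedSpace ℝ Y] {f : X → Y} (hf : ContDiff ℝ 1 f) {k : Set X}
    (hk : IsCompact k) {ε : ℝ} (hε : 0 < ε) :
    ∃ δ > 0, ∀ x ∈ k, ∀ y, ‖y - x‖ < δ → ‖f y - f x - fderiv ℝ f x (y - x)‖ ≤ ε * ‖y - x‖ := by
  have hc : Continuous (fderiv ℝ f) := hf.continuous_fderiv one_ne_zero
  have h := hk.uniformContinuousAt_of_continuousAt (fderiv ℝ f) (fun a _ => hc.continuousAt)
    (Metric.dist_mem_uniformity hε)
  obtain ⟨δ, hδ, h⟩ := Metric.mem_uniformity_dist.1 h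
  refine ⟨δ, hδ, fun x hx y hy => ?_⟩
  refine (convex_ball x δ).norm_image_sub_le_of_norm_fderiv_le' (𝕜 := ℝ)
    (fun z _ => (hf.differentiable one_ne_zero) z) (fun z hz => ?_)
    (Metric.mem_ball_self hδ) (by rwa [Metric.mem_ball, dist_eq_norm])
  have := h (a := x) (b := z) (by rw [dist_comm]; exact hz) hx
  rw [← dist_eq_norm, dist_comm]
  exact le_of_lt this

variable {ι : Type*} [Fintype ι] {E : Type*} [NormedAddCommGroup E] [NormedSpace ℝ E]
  [CompleteSpace E]

/-- The retraction of the line onto `[-R, R]`. -/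
def clampTo (R x : ℝ) : ℝ := max (-R) (min R x)

@[fun_prop]
lemma continuous_clampTo (R : ℝ) : Continuous (clampTo R) := by
  unfold clampTo; fun_prop

lemma clampTo_of_abs_le {R x : ℝ} (h : |x| ≤ R) : clampTo R x = x := by
  have := abs_le.1 h
  rw [clampTo, min_eq_right this.2, max_eq_right this.1]

lemma clampTo_mem {R : ℝ} (hR : 0 ≤ R) (x : ℝ) : clampTo R x ∈ Icc (-R) R :=
  ⟨le_max_left _ _, max_le (by linarith) (min_le_left _ _)⟩

/-- The candidate `v` is produced first, as the solution of the linearised system. The difference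
between the difference quotient of `u` and `v` satisfies the linearised equation up to an error that
is small uniformly on the compact diamond, and Gronwall forces it to zero with the increment. -/
lemma exists_hasDerivAt_mild_of_diamond {l : ι → ℝ} (hl : ∀ i, |l i| ≤ 1)
    {F : (ι → E) → (ι → E)} (hF : ContDiff ℝ 1 F) {u₀ : ℝ → ι → E} (hu₀ : ContDiff ℝ 1 u₀)
    {u : ℝ × ℝ → ι → E} (hu : Continuous u) (hmild : ∀ q, IsMildAt l (fun _ => F) u₀ u q)
    {R : ℝ} (hR : 0 ≤ R) :
    ∃ v : ℝ × ℝ → ι → E, Continuous v ∧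
      (∀ q ∈ diamond R, IsMildAt l (fun q w => fderiv ℝ F (u q) w) (deriv u₀) v q) ∧
      ∀ q ∈ diamond R, HasDerivAt (fun x => u (x, q.2)) (v q) q.1 := by
  have hdF : Continuous (fderiv ℝ F) := hF.continuous_fderiv one_ne_zero
  have hdu₀ : Continuous (deriv u₀) := hu₀.continuous_deriv le_rfl
  -- Clamping the coordinates bounds the coefficients and the data of the linearised system on the
  -- whole plane, as `exists_isMildAt` demands, and changes nothing on the diamond.
  let ρ : ℝ × ℝ → ℝ × ℝ := fun q => (clampTo R q.1, clampTo R q.2)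
  have hρ : ∀ q ∈ diamond R, ρ q = q := by
    intro q hq
    have hq' : |q.1| + |q.2| ≤ R := hq
    simp only [ρ]
    rw [clampTo_of_abs_le (by linarith [abs_nonneg q.2]),
      clampTo_of_abs_le (by linarith [abs_nonneg q.1])]
  have hρm : ∀ q, ρ q ∈ Icc ((-R, -R) : ℝ × ℝ) (R, R) := fun q =>
    ⟨⟨(clampTo_mem hR _).1, (clampTo_mem hR _).1⟩, ⟨(clampTo_mem hR _).2, (clampTo_mem hR _).2⟩⟩
  have hρc : Continuous ρ := by
    exact ((continuous_clampTo R).comp continuous_fst).prodMk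
      ((continuous_clampTo R).comp continuous_snd)
  obtain ⟨K, hK⟩ := ((isCompact_Icc (a := ((-R, -R) : ℝ × ℝ)) (b := (R, R))).exists_bound_of_continuousOn
    (f := fun q => fderiv ℝ F (u q)) (hdF.comp hu).continuousOn)
  obtain ⟨C₀, hC₀⟩ := ((isCompact_Icc (a := -R) (b := R)).exists_bound_of_continuousOn
    (f := deriv u₀) hdu₀.continuousOn)
  have hK0 : 0 ≤ K := (norm_nonneg _).trans (hK _ (hρm 0))
  obtain ⟨v, hv, hvm⟩ := exists_isMildAt l (F := fun q w => fderiv ℝ F (u (ρ q)) w)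
    (K := K) (C := 0) (C₀ := C₀) (u₀ := fun x => deriv u₀ (clampTo R x))
    (by
      have h1 : Continuous fun p : (ℝ × ℝ) × (ι → E) => fderiv ℝ F (u (ρ p.1)) :=
        hdF.comp (hu.comp (hρc.comp continuous_fst))
      exact h1.clm_apply continuous_snd)
    (fun q w w' => by
      rw [← map_sub]
      exact ContinuousLinearMap.le_of_opNorm_le _ (hK _ (hρm q)) _)
    (fun q => by simp) (hdu₀.comp (continuous_clampTo R)) (fun x => hC₀ _ (clampTo_mem hR x))
  have hvlin : ∀ q ∈ diamond R,
      IsMildAt l (fun q w => fderiv ℝ F (u q) w) (deriv u₀) v q := by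
    intro q hq i
    rw [hvm q i]
    congr 1
    · simp only
      rw [clampTo_of_abs_le (foot_mem (hl i) hq)]
    · apply intervalIntegral.integral_congr
      intro s hs
      simp only
      rw [hρ _ (charPt_mem_diamond (hl i) hq hs)]
  refine ⟨v, hv, hvlin, fun q₁ hq₁ => ?_⟩
  obtain ⟨V, hV⟩ := (isCompact_diamond R).exists_bound_of_continuousOn hv.continuousOn
  have hV0 : 0 ≤ V := (norm_nonneg _).trans (hV q₁ hq₁)
  -- The Gronwall bound for `α = ε (1 + R V)` and Lipschitz constant `K + 1`, divided by `ε`.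
  set P : ℝ := 2 * (1 + R * V) * Real.exp ((2 * (K + 1) + 1) * |q₁.2|) with hP
  have hP0 : 0 < P := by positivity
  rw [hasDerivAt_iff_tendsto_slope_zero]
  have main : ∀ ε > 0, ε ≤ 1 → ∃ δ > 0, ∀ h : ℝ, h ≠ 0 → |h| < δ →
      ‖h⁻¹ • (u (q₁.1 + h, q₁.2) - u q₁) - v q₁‖ ≤ ε * P := by
    intro ε hε hε1
    obtain ⟨δ₁, hδ₁, h₁⟩ := exists_forall_norm_sub_sub_fderiv_le hF
      ((isCompact_diamond R).image hu) hε
    obtain ⟨δ₂, hδ₂, h₂⟩ := exists_forall_norm_sub_sub_fderiv_le hu₀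
      (isCompact_Icc (a := -R) (b := R)) hε
    have h₃ := (isCompact_diamond R).uniformContinuousAt_of_continuousAt u
      (fun a _ => hu.continuousAt) (Metric.dist_mem_uniformity hδ₁)
    obtain ⟨δ₃, hδ₃, h₃⟩ := Metric.mem_uniformity_dist.1 h₃
    refine ⟨min δ₂ δ₃, lt_min hδ₂ hδ₃, fun h h0 hh => ?_⟩
    set e : ℝ × ℝ → ι → E := fun q => h⁻¹ • (u (q.1 + h, q.2) - u q) - v q with he
    have hec : Continuous e := by fun_prop
    have hcont : ∀ q i, Continuous fun s => F (u (charPt (l i) q s)) i := fun q i => by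
      have := hF.continuous
      exact (continuous_apply i).comp (by fun_prop)
    have hcont' : ∀ q i, Continuous fun s =>
        F (u ((charPt (l i) q s).1 + h, (charPt (l i) q s).2)) i := fun q i => by
      have := hF.continuous
      exact (continuous_apply i).comp (by fun_prop)
    have hcontv : ∀ q i, Continuous fun s =>
        fderiv ℝ F (u (charPt (l i) q s)) (v (charPt (l i) q s)) i := fun q i => by
      exact (continuous_apply i).comp (by fun_prop)
    have key : ∀ q ∈ diamond R, ∀ i,
        ‖e q i‖ ≤ ε * (1 + R * V) + |∫ s in (0 : ℝ)..q.2, (K + 1) * ‖e (charPt (l i) q s)‖| := by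
      intro q hq i
      have e1 : e q i = (h⁻¹ • (u₀ (q.1 + l i * q.2 + h) - u₀ (q.1 + l i * q.2))
          - deriv u₀ (q.1 + l i * q.2)) i + ∫ s in (0 : ℝ)..q.2,
          (h⁻¹ • (F (u ((charPt (l i) q s).1 + h, (charPt (l i) q s).2)) i
            - F (u (charPt (l i) q s)) i)
            - fderiv ℝ F (u (charPt (l i) q s)) (v (charPt (l i) q s)) i) := by
        rw [intervalIntegral.integral_sub, intervalIntegral.integral_smul,
          intervalIntegral.integral_sub]
        · simp only [he, Pi.sub_apply, Pi.smul_apply]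
          rw [hvlin q hq i, hmild q i, hmild (q.1 + h, q.2) i]
          have : ∀ s, charPt (l i) (q.1 + h, q.2) s
              = ((charPt (l i) q s).1 + h, (charPt (l i) q s).2) := by
            intro s; simp only [charPt]; ext <;> simp only; ring
          simp only [this]
          rw [show q.1 + h + l i * q.2 = q.1 + l i * q.2 + h by ring]
          simp only [smul_sub, smul_add]
          abel
        · exact (hcont' q i).intervalIntegrable _ _
        · exact (hcont q i).intervalIntegrable _ _
        · exact (((hcont' q i).sub (hcont q i)).const_smul h⁻¹).intervalIntegrable _ _
        · exact (hcontv q i).intervalIntegrable _ _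
      have hfoot := foot_mem (hl i) hq
      have b1 : ‖(h⁻¹ • (u₀ (q.1 + l i * q.2 + h) - u₀ (q.1 + l i * q.2))
          - deriv u₀ (q.1 + l i * q.2)) i‖ ≤ ε := by
        refine (norm_le_pi_norm _ i).trans ?_
        have := h₂ (q.1 + l i * q.2) (abs_le.1 hfoot) (q.1 + l i * q.2 + h) (by
          rw [add_sub_cancel_left]; exact hh.trans_le (min_le_left _ _))
        rw [add_sub_cancel_left] at this
        have e2 : h⁻¹ • (u₀ (q.1 + l i * q.2 + h) - u₀ (q.1 + l i * q.2))
          - deriv u₀ (q.1 + l i * q.2) = h⁻¹ • (u₀ (q.1 + l i * q.2 + h) - u₀ (q.1 + l i * q.2)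
            - fderiv ℝ u₀ (q.1 + l i * q.2) h) := by
          rw [smul_sub (h⁻¹) _ (fderiv ℝ u₀ (q.1 + l i * q.2) h), ← map_smul, smul_eq_mul,
            inv_mul_cancel₀ h0, fderiv_apply_one_eq_deriv]
        rw [e2, norm_smul, norm_inv]
        rw [inv_mul_le_iff₀ (norm_pos_iff.2 h0), mul_comm ‖h‖]
        exact this
      have b2 : ∀ s ∈ uIcc 0 q.2, ‖h⁻¹ • (F (u ((charPt (l i) q s).1 + h, (charPt (l i) q s).2)) i
            - F (u (charPt (l i) q s)) i)
            - fderiv ℝ F (u (charPt (l i) q s)) (v (charPt (l i) q s)) i‖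
            ≤ (K + 1) * ‖e (charPt (l i) q s)‖ + ε * V := by
        intro s hs
        have hp := charPt_mem_diamond (hl i) hq hs
        set p := charPt (l i) q s
        have a1 : ‖u (p.1 + h, p.2) - u p‖ < δ₁ := by
          rw [← dist_eq_norm, dist_comm]
          refine h₃ (a := p) (b := (p.1 + h, p.2)) ?_ hp
          rw [Prod.dist_eq]
          simp only [dist_self_add_right, dist_self]
          exact max_lt (hh.trans_le (min_le_right _ _)) hδ₃
        have a2 := h₁ (u p) (mem_image_of_mem u hp) (u (p.1 + h, p.2)) a1
        have a3 : h⁻¹ • (F (u (p.1 + h, p.2)) i - F (u p) i) - fderiv ℝ F (u p) (v p) i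
            = (h⁻¹ • (F (u (p.1 + h, p.2)) - F (u p) - fderiv ℝ F (u p) (u (p.1 + h, p.2) - u p))
              + fderiv ℝ F (u p) (e p)) i := by
          simp only [he, map_sub, map_smul, smul_sub, Pi.add_apply, Pi.sub_apply, Pi.smul_apply]
          abel
        rw [a3]
        refine (norm_le_pi_norm _ i).trans ((norm_add_le _ _).trans ?_)
        -- The Taylor remainder is `ε` times the size of the difference quotient `e + v`. Its
        -- `e`-part is absorbed into the constant `K + 1` because `ε ≤ 1`; its `v`-part, integrated
        -- over a time at most `R`, joins `α`.
        have a4 : ‖h⁻¹ • (F (u (p.1 + h, p.2)) - F (u p)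
            - fderiv ℝ F (u p) (u (p.1 + h, p.2) - u p))‖ ≤ ε * (‖e p‖ + ‖v p‖) := by
          calc _ ≤ ‖h⁻¹‖ * (ε * ‖u (p.1 + h, p.2) - u p‖) := by
                rw [norm_smul]; gcongr
            _ = ε * ‖h⁻¹ • (u (p.1 + h, p.2) - u p)‖ := by rw [norm_smul]; ring
            _ = ε * ‖e p + v p‖ := by simp [he]
            _ ≤ _ := by gcongr; exact norm_add_le _ _
        have a5 : ‖fderiv ℝ F (u p) (e p)‖ ≤ K * ‖e p‖ := by
          refine ContinuousLinearMap.le_of_opNorm_le _ ?_ _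
          have := hK _ (hρm p)
          rwa [hρ p hp] at this
        have a6 := hV p hp
        have a7 : ε * ‖e p‖ ≤ 1 * ‖e p‖ := by gcongr
        have a8 : ε * ‖v p‖ ≤ ε * V := by gcongr
        linarith
      have hR' : |q.2| ≤ R := by
        have : |q.1| + |q.2| ≤ R := hq
        linarith [abs_nonneg q.1]
      have b3 : ‖∫ s in (0 : ℝ)..q.2,
          (h⁻¹ • (F (u ((charPt (l i) q s).1 + h, (charPt (l i) q s).2)) i
            - F (u (charPt (l i) q s)) i)
            - fderiv ℝ F (u (charPt (l i) q s)) (v (charPt (l i) q s)) i)‖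
          ≤ |∫ s in (0 : ℝ)..q.2, (K + 1) * ‖e (charPt (l i) q s)‖| + R * (ε * V) := by
        have c0 : Continuous fun s => (K + 1) * ‖e (charPt (l i) q s)‖ := by fun_prop
        refine (intervalIntegral.norm_integral_le_abs_of_norm_le
          (g := fun s => (K + 1) * ‖e (charPt (l i) q s)‖ + ε * V) ?_ ?_).trans ?_
        · refine (MeasureTheory.ae_restrict_iff' measurableSet_uIoc).2
            (Eventually.of_forall fun s hs => b2 s (uIoc_subset_uIcc hs))
        · exact (c0.add continuous_const).intervalIntegrable _ _
        · rw [intervalIntegral.integral_add (c0.intervalIntegrable _ _)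
            (continuous_const.intervalIntegrable _ _)]
          refine (abs_add_le _ _).trans ?_
          gcongr
          rw [intervalIntegral.integral_const, smul_eq_mul, abs_mul, sub_zero,
            abs_of_nonneg (show 0 ≤ ε * V by positivity)]
          gcongr
      rw [e1]
      refine (norm_add_le _ _).trans ?_
      linarith
    have := norm_le_of_forall_le_integral hl (by positivity) (by positivity) hec.continuousOn key
      q₁ hq₁
    calc _ ≤ _ := this
      _ = ε * P := by rw [hP]; ring
  rw [Metric.tendsto_nhdsWithin_nhds]
  intro η hη
  obtain ⟨δ, hδ, hmain⟩ := main (min 1 (η / (2 * P))) (by positivity) (min_le_left _ _)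
  refine ⟨δ, hδ, fun {h} h0 hh => ?_⟩
  rw [dist_eq_norm]
  refine (hmain h h0 (by simpa using hh)).trans_lt ?_
  calc min 1 (η / (2 * P)) * P ≤ η / (2 * P) * P := by gcongr; exact min_le_right _ _
    _ = η / 2 := by field_simp
    _ < η := by linarith

/-- The diamonds exhaust the plane, and uniqueness of derivatives glues the fields found on them.
Continuity at a point is read off from a diamond that is larger by 1 and contains the point in its
interior. -/
lemma exists_hasDerivAt_mild {l : ι → ℝ} (hl : ∀ i, |l i| ≤ 1)
    {F : (ι → E) → (ι → E)} (hF : ContDiff ℝ 1 F) {u₀ : ℝ → ι → E} (hu₀ : ContDiff ℝ 1 u₀)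
    {u : ℝ × ℝ → ι → E} (hu : Continuous u) (hmild : ∀ q, IsMildAt l (fun _ => F) u₀ u q) :
    ∃ v : ℝ × ℝ → ι → E, Continuous v ∧
      (∀ q, IsMildAt l (fun q w => fderiv ℝ F (u q) w) (deriv u₀) v q) ∧
      ∀ q : ℝ × ℝ, HasDerivAt (fun x => u (x, q.2)) (v q) q.1 := by
  have key := fun (R : ℝ) (hR : 0 ≤ R) =>
    exists_hasDerivAt_mild_of_diamond hl hF hu₀ hu hmild hR
  let v : ℝ × ℝ → ι → E := fun q => deriv (fun x => u (x, q.2)) q.1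
  have hself : ∀ q : ℝ × ℝ, q ∈ diamond (|q.1| + |q.2|) := fun q => le_refl (|q.1| + |q.2|)
  have hd : ∀ q : ℝ × ℝ, HasDerivAt (fun x => u (x, q.2)) (v q) q.1 := by
    intro q
    obtain ⟨v', -, -, h⟩ := key (|q.1| + |q.2|) (by positivity)
    exact (h q (hself q)).differentiableAt.hasDerivAt
  refine ⟨v, ?_, ?_, hd⟩
  · refine continuous_iff_continuousAt.2 fun q => ?_
    obtain ⟨v', hv', -, h⟩ := key (|q.1| + |q.2| + 1) (by positivity)
    refine hv'.continuousAt.congr ?_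
    have : {p : ℝ × ℝ | |p.1| + |p.2| < |q.1| + |q.2| + 1} ∈ 𝓝 q :=
      (isOpen_lt (by fun_prop) (by fun_prop)).mem_nhds (by simp)
    filter_upwards [this] with p hp
    exact ((hd p).unique (h p (le_of_lt hp))).symm
  · intro q i
    obtain ⟨v', hv', hm, h⟩ := key (|q.1| + |q.2|) (by positivity)
    rw [(hd q).unique (h q (hself q)), hm q (hself q) i]
    congr 1
    apply intervalIntegral.integral_congr
    intro s hs
    simp only
    have hp := charPt_mem_diamond (hl i) (hself q) hs
    rw [(hd _).unique (h _ hp)]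

/-- A continuous mild solution of a smooth autonomous system with smooth data is smooth. -/
theorem contDiff_of_isMildAt {l : ι → ℝ} (hl : ∀ i, |l i| ≤ 1) (k : ℕ) :
    ∀ {E : Type*} [NormedAddCommGroup E] [NormedSpace ℝ E] [CompleteSpace E]
    {F : (ι → E) → (ι → E)} (_ : ContDiff ℝ ∞ F) {u₀ : ℝ → ι → E} (_ : ContDiff ℝ ∞ u₀)
    {u : ℝ × ℝ → ι → E} (_ : Continuous u) (_ : ∀ q, IsMildAt l (fun _ => F) u₀ u q),
    ContDiff ℝ k u := by
  induction k with
  | zero => intro E _ _ _ F hF u₀ hu₀ u hu hmild; exact contDiff_zero.2 hu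
  | succ k ih =>
    intro E _ _ _ F hF u₀ hu₀ u hu hmild
    obtain ⟨v, hv, hvm, hd⟩ := exists_hasDerivAt_mild hl (hF.of_le (by simp)) (hu₀.of_le (by simp))
      hu hmild
    -- The pair `(u, ∂_x u)` solves a smooth autonomous system of the same form with values in `E ×
    -- E`, so the induction hypothesis applies to it. This is why `E` is quantified inside the
    -- induction.
    let F₁ : (ι → E × E) → (ι → E × E) := fun w i =>
      (F (fun j => (w j).1) i, fderiv ℝ F (fun j => (w j).1) (fun j => (w j).2) i)
    have hF₁ : ContDiff ℝ ∞ F₁ := by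
      refine contDiff_pi.2 fun i => ?_
      have hfst : ContDiff ℝ ∞ fun (w : ι → E × E) (j : ι) => (w j).1 := by fun_prop
      have hsnd : ContDiff ℝ ∞ fun (w : ι → E × E) (j : ι) => (w j).2 := by fun_prop
      have h1 : ContDiff ℝ ∞ (fderiv ℝ F) := hF.fderiv_right (by simp)
      refine ContDiff.prodMk ?_ ?_
      · exact contDiff_pi.1 (hF.comp hfst) i
      · exact contDiff_pi.1 ((h1.comp hfst).clm_apply hsnd) i
    have hu₁ : ContDiff ℝ ∞ fun x (i : ι) => (u₀ x i, deriv u₀ x i) := by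
      refine contDiff_pi.2 fun i => ContDiff.prodMk ?_ ?_
      · exact contDiff_pi.1 hu₀ i
      · exact contDiff_pi.1 (contDiff_infty_iff_deriv.1 hu₀).2 i
    have hFc : Continuous F := hF.continuous
    have hdFc : Continuous (fderiv ℝ F) := hF.continuous_fderiv (by simp)
    have hk := ih hF₁ hu₁ (u := fun q i => (u q i, v q i)) (by fun_prop) (by
      intro q i
      change (u q i, v q i) = _
      rw [hmild q i, hvm q i]
      have c1 : Continuous fun s => F (u (charPt (l i) q s)) i :=
        (continuous_apply i).comp (by fun_prop)
      have c2 : Continuous fun s => fderiv ℝ F (u (charPt (l i) q s)) (v (charPt (l i) q s)) i :=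
        (continuous_apply i).comp (by fun_prop)
      have c3 : Continuous fun s => ((F (u (charPt (l i) q s)) i,
        fderiv ℝ F (u (charPt (l i) q s)) (v (charPt (l i) q s)) i) : E × E) := c1.prodMk c2
      ext
      · have := ContinuousLinearMap.intervalIntegral_comp_comm (ContinuousLinearMap.fst ℝ E E)
          (c3.intervalIntegrable (μ := MeasureTheory.volume) 0 q.2)
        simp only [ContinuousLinearMap.coe_fst'] at this
        simp only [F₁, Prod.fst_add]
        rw [← this]
      · have := ContinuousLinearMap.intervalIntegral_comp_comm (ContinuousLinearMap.snd ℝ E E)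
          (c3.intervalIntegrable (μ := MeasureTheory.volume) 0 q.2)
        simp only [ContinuousLinearMap.coe_snd'] at this
        simp only [F₁, Prod.snd_add]
        rw [← this])
    have hku : ContDiff ℝ k u := by
      refine contDiff_pi.2 fun i => ?_
      exact (contDiff_pi.1 hk i).fst
    have hkv : ContDiff ℝ k v := by
      refine contDiff_pi.2 fun i => ?_
      exact (contDiff_pi.1 hk i).snd
    refine contDiff_pi.2 fun i => ?_
    -- straighten the characteristics of the `i`-th component
    let T : ℝ × ℝ → ℝ × ℝ := fun q => (q.1 - l i * q.2, q.2)
    have hT : ∀ m : WithTop ℕ∞, ContDiff ℝ m T := fun m => by simp only [T]; fun_prop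
    let a : ℝ → ℝ → E := fun y t => u (T (y, t)) i
    let a₁ : ℝ → ℝ → ℝ →L[ℝ] E := fun y t => ContinuousLinearMap.toSpanSingleton ℝ (v (T (y, t)) i)
    let a₂ : ℝ → ℝ → ℝ →L[ℝ] E := fun y t =>
      ContinuousLinearMap.toSpanSingleton ℝ (F (u (T (y, t))) i)
    have hTc : Continuous T := (hT 0).continuous
    have k1 : ContDiff ℝ k ↿a₁ := by
      have : ContDiff ℝ k fun q : ℝ × ℝ => v (T q) i := contDiff_pi.1 (hkv.comp (hT k)) i
      exact (ContinuousLinearMap.toSpanSingletonCLE (𝕜 := ℝ) (E := E)).contDiff.comp this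
    have k2 : ContDiff ℝ k ↿a₂ := by
      have : ContDiff ℝ k fun q : ℝ × ℝ => F (u (T q)) i :=
        contDiff_pi.1 ((hF.of_le (by exact_mod_cast le_top)).comp (hku.comp (hT k))) i
      exact (ContinuousLinearMap.toSpanSingletonCLE (𝕜 := ℝ) (E := E)).contDiff.comp this
    have d1 : ∀ q : ℝ × ℝ, HasFDerivAt (fun y => a y q.2) (a₁ q.1 q.2) q.1 := by
      intro q
      have h1 := hd (T q)
      have h2 := (hasDerivAt_pi.1 h1) i
      exact (HasDerivAt.comp_sub_const (f := fun x => u (x, q.2) i) q.1 (l i * q.2) h2).hasFDerivAt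
    have d2 : ∀ q : ℝ × ℝ, HasFDerivAt (fun t => a q.1 t) (a₂ q.1 q.2) q.2 := by
      intro q
      have h1 : (fun t => a q.1 t) = fun t => u₀ q.1 i + ∫ s in (0 : ℝ)..t, F (u (T (q.1, s))) i := by
        funext t
        simp only [a]
        rw [hmild]
        simp only [T, charPt]
        congr 2
        · ring_nf
        · ext s; ring_nf
      rw [h1]
      have c1 : Continuous fun s => F (u (T (q.1, s))) i :=
        (continuous_apply i).comp (by fun_prop)
      exact ((c1.integral_hasStrictDerivAt 0 q.2).hasDerivAt.const_add _).hasFDerivAt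
    -- In the straightened coordinates both partial derivatives are already `C^k`: one is `∂_x u`,
    -- the other is the source `F (u)`, by the integral equation.
    have ha : ContDiff ℝ (k + 1) ↿a := by
      rw [contDiff_succ_iff_hasFDerivAt]
      refine ⟨fun q => (↿a₁ q).coprod (↿a₂ q), ?_, fun q => ?_⟩
      · have : ContDiff ℝ k fun q => (↿a₁ q ∘L ContinuousLinearMap.fst ℝ ℝ ℝ)
            + (↿a₂ q ∘L ContinuousLinearMap.snd ℝ ℝ ℝ) :=
          (k1.clm_comp contDiff_const).add (k2.clm_comp contDiff_const)
        convert! this using 2 with q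
      · exact (hasStrictFDerivAt_uncurry_coprod (Eventually.of_forall d1) (Eventually.of_forall d2)
          k1.continuous.continuousAt k2.continuous.continuousAt).hasFDerivAt
    have hfin : (fun q : ℝ × ℝ => u q i) = ↿a ∘ fun q : ℝ × ℝ => (q.1 + l i * q.2, q.2) := by
      funext q
      simp [a, T, Function.HasUncurry.uncurry]
    rw [hfin]
    push_cast
    exact ha.comp (by fun_prop)

end Regularity

/-! ### Semilinear wave equations in null form. -/

section SecondOrder

open Set Filter Topology

variable {V : Type*} [NormedAddCommGroup V] [NormedSpace ℝ V]

/-- The `x`-derivative of a function of `(x, t)`. -/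
noncomputable def dX (f : ℝ × ℝ → V) (q : ℝ × ℝ) : V := fderiv ℝ f q (1, 0)

/-- The `t`-derivative of a function of `(x, t)`. -/
noncomputable def dT (f : ℝ × ℝ → V) (q : ℝ × ℝ) : V := fderiv ℝ f q (0, 1)

/-- The wave operator `∂_t² - ∂_x²`. -/
noncomputable def waveOp (f : ℝ × ℝ → V) (q : ℝ × ℝ) : V := dT (dT f) q - dX (dX f) q

lemma fderiv_eq_dX_dT (f : ℝ × ℝ → V) (q : ℝ × ℝ) (a b : ℝ) :
    fderiv ℝ f q (a, b) = a • dX f q + b • dT f q := by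
  rw [dX, dT, ← map_smul, ← map_smul, ← map_add]
  simp

lemma ContDiffAt.dX {f : ℝ × ℝ → V} {q : ℝ × ℝ} (hf : ContDiffAt ℝ ∞ f q) :
    ContDiffAt ℝ ∞ (dX f) q :=
  (hf.fderiv_right (m := ∞) (by simp)).clm_apply contDiffAt_const

lemma ContDiffAt.dT {f : ℝ × ℝ → V} {q : ℝ × ℝ} (hf : ContDiffAt ℝ ∞ f q) :
    ContDiffAt ℝ ∞ (dT f) q :=
  (hf.fderiv_right (m := ∞) (by simp)).clm_apply contDiffAt_const

lemma Filter.EventuallyEq.dX {f g : ℝ × ℝ → V} {q : ℝ × ℝ} (h : f =ᶠ[𝓝 q] g) :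
    dX f =ᶠ[𝓝 q] dX g := by
  filter_upwards [h.fderiv (𝕜 := ℝ)] with p hp
  rw [_root_.dX, _root_.dX, hp]

lemma Filter.EventuallyEq.dT {f g : ℝ × ℝ → V} {q : ℝ × ℝ} (h : f =ᶠ[𝓝 q] g) :
    dT f =ᶠ[𝓝 q] dT g := by
  filter_upwards [h.fderiv (𝕜 := ℝ)] with p hp
  rw [_root_.dT, _root_.dT, hp]

lemma dT_dX_comm {f : ℝ × ℝ → V} {q : ℝ × ℝ} (hf : ContDiffAt ℝ ∞ f q) :
    dT (dX f) q = dX (dT f) q := by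
  have hsymm : IsSymmSndFDerivAt ℝ f q :=
    (hf.of_le (m := 2) (WithTop.coe_le_coe.2 le_top)).isSymmSndFDerivAt (by simp)
  have hd : DifferentiableAt ℝ (fderiv ℝ f) q :=
    (hf.fderiv_right (m := ∞) (by simp)).differentiableAt (by simp)
  have h1 : ∀ v w : ℝ × ℝ, fderiv ℝ (fun p => fderiv ℝ f p v) q w
      = fderiv ℝ (fderiv ℝ f) q w v := by
    intro v w
    rw [fderiv_clm_apply hd (differentiableAt_const v)]
    simp
  change fderiv ℝ (fun p => fderiv ℝ f p (1, 0)) q (0, 1)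
    = fderiv ℝ (fun p => fderiv ℝ f p (0, 1)) q (1, 0)
  rw [h1, h1]
  exact hsymm.eq _ _

lemma hasDerivAt_comp_charPt {f : ℝ × ℝ → V} (l : ℝ) (q : ℝ × ℝ) {s : ℝ}
    (hf : DifferentiableAt ℝ f (charPt l q s)) :
    HasDerivAt (fun s => f (charPt l q s)) (dT f (charPt l q s) - l • dX f (charPt l q s)) s := by
  have h1 : HasDerivAt (fun s => charPt l q s) (-l, 1) s := by
    refine HasDerivAt.prodMk ?_ (hasDerivAt_id s)
    have := (((hasDerivAt_id s).const_sub q.2).const_mul l).const_add q.1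
    simpa using this
  have := hf.hasFDerivAt.comp_hasDerivAt s h1
  rw [fderiv_eq_dX_dT, neg_smul, one_smul, ← sub_eq_neg_add] at this
  exact this

lemma charPt_self (l : ℝ) (q : ℝ × ℝ) : charPt l q q.2 = q := by simp [charPt]

lemma dX_eq_deriv {f : ℝ × ℝ → V} {q : ℝ × ℝ} (hf : DifferentiableAt ℝ f q) :
    HasDerivAt (fun x => f (x, q.2)) (dX f q) q.1 := by
  have h1 : HasDerivAt (fun x : ℝ => ((x, q.2) : ℝ × ℝ)) (1, 0) q.1 :=
    (hasDerivAt_id _).prodMk (hasDerivAt_const _ _)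
  exact hf.hasFDerivAt.comp_hasDerivAt q.1 h1

lemma dT_eq_deriv {f : ℝ × ℝ → V} {q : ℝ × ℝ} (hf : DifferentiableAt ℝ f q) :
    HasDerivAt (fun t => f (q.1, t)) (dT f q) q.2 := by
  have h1 : HasDerivAt (fun t : ℝ => ((q.1, t) : ℝ × ℝ)) (0, 1) q.2 :=
    (hasDerivAt_const _ _).prodMk (hasDerivAt_id _)
  exact hf.hasFDerivAt.comp_hasDerivAt q.2 h1

lemma dX_add {f g : ℝ × ℝ → V} {q : ℝ × ℝ} (hf : DifferentiableAt ℝ f q)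
    (hg : DifferentiableAt ℝ g q) : dX (fun p => f p + g p) q = dX f q + dX g q := by
  simp only [dX]; rw [fderiv_fun_add hf hg]; rfl

lemma dT_add {f g : ℝ × ℝ → V} {q : ℝ × ℝ} (hf : DifferentiableAt ℝ f q)
    (hg : DifferentiableAt ℝ g q) : dT (fun p => f p + g p) q = dT f q + dT g q := by
  simp only [dT]; rw [fderiv_fun_add hf hg]; rfl

lemma dX_sub {f g : ℝ × ℝ → V} {q : ℝ × ℝ} (hf : DifferentiableAt ℝ f q)
    (hg : DifferentiableAt ℝ g q) : dX (fun p => f p - g p) q = dX f q - dX g q := by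
  simp only [dX]; rw [fderiv_fun_sub hf hg]; rfl

lemma dT_sub {f g : ℝ × ℝ → V} {q : ℝ × ℝ} (hf : DifferentiableAt ℝ f q)
    (hg : DifferentiableAt ℝ g q) : dT (fun p => f p - g p) q = dT f q - dT g q := by
  simp only [dT]; rw [fderiv_fun_sub hf hg]; rfl

lemma dX_smul {f : ℝ × ℝ → V} {q : ℝ × ℝ} (c : ℝ) (hf : DifferentiableAt ℝ f q) :
    dX (fun p => c • f p) q = c • dX f q := by
  simp only [dX]; rw [fderiv_fun_const_smul hf]; rfl

lemma dT_smul {f : ℝ × ℝ → V} {q : ℝ × ℝ} (c : ℝ) (hf : DifferentiableAt ℝ f q) :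
    dT (fun p => c • f p) q = c • dT f q := by
  simp only [dT]; rw [fderiv_fun_const_smul hf]; rfl

lemma dX_comp_sub (f : ℝ × ℝ → V) (c q : ℝ × ℝ) : dX (fun p => f (p - c)) q = dX f (q - c) := by
  simp only [dX]; rw [fderiv_comp_sub]

lemma dT_comp_sub (f : ℝ × ℝ → V) (c q : ℝ × ℝ) : dT (fun p => f (p - c)) q = dT f (q - c) := by
  simp only [dT]; rw [fderiv_comp_sub]

lemma waveOp_comp_sub (f : ℝ × ℝ → V) (c q : ℝ × ℝ) :
    waveOp (fun p => f (p - c)) q = waveOp f (q - c) := by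
  have h1 : dT (fun p => f (p - c)) = fun q => dT f (q - c) := funext fun q => dT_comp_sub f c q
  have h2 : dX (fun p => f (p - c)) = fun q => dX f (q - c) := funext fun q => dX_comp_sub f c q
  rw [waveOp, h1, h2, dT_comp_sub, dX_comp_sub, waveOp]

/-- `(∂_t - ∂_x)(∂_t + ∂_x) f` is the wave operator. -/
lemma dT_sub_dX_of_add {f : ℝ × ℝ → V} {q : ℝ × ℝ} (hf : ContDiffAt ℝ ∞ f q) :
    dT (fun p => dT f p + dX f p) q - dX (fun p => dT f p + dX f p) q = waveOp f q := by
  have h1 := hf.dT.differentiableAt (by simp)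
  have h2 := hf.dX.differentiableAt (by simp)
  rw [dT_add h1 h2, dX_add h1 h2, dT_dX_comm hf, waveOp]
  abel

/-- `(∂_t + ∂_x)(∂_t - ∂_x) f` is the wave operator. -/
lemma dT_add_dX_of_sub {f : ℝ × ℝ → V} {q : ℝ × ℝ} (hf : ContDiffAt ℝ ∞ f q) :
    dT (fun p => dT f p - dX f p) q + dX (fun p => dT f p - dX f p) q = waveOp f q := by
  have h1 := hf.dT.differentiableAt (by simp)
  have h2 := hf.dX.differentiableAt (by simp)
  rw [dT_sub h1 h2, dX_sub h1 h2, dT_dX_comm hf, waveOp]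
  abel

/-- The speeds of the first-order system for `(ψ, ∂_t ψ + ∂_x ψ, ∂_t ψ - ∂_x ψ)`. -/
noncomputable def waveSpeed : Fin 3 → ℝ := ![0, 1, -1]

lemma abs_waveSpeed_le (i : Fin 3) : |waveSpeed i| ≤ 1 := by
  fin_cases i <;> simp [waveSpeed]

/-- The source of the first-order system equivalent to `□ψ = H(ψ, ∂_t ψ + ∂_x ψ, ∂_t ψ - ∂_x ψ)`. -/
noncomputable def waveSource (H : V × V × V → V) (w : Fin 3 → V) : Fin 3 → V :=
  ![(1 / 2 : ℝ) • (w 1 + w 2), H (w 0, w 1, w 2), H (w 0, w 1, w 2)]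

lemma contDiff_waveSource {H : V × V × V → V} (hH : ContDiff ℝ ∞ H) :
    ContDiff ℝ ∞ (waveSource H) := by
  refine contDiff_pi.2 fun i => ?_
  fin_cases i <;> simp only [waveSource, Fin.zero_eta, Fin.mk_one, Fin.reduceFinMk,
    Matrix.cons_val] <;> fun_prop

omit [NormedSpace ℝ V] in
lemma norm_triple_sub_le (w w' : Fin 3 → V) :
    ‖((w 0, w 1, w 2) : V × V × V) - (w' 0, w' 1, w' 2)‖ ≤ ‖w - w'‖ := by
  have h : ∀ i, ‖w i - w' i‖ ≤ ‖w - w'‖ := fun i => norm_le_pi_norm (w - w') i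
  rw [Prod.norm_def, Prod.norm_def]
  exact max_le (h 0) (max_le (h 1) (h 2))

lemma norm_waveSource_sub_le {H : V × V × V → V} {K : ℝ} (hK0 : 0 ≤ K)
    (hK : ∀ p p', ‖H p - H p'‖ ≤ K * ‖p - p'‖) (w w' : Fin 3 → V) :
    ‖waveSource H w - waveSource H w'‖ ≤ (K + 1) * ‖w - w'‖ := by
  have h : ∀ i, ‖w i - w' i‖ ≤ ‖w - w'‖ := fun i => norm_le_pi_norm (w - w') i
  have h0 := norm_nonneg (w - w')
  have hH : ‖H (w 0, w 1, w 2) - H (w' 0, w' 1, w' 2)‖ ≤ (K + 1) * ‖w - w'‖ := by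
    refine (hK _ _).trans ?_
    have := mul_le_mul_of_nonneg_left (norm_triple_sub_le w w') hK0
    linarith
  refine (pi_norm_le_iff_of_nonneg (by positivity)).2 fun i => ?_
  rw [Pi.sub_apply]
  fin_cases i
  · change ‖(1 / 2 : ℝ) • (w 1 + w 2) - (1 / 2 : ℝ) • (w' 1 + w' 2)‖ ≤ _
    rw [← smul_sub, show w 1 + w 2 - (w' 1 + w' 2) = (w 1 - w' 1) + (w 2 - w' 2) by abel, norm_smul]
    have := norm_add_le (w 1 - w' 1) (w 2 - w' 2)
    rw [Real.norm_of_nonneg (by norm_num)]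
    nlinarith [h 1, h 2]
  · exact hH
  · exact hH

/-- Global solution of a semilinear second-order equation with globally Lipschitz source, with
bounds on the propagation of `∂_t ψ ± ∂_x ψ`. -/
lemma exists_global_waveOp_eq [CompleteSpace V] {H : V × V × V → V} (hH : ContDiff ℝ ∞ H) {K M : ℝ}
    (hK0 : 0 ≤ K) (hK : ∀ p p', ‖H p - H p'‖ ≤ K * ‖p - p'‖) (hM : ∀ p, ‖H p‖ ≤ M)
    {ψ₀ ψ₁ : ℝ → V} (h₀ : ContDiff ℝ ∞ ψ₀) (h₁ : ContDiff ℝ ∞ ψ₁) {C : ℝ}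
    (hC₀ : ∀ x, ‖ψ₀ x‖ ≤ C) (hC₁ : ∀ x, ‖ψ₁ x‖ ≤ C) (hC₂ : ∀ x, ‖deriv ψ₀ x‖ ≤ C) :
    ∃ ψ : ℝ × ℝ → V, ContDiff ℝ ∞ ψ ∧ (∀ x, ψ (x, 0) = ψ₀ x) ∧ (∀ x, dT ψ (x, 0) = ψ₁ x) ∧
      (∀ q, waveOp ψ q = H (ψ q, dT ψ q + dX ψ q, dT ψ q - dX ψ q)) ∧
      (∀ q : ℝ × ℝ, ‖(dT ψ q + dX ψ q) - (ψ₁ (q.1 + q.2) + deriv ψ₀ (q.1 + q.2))‖ ≤ M * |q.2|) ∧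
      (∀ q : ℝ × ℝ, ‖(dT ψ q - dX ψ q) - (ψ₁ (q.1 - q.2) - deriv ψ₀ (q.1 - q.2))‖ ≤ M * |q.2|) := by
  have hM0 : 0 ≤ M := (norm_nonneg _).trans (hM 0)
  have hd₀ : ContDiff ℝ ∞ (deriv ψ₀) := (contDiff_infty_iff_deriv.1 h₀).2
  let u₀ : ℝ → Fin 3 → V := fun x => ![ψ₀ x, ψ₁ x + deriv ψ₀ x, ψ₁ x - deriv ψ₀ x]
  have hu₀ : ContDiff ℝ ∞ u₀ := by
    refine contDiff_pi.2 fun i => ?_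
    fin_cases i <;> simp only [u₀, Fin.zero_eta, Fin.mk_one, Fin.reduceFinMk,
      Matrix.cons_val] <;> fun_prop
  have hC0 : 0 ≤ C := (norm_nonneg _).trans (hC₀ 0)
  have hu₀b : ∀ x, ‖u₀ x‖ ≤ 2 * C := by
    intro x
    refine (pi_norm_le_iff_of_nonneg (by positivity)).2 fun i => ?_
    fin_cases i
    · exact (hC₀ x).trans (by linarith)
    · exact (norm_add_le _ _).trans (by linarith [hC₁ x, hC₂ x])
    · exact (norm_sub_le _ _).trans (by linarith [hC₁ x, hC₂ x])
  have hF := contDiff_waveSource hH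
  obtain ⟨u, hu, hmild⟩ := exists_isMildAt waveSpeed (F := fun _ => waveSource H)
    (hF.continuous.comp continuous_snd)
    (fun _ => norm_waveSource_sub_le hK0 hK) (fun _ => le_rfl) hu₀.continuous hu₀b
  have hus : ContDiff ℝ ∞ u := contDiff_infty.2 fun k =>
    contDiff_of_isMildAt abs_waveSpeed_le k hF hu₀ hu hmild
  have hui : ∀ i, ContDiff ℝ ∞ fun q => u q i := fun i => contDiff_pi.1 hus i
  have hdi : ∀ i q, DifferentiableAt ℝ (fun q => u q i) q := fun i q =>
    (hui i).contDiffAt.differentiableAt (by simp)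
  have hinit : ∀ x i, u (x, 0) i = u₀ x i := fun x i => by rw [hmild]; simp
  have hpde : ∀ q i, dT (fun q => u q i) q - waveSpeed i • dX (fun q => u q i) q
      = waveSource H (u q) i := by
    intro q i
    have h1 := hasDerivAt_comp_charPt (waveSpeed i) q (s := q.2) (hdi i _)
    rw [charPt_self] at h1
    have h2 : (fun s => u (charPt (waveSpeed i) q s) i) = fun s => u₀ (q.1 + waveSpeed i * q.2) i +
        ∫ r in (0 : ℝ)..s, waveSource H (u (charPt (waveSpeed i) q r)) i := by
      funext s
      rw [hmild]
      simp only [charPt]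
      congr 2
      · ring_nf
      · ext r; ring_nf
    rw [h2] at h1
    have c1 : Continuous fun r => waveSource H (u (charPt (waveSpeed i) q r)) i := by
      have := hF.continuous
      exact (continuous_apply i).comp (by fun_prop)
    have h3 := ((c1.integral_hasStrictDerivAt 0 q.2).hasDerivAt.const_add
      (u₀ (q.1 + waveSpeed i * q.2) i))
    rw [charPt_self] at h3
    exact h1.unique h3
  let ψ : ℝ × ℝ → V := fun q => u q 0
  let a : ℝ × ℝ → V := fun q => u q 1
  let b : ℝ × ℝ → V := fun q => u q 2
  have pψ : ∀ q, dT ψ q = (1 / 2 : ℝ) • (a q + b q) := by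
    intro q
    have := hpde q 0
    simpa [waveSpeed, waveSource] using this
  have pa : ∀ q, dT a q - dX a q = H (ψ q, a q, b q) := by
    intro q
    have := hpde q 1
    simpa [waveSpeed, waveSource] using this
  have pb : ∀ q, dT b q + dX b q = H (ψ q, a q, b q) := by
    intro q
    have := hpde q 2
    simpa [waveSpeed, waveSource] using this
  have hψ : ContDiff ℝ ∞ ψ := hui 0
  have hψd : ∀ q, DifferentiableAt ℝ ψ q := hdi 0
  have had : ∀ q, DifferentiableAt ℝ a q := hdi 1
  have hbd : ∀ q, DifferentiableAt ℝ b q := hdi 2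
  have hdTψ : dT ψ = fun q => (1 / 2 : ℝ) • (a q + b q) := funext pψ
  -- The system itself only says `∂_t ψ = (a + b) / 2`. For `a` and `b` to be the null derivatives
  -- of `ψ`, this constraint is needed too. It propagates: the source cancels between the equations
  -- for `a` and `b`, so the defect has zero `t`-derivative, and it vanishes at `t = 0`.
  have hw : ∀ q, dX ψ q = (1 / 2 : ℝ) • (a q - b q) := by
    intro q
    have hdw : ∀ p, DifferentiableAt ℝ (fun p => dX ψ p - (1 / 2 : ℝ) • (a p - b p)) p := fun p =>
      (hψ.contDiffAt.dX.differentiableAt (by simp)).sub (((had p).sub (hbd p)).const_smul _)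
    have hz : ∀ p, dT (fun p => dX ψ p - (1 / 2 : ℝ) • (a p - b p)) p = 0 := by
      intro p
      rw [dT_sub (g := fun p => (1 / 2 : ℝ) • (a p - b p))
        (hψ.contDiffAt.dX.differentiableAt (by simp)) (((had p).sub (hbd p)).const_smul (1 / 2 : ℝ)),
        dT_smul (f := fun p => a p - b p) _ ((had p).sub (hbd p)), dT_sub (had p) (hbd p),
        dT_dX_comm hψ.contDiffAt, hdTψ, dX_smul (f := fun p => a p + b p) _ ((had p).add (hbd p)),
        dX_add (had p) (hbd p), ← smul_sub]
      have e1 : dT a p = H (ψ p, a p, b p) + dX a p := by rw [← pa p]; abel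
      have e2 : dT b p = H (ψ p, a p, b p) - dX b p := by rw [← pb p]; abel
      rw [e1, e2, show dX a p + dX b p - (H (ψ p, a p, b p) + dX a p
        - (H (ψ p, a p, b p) - dX b p)) = 0 by abel, smul_zero]
    have hconst := is_const_of_deriv_eq_zero
      (f := fun t => dX ψ (q.1, t) - (1 / 2 : ℝ) • (a (q.1, t) - b (q.1, t)))
      (fun t => (dT_eq_deriv (hdw (q.1, t))).differentiableAt)
      (fun t => by rw [(dT_eq_deriv (hdw (q.1, t))).deriv, hz]) q.2 0
    have hX0 : dX ψ (q.1, 0) = deriv ψ₀ q.1 := by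
      have h1 := (dX_eq_deriv (hψd (q.1, 0))).deriv
      rw [← h1]
      congr 1
      funext x
      exact hinit x 0
    have hzero : dX ψ (q.1, 0) - (1 / 2 : ℝ) • (a (q.1, 0) - b (q.1, 0)) = 0 := by
      have ea : a (q.1, 0) = ψ₁ q.1 + deriv ψ₀ q.1 := hinit q.1 1
      have eb : b (q.1, 0) = ψ₁ q.1 - deriv ψ₀ q.1 := hinit q.1 2
      rw [hX0, ea, eb, add_sub_sub_cancel, ← two_smul ℝ, smul_smul]
      norm_num
    have hfin : dX ψ q - (1 / 2 : ℝ) • (a q - b q) = 0 := by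
      have := hconst.trans hzero
      simpa using this
    exact sub_eq_zero.1 hfin
  have ha : ∀ q, dT ψ q + dX ψ q = a q := by
    intro q
    rw [pψ, hw, ← smul_add, show a q + b q + (a q - b q) = (2 : ℝ) • a q by
      rw [two_smul]; abel, smul_smul]
    norm_num
  have hb : ∀ q, dT ψ q - dX ψ q = b q := by
    intro q
    rw [pψ, hw, ← smul_sub, show a q + b q - (a q - b q) = (2 : ℝ) • b q by
      rw [two_smul]; abel, smul_smul]
    norm_num
  refine ⟨ψ, hψ, fun x => hinit x 0, fun x => ?_, fun q => ?_, fun q => ?_, fun q => ?_⟩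
  · have ea : a (x, 0) = ψ₁ x + deriv ψ₀ x := hinit x 1
    have eb : b (x, 0) = ψ₁ x - deriv ψ₀ x := hinit x 2
    rw [pψ, ea, eb, add_add_sub_cancel, ← two_smul ℝ, smul_smul]
    norm_num
  · rw [ha, hb, ← pa q, ← dT_sub_dX_of_add hψ.contDiffAt]
    have : (fun p => dT ψ p + dX ψ p) = a := funext ha
    rw [this]
  · rw [ha]
    have h1 : a q = _ := hmild q 1
    have h2 : (∫ s in (0 : ℝ)..q.2, waveSource H (u (charPt (waveSpeed 1) q s)) 1)
        = a q - (ψ₁ (q.1 + q.2) + deriv ψ₀ (q.1 + q.2)) := by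
      rw [h1]
      simp [u₀, waveSpeed]
    rw [← h2]
    have := intervalIntegral.norm_integral_le_of_norm_le_const (a := 0) (b := q.2) (C := M)
      (f := fun s => waveSource H (u (charPt (waveSpeed 1) q s)) 1) (fun s _ => hM _)
    simpa using this
  · rw [hb]
    have h1 : b q = _ := hmild q 2
    have h2 : (∫ s in (0 : ℝ)..q.2, waveSource H (u (charPt (waveSpeed 2) q s)) 2)
        = b q - (ψ₁ (q.1 - q.2) - deriv ψ₀ (q.1 - q.2)) := by
      rw [h1]
      simp [u₀, waveSpeed, sub_eq_add_neg]
      abel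
    rw [← h2]
    have := intervalIntegral.norm_integral_le_of_norm_le_const (a := 0) (b := q.2) (C := M)
      (f := fun s => waveSource H (u (charPt (waveSpeed 2) q s)) 2) (fun s _ => hM _)
    simpa using this

/-- The open diamond of radius `r` centred at `c`. -/
def openDiamond (c : ℝ × ℝ) (r : ℝ) : Set (ℝ × ℝ) := {q | |q.1 - c.1| + |q.2 - c.2| < r}

lemma isOpen_openDiamond (c : ℝ × ℝ) (r : ℝ) : IsOpen (openDiamond c r) :=
  isOpen_lt (by fun_prop) (by fun_prop)

/-- The triples `(ψ, ψ_t + ψ_x, ψ_t - ψ_x)` solve one Lipschitz system with the same data; the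
`x`-derivatives on the initial line agree because the values do. Gronwall with `α = 0`, on the
closed diamond through the given point, makes the triples equal. -/
lemma eq_on_openDiamond_zero [CompleteSpace V] {H : V × V × V → V} {K : ℝ} (hK0 : 0 ≤ K)
    (hK : ∀ p p', ‖H p - H p'‖ ≤ K * ‖p - p'‖) {r : ℝ} {ψ ψ' : ℝ × ℝ → V}
    (hψ : ∀ q ∈ openDiamond 0 r, ContDiffAt ℝ ∞ ψ q)
    (hψ' : ∀ q ∈ openDiamond 0 r, ContDiffAt ℝ ∞ ψ' q)
    (he : ∀ q ∈ openDiamond 0 r, waveOp ψ q = H (ψ q, dT ψ q + dX ψ q, dT ψ q - dX ψ q))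
    (he' : ∀ q ∈ openDiamond 0 r, waveOp ψ' q = H (ψ' q, dT ψ' q + dX ψ' q, dT ψ' q - dX ψ' q))
    (h0 : ∀ x, |x| < r → ψ (x, 0) = ψ' (x, 0))
    (h1 : ∀ x, |x| < r → dT ψ (x, 0) = dT ψ' (x, 0)) :
    ∀ q ∈ openDiamond 0 r, ψ q = ψ' q := by
  intro q hq
  have hq' : |q.1| + |q.2| < r := by simpa [openDiamond] using hq
  set R := |q.1| + |q.2| with hR
  have hsub : ∀ p ∈ diamond R, p ∈ openDiamond 0 r := by
    intro p hp
    have hp' : |p.1| + |p.2| ≤ R := hp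
    change |p.1 - 0| + |p.2 - 0| < r
    rw [sub_zero, sub_zero]
    linarith
  let U : (ℝ × ℝ → V) → ℝ × ℝ → Fin 3 → V := fun f p => ![f p, dT f p + dX f p, dT f p - dX f p]
  have hUs : ∀ f : ℝ × ℝ → V, ∀ p, ContDiffAt ℝ ∞ f p → ∀ i,
      ContDiffAt ℝ ∞ (fun p => U f p i) p := by
    intro f p hf i
    fin_cases i
    · exact hf
    · exact hf.dT.add hf.dX
    · exact hf.dT.sub hf.dX
  have hUc : ∀ f : ℝ × ℝ → V, (∀ p ∈ openDiamond 0 r, ContDiffAt ℝ ∞ f p) →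
      ContinuousOn (U f) (diamond R) := by
    intro f hf p hp
    refine ContinuousAt.continuousWithinAt (continuousAt_pi.2 fun i => ?_)
    exact (hUs f p (hf p (hsub p hp)) i).continuousAt
  have hUd : ∀ f : ℝ × ℝ → V, (∀ p ∈ openDiamond 0 r, ContDiffAt ℝ ∞ f p) →
      (∀ q ∈ openDiamond 0 r, waveOp f q = H (f q, dT f q + dX f q, dT f q - dX f q)) →
      ∀ p ∈ diamond R, ∀ i, ∀ s ∈ uIcc 0 p.2,
        HasDerivAt (fun s => U f (charPt (waveSpeed i) p s) i)
          (waveSource H (U f (charPt (waveSpeed i) p s)) i) s := by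
    intro f hf hfe p hp i s hs
    have hm := hsub _ (charPt_mem_diamond (abs_waveSpeed_le i) hp hs)
    have hd := hasDerivAt_comp_charPt (waveSpeed i) p (s := s)
      ((hUs f _ (hf _ hm) i).differentiableAt (by simp))
    convert hd using 1
    set p' := charPt (waveSpeed i) p s
    fin_cases i
    · simp only [waveSource, U, waveSpeed, Fin.zero_eta, Matrix.cons_val, zero_smul, sub_zero]
      rw [show dT f p' + dX f p' + (dT f p' - dX f p') = (2 : ℝ) • dT f p' by
        rw [two_smul]; abel, smul_smul]
      norm_num
    · simp only [waveSource, U, waveSpeed, Fin.mk_one, Matrix.cons_val, one_smul]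
      rw [dT_sub_dX_of_add (hf _ hm), hfe _ hm]
    · simp only [waveSource, U, waveSpeed, Fin.reduceFinMk, Matrix.cons_val, neg_smul, one_smul,
        sub_neg_eq_add]
      rw [dT_add_dX_of_sub (hf _ hm), hfe _ hm]
  have hUi : ∀ x, |x| < r → ∀ i, U ψ (x, 0) i = U ψ' (x, 0) i := by
    intro x hx
    have hxm : ((x, 0) : ℝ × ℝ) ∈ openDiamond 0 r := by simpa [openDiamond] using hx
    have e1 : dX ψ (x, 0) = dX ψ' (x, 0) := by
      rw [← (dX_eq_deriv ((hψ _ hxm).differentiableAt (by simp))).deriv,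
        ← (dX_eq_deriv ((hψ' _ hxm).differentiableAt (by simp))).deriv]
      apply Filter.EventuallyEq.deriv_eq
      filter_upwards [(isOpen_lt continuous_abs continuous_const).mem_nhds hx] with y hy
      exact h0 y hy
    intro i
    fin_cases i
    · exact h0 x hx
    · change dT ψ (x, 0) + dX ψ (x, 0) = dT ψ' (x, 0) + dX ψ' (x, 0)
      rw [h1 x hx, e1]
    · change dT ψ (x, 0) - dX ψ (x, 0) = dT ψ' (x, 0) - dX ψ' (x, 0)
      rw [h1 x hx, e1]
  have hLip := norm_waveSource_sub_le hK0 hK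
  have hFc : Continuous (waveSource H) := by
    refine (LipschitzWith.of_dist_le_mul (K := (⟨K + 1, by positivity⟩ : NNReal))
      fun w w' => ?_).continuous
    rw [dist_eq_norm, dist_eq_norm]
    exact hLip w w'
  have hG := norm_le_of_forall_le_integral (w := fun p => U ψ p - U ψ' p) (α := 0) (K := K + 1)
    abs_waveSpeed_le le_rfl (by positivity) ((hUc ψ hψ).sub (hUc ψ' hψ')) (by
      intro p hp i
      have hmem : ∀ s ∈ uIcc 0 p.2, charPt (waveSpeed i) p s ∈ diamond R := fun s hs =>
        charPt_mem_diamond (abs_waveSpeed_le i) hp hs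
      have hcc : Continuous fun s => charPt (waveSpeed i) p s := by fun_prop
      have c1 : ∀ f : ℝ × ℝ → V, (∀ p ∈ openDiamond 0 r, ContDiffAt ℝ ∞ f p) →
          ContinuousOn (fun s => U f (charPt (waveSpeed i) p s)) (uIcc 0 p.2) := fun f hf =>
        (hUc f hf).comp hcc.continuousOn hmem
      have c2 : ∀ f : ℝ × ℝ → V, (∀ p ∈ openDiamond 0 r, ContDiffAt ℝ ∞ f p) →
          ContinuousOn (fun s => waveSource H (U f (charPt (waveSpeed i) p s)) i) (uIcc 0 p.2) :=
        fun f hf => ((continuous_apply i).comp hFc).comp_continuousOn (c1 f hf)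
      have i1 := intervalIntegral.integral_eq_sub_of_hasDerivAt
        (hUd ψ hψ he p hp i) (c2 ψ hψ).intervalIntegrable
      have i2 := intervalIntegral.integral_eq_sub_of_hasDerivAt
        (hUd ψ' hψ' he' p hp i) (c2 ψ' hψ').intervalIntegrable
      have hfoot := foot_mem (abs_waveSpeed_le i) hp
      have hz : charPt (waveSpeed i) p 0 = (p.1 + waveSpeed i * p.2, 0) := by simp [charPt]
      rw [charPt_self, hz] at i1 i2
      have e1 : (U ψ p - U ψ' p) i = ∫ s in (0 : ℝ)..p.2,
          (waveSource H (U ψ (charPt (waveSpeed i) p s)) i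
            - waveSource H (U ψ' (charPt (waveSpeed i) p s)) i) := by
        rw [intervalIntegral.integral_sub (c2 ψ hψ).intervalIntegrable
          (c2 ψ' hψ').intervalIntegrable, i1, i2, hUi _ (by linarith) i]
        simp
      rw [zero_add, e1]
      refine intervalIntegral.norm_integral_le_abs_of_norm_le ?_ ?_
      · refine (MeasureTheory.ae_restrict_iff' measurableSet_uIoc).2
          (Eventually.of_forall fun s _ => ?_)
        rw [← Pi.sub_apply]
        exact (norm_le_pi_norm _ i).trans (hLip _ _)
      · exact (ContinuousOn.mul continuousOn_const
          ((c1 ψ hψ).sub (c1 ψ' hψ')).norm).intervalIntegrable)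
  have := hG q (le_refl R)
  rw [mul_zero, zero_mul, norm_le_zero_iff] at this
  have h := congrFun this 0
  exact sub_eq_zero.1 h

/-- Local uniqueness for the Cauchy problem on a diamond. -/
lemma eq_on_openDiamond [CompleteSpace V] {H : V × V × V → V} {K : ℝ} (hK0 : 0 ≤ K)
    (hK : ∀ p p', ‖H p - H p'‖ ≤ K * ‖p - p'‖) {c : ℝ × ℝ} {r : ℝ} {ψ ψ' : ℝ × ℝ → V}
    (hψ : ∀ q ∈ openDiamond c r, ContDiffAt ℝ ∞ ψ q)
    (hψ' : ∀ q ∈ openDiamond c r, ContDiffAt ℝ ∞ ψ' q)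
    (he : ∀ q ∈ openDiamond c r, waveOp ψ q = H (ψ q, dT ψ q + dX ψ q, dT ψ q - dX ψ q))
    (he' : ∀ q ∈ openDiamond c r, waveOp ψ' q = H (ψ' q, dT ψ' q + dX ψ' q, dT ψ' q - dX ψ' q))
    (h0 : ∀ x, |x - c.1| < r → ψ (x, c.2) = ψ' (x, c.2))
    (h1 : ∀ x, |x - c.1| < r → dT ψ (x, c.2) = dT ψ' (x, c.2)) :
    ∀ q ∈ openDiamond c r, ψ q = ψ' q := by
  have hm : ∀ q, q ∈ openDiamond 0 r → q - -c ∈ openDiamond c r := by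
    intro q hq
    simpa [openDiamond] using hq
  have hs : ∀ f : ℝ × ℝ → V, ∀ q, ContDiffAt ℝ ∞ f (q - -c) →
      ContDiffAt ℝ ∞ (fun p => f (p - -c)) q := fun f q hf =>
    hf.comp q (contDiffAt_id.sub contDiffAt_const)
  have hx0 : ∀ x : ℝ, ((x, 0) : ℝ × ℝ) - -c = (x + c.1, c.2) := fun x => by ext <;> simp
  have key := eq_on_openDiamond_zero (r := r) (ψ := fun p => ψ (p - -c))
    (ψ' := fun p => ψ' (p - -c)) hK0 hK (fun q hq => hs ψ q (hψ _ (hm q hq)))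
    (fun q hq => hs ψ' q (hψ' _ (hm q hq)))
    (fun q hq => by rw [waveOp_comp_sub, dT_comp_sub, dX_comp_sub, he _ (hm q hq)])
    (fun q hq => by rw [waveOp_comp_sub, dT_comp_sub, dX_comp_sub, he' _ (hm q hq)])
    (fun x hx => by
      simp only [hx0]
      exact h0 (x + c.1) (by simpa using hx))
    (fun x hx => by
      rw [dT_comp_sub, dT_comp_sub, hx0]
      exact h1 (x + c.1) (by simpa using hx))
  intro q hq
  have := key (q - c) (by simpa [openDiamond] using hq)
  simpa using this

end SecondOrder

/-! ### Cut-offs and local existence in a vector space. -/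

section LocalExistence

open Set Filter Topology

/-- Extension by zero of the product of a function smooth on an open set with a smooth function
whose closed support lies in that set. -/
lemma contDiff_smul_of_tsupport_subset {X Y : Type*} [NormedAddCommGroup X] [NormedSpace ℝ X]
    [NormedAddCommGroup Y] [NormedSpace ℝ Y] {s : Set X} (hs : IsOpen s) {f : X → ℝ} {g : X → Y}
    (hf : ContDiff ℝ ∞ f) (hfs : tsupport f ⊆ s) (hg : ContDiffOn ℝ ∞ g s) :
    ContDiff ℝ ∞ fun x => f x • g x := by
  refine contDiff_iff_contDiffAt.2 fun x => ?_
  by_cases hx : x ∈ s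
  · exact hf.contDiffAt.smul (hg.contDiffAt (hs.mem_nhds hx))
  · have h0 : f =ᶠ[𝓝 x] 0 := notMem_tsupport_iff_eventuallyEq.1 fun h => hx (hfs h)
    refine (contDiffAt_const (c := (0 : Y))).congr_of_eventuallyEq ?_
    filter_upwards [h0] with y hy
    simp [hy]

variable {V : Type*} [NormedAddCommGroup V] [NormedSpace ℝ V] [FiniteDimensional ℝ V]

/-- Localisation of a smooth source to a globally Lipschitz one. -/
lemma exists_lipschitz_localisation {U : Set V} (hU : IsOpen U) {H : V × V × V → V}
    (hH : ContDiffOn ℝ ∞ H (U ×ˢ univ)) {z₀ : V} (hz₀ : z₀ ∈ U) :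
    ∃ ρ > 0, Metric.closedBall z₀ ρ ⊆ U ∧ ∀ C > 0, ∃ H' : V × V × V → V, ContDiff ℝ ∞ H' ∧
      (∃ K, 0 ≤ K ∧ ∀ p p', ‖H' p - H' p'‖ ≤ K * ‖p - p'‖) ∧ (∃ M, ∀ p, ‖H' p‖ ≤ M) ∧
      ∀ z ∈ Metric.closedBall z₀ ρ, ∀ a b : V, ‖a‖ ≤ C → ‖b‖ ≤ C → H' (z, a, b) = H (z, a, b) := by
  obtain ⟨ρ₁, hρ₁, hsub⟩ := Metric.nhds_basis_closedBall.mem_iff.1 (hU.mem_nhds hz₀)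
  refine ⟨ρ₁ / 2, by positivity, (Metric.closedBall_subset_closedBall (by linarith)).trans hsub,
    fun C hC => ?_⟩
  let f₁ : ContDiffBump z₀ := ⟨ρ₁ / 2, ρ₁, by positivity, by linarith⟩
  let f₂ : ContDiffBump (0 : V) := ⟨C, C + 1, hC, by linarith⟩
  -- The cut-off has compact support over `U`, so `f • H` is smooth with compact support, hence
  -- bounded and globally Lipschitz. It is 1 where `z` is within `ρ₁ / 2` of `z₀` and both null
  -- derivatives are at most `C`.
  let f : V × V × V → ℝ := fun p => f₁ p.1 * (f₂ p.2.1 * f₂ p.2.2)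
  have hf : ContDiff ℝ ∞ f :=
    (f₁.contDiff.comp contDiff_fst).mul ((f₂.contDiff.comp (contDiff_fst.comp contDiff_snd)).mul
      (f₂.contDiff.comp (contDiff_snd.comp contDiff_snd)))
  let k : Set (V × V × V) := Metric.closedBall z₀ ρ₁ ×ˢ
    (Metric.closedBall 0 (C + 1) ×ˢ Metric.closedBall 0 (C + 1))
  have hk : IsCompact k := (isCompact_closedBall _ _).prod
    ((isCompact_closedBall _ _).prod (isCompact_closedBall _ _))
  have hfk : tsupport f ⊆ k := by
    refine closure_minimal (fun p hp => ?_) hk.isClosed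
    have hp' : f p ≠ 0 := hp
    have h1 : f₁ p.1 ≠ 0 := left_ne_zero_of_mul hp'
    have h2 : f₂ p.2.1 ≠ 0 := left_ne_zero_of_mul (right_ne_zero_of_mul hp')
    have h3 : f₂ p.2.2 ≠ 0 := right_ne_zero_of_mul (right_ne_zero_of_mul hp')
    refine ⟨?_, ?_, ?_⟩
    · by_contra hn
      exact h1 (f₁.zero_of_le_dist (le_of_lt (by simpa using hn)))
    · by_contra hn
      exact h2 (f₂.zero_of_le_dist (le_of_lt (by simpa using hn)))
    · by_contra hn
      exact h3 (f₂.zero_of_le_dist (le_of_lt (by simpa using hn)))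
  have hH' : ContDiff ℝ ∞ fun p => f p • H p :=
    contDiff_smul_of_tsupport_subset (hU.prod isOpen_univ) hf
      (hfk.trans (show k ⊆ U ×ˢ univ from fun p hp => ⟨hsub hp.1, mem_univ _⟩)) hH
  have hsupp : HasCompactSupport fun p => f p • H p :=
    HasCompactSupport.smul_right (hk.of_isClosed_subset (isClosed_tsupport f) hfk)
  refine ⟨fun p => f p • H p, hH', ?_, ?_, ?_⟩
  · obtain ⟨K, hK⟩ := hH'.lipschitzWith_of_hasCompactSupport hsupp (by simp)
    refine ⟨K, K.2, fun p p' => ?_⟩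
    have := hK.dist_le_mul p p'
    rwa [dist_eq_norm, dist_eq_norm] at this
  · exact hH'.continuous.bounded_above_of_compact_support hsupp
  · intro z hz a b ha hb
    have h1 : f₁ z = 1 := f₁.one_of_mem_closedBall hz
    have h2 : f₂ a = 1 := f₂.one_of_mem_closedBall (by simpa using ha)
    have h3 : f₂ b = 1 := f₂.one_of_mem_closedBall (by simpa using hb)
    simp [f, h1, h2, h3]

omit [FiniteDimensional ℝ V] in
/-- A function smooth on an interval agrees on any smaller interval with a compactly supported
smooth function. -/
lemma exists_contDiff_eqOn_ball {m r r' : ℝ} (hr : 0 < r) (hrr' : r < r') {f : ℝ → V}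
    (hf : ContDiffOn ℝ ∞ f (Metric.ball m r')) :
    ∃ g : ℝ → V, ContDiff ℝ ∞ g ∧ HasCompactSupport g ∧ EqOn g f (Metric.ball m r) := by
  let χ : ContDiffBump m := ⟨r, (r + r') / 2, hr, by linarith⟩
  refine ⟨fun x => χ x • f x, ?_, χ.hasCompactSupport.smul_right, fun x hx => ?_⟩
  · refine contDiff_smul_of_tsupport_subset Metric.isOpen_ball χ.contDiff ?_ hf
    rw [χ.tsupport_eq]
    exact Metric.closedBall_subset_ball (show (r + r') / 2 < r' by linarith)
  · have : χ x = 1 := χ.one_of_mem_closedBall (Metric.ball_subset_closedBall hx)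
    simp [this]

/-- Local existence for the Cauchy problem on diamonds whose size depends only on bounds for the
data. -/
lemma exists_local_waveOp_eq {U : Set V} (hU : IsOpen U) {H : V × V × V → V}
    (hH : ContDiffOn ℝ ∞ H (U ×ˢ univ)) {z₀ : V} (hz₀ : z₀ ∈ U) {C : ℝ} (hC : 0 < C) :
    ∃ ρ > 0, Metric.closedBall z₀ ρ ⊆ U ∧ ∃ δ > 0, ∀ (c : ℝ × ℝ) (r r' : ℝ), 0 < r → r < r' →
      r ≤ δ → ∀ ψ₀ ψ₁ : ℝ → V, ContDiffOn ℝ ∞ ψ₀ (Metric.ball c.1 r') →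
      ContDiffOn ℝ ∞ ψ₁ (Metric.ball c.1 r') →
      (∀ x ∈ Metric.ball c.1 r, ‖ψ₀ x - z₀‖ ≤ ρ / 2 ∧ ‖ψ₁ x + deriv ψ₀ x‖ ≤ C ∧
        ‖ψ₁ x - deriv ψ₀ x‖ ≤ C) →
      ∃ ψ : ℝ × ℝ → V, ContDiff ℝ ∞ ψ ∧
        (∀ q ∈ openDiamond c r, ψ q ∈ Metric.closedBall z₀ ρ ∧
          waveOp ψ q = H (ψ q, dT ψ q + dX ψ q, dT ψ q - dX ψ q)) ∧
        ∀ x ∈ Metric.ball c.1 r, ψ (x, c.2) = ψ₀ x ∧ dT ψ (x, c.2) = ψ₁ x := by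
  have : CompleteSpace V := FiniteDimensional.complete ℝ V
  obtain ⟨ρ, hρ, hρU, hloc⟩ := exists_lipschitz_localisation hU hH hz₀
  -- The null derivatives start below `C` and are allowed to grow by 1.
  obtain ⟨H', hH', ⟨K, hK0, hK⟩, ⟨M, hM⟩, heq⟩ := hloc (C + 1) (by positivity)
  have hM0 : 0 ≤ M := (norm_nonneg _).trans (hM 0)
  -- For times below the first bound the null derivatives change by at most 1, since `‖H'‖ ≤ M`. For
  -- times below the second, `ψ` moves by at most `ρ / 2` from data within `ρ / 2` of `z₀`. Hence
  -- the solution never leaves the region where `H' = H`.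
  refine ⟨ρ, hρ, hρU, min (1 / (M + 1)) (ρ / (2 * (C + 1))), by positivity, ?_⟩
  intro c r r' hr hrr' hrδ ψ₀ ψ₁ h₀ h₁ hb
  obtain ⟨g₀, hg₀, hs₀, he₀⟩ := exists_contDiff_eqOn_ball hr hrr' h₀
  obtain ⟨g₁, hg₁, hs₁, he₁⟩ := exists_contDiff_eqOn_ball hr hrr' h₁
  have hδ₁ : M * r ≤ 1 := by
    have h1 := hrδ.trans (min_le_left _ _)
    rw [le_div_iff₀ (by positivity)] at h1
    nlinarith
  have hδ₂ : (C + 1) * r ≤ ρ / 2 := by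
    have h1 := hrδ.trans (min_le_right _ _)
    rw [le_div_iff₀ (by positivity)] at h1
    linarith
  obtain ⟨B₀, hB₀⟩ := hg₀.continuous.bounded_above_of_compact_support hs₀
  obtain ⟨B₁, hB₁⟩ := hg₁.continuous.bounded_above_of_compact_support hs₁
  obtain ⟨B₂, hB₂⟩ := (hg₀.continuous_deriv (by simp)).bounded_above_of_compact_support hs₀.deriv
  have hderiv : ∀ x ∈ Metric.ball c.1 r, deriv g₀ x = deriv ψ₀ x := fun x hx =>
    Filter.EventuallyEq.deriv_eq (he₀.eventuallyEq_of_mem (Metric.isOpen_ball.mem_nhds hx))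
  obtain ⟨φ, hφ, hφ₀, hφ₁, hφe, hφa, hφb⟩ := exists_global_waveOp_eq hH' hK0 hK hM
    (ψ₀ := fun x => g₀ (x + c.1)) (ψ₁ := fun x => g₁ (x + c.1)) (by fun_prop) (by fun_prop)
    (C := max B₀ (max B₁ B₂)) (fun x => (hB₀ _).trans (le_max_left _ _))
    (fun x => (hB₁ _).trans ((le_max_left _ _).trans (le_max_right _ _)))
    (fun x => by
      rw [deriv_comp_add_const]
      exact (hB₂ _).trans ((le_max_right _ _).trans (le_max_right _ _)))
  simp only [deriv_comp_add_const] at hφa hφb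
  have hbound : ∀ q : ℝ × ℝ, |q.1| + |q.2| < r → ‖dT φ q + dX φ q‖ ≤ C + 1 ∧
      ‖dT φ q - dX φ q‖ ≤ C + 1 := by
    intro q hq
    have hq2 : M * |q.2| ≤ 1 := by
      refine le_trans ?_ hδ₁
      gcongr
      linarith [abs_nonneg q.1]
    constructor
    · have hm : q.1 + q.2 + c.1 ∈ Metric.ball c.1 r := by
        rw [Metric.mem_ball, Real.dist_eq, add_sub_cancel_right]
        exact (abs_add_le _ _).trans_lt hq
      have h2 := hφa q
      have h3 := (hb _ hm).2.1
      rw [he₁ hm, hderiv _ hm] at h2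
      have h4 := norm_le_norm_sub_add (dT φ q + dX φ q)
        (ψ₁ (q.1 + q.2 + c.1) + deriv ψ₀ (q.1 + q.2 + c.1))
      linarith
    · have hm : q.1 - q.2 + c.1 ∈ Metric.ball c.1 r := by
        rw [Metric.mem_ball, Real.dist_eq, add_sub_cancel_right]
        exact (abs_sub _ _).trans_lt hq
      have h2 := hφb q
      have h3 := (hb _ hm).2.2
      rw [he₁ hm, hderiv _ hm] at h2
      have h4 := norm_le_norm_sub_add (dT φ q - dX φ q)
        (ψ₁ (q.1 - q.2 + c.1) - deriv ψ₀ (q.1 - q.2 + c.1))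
      linarith
  have hdTb : ∀ q : ℝ × ℝ, |q.1| + |q.2| < r → ‖dT φ q‖ ≤ C + 1 := by
    intro q hq
    have h1 : dT φ q = (1 / 2 : ℝ) • ((dT φ q + dX φ q) + (dT φ q - dX φ q)) := by
      rw [add_add_sub_cancel, ← two_smul ℝ, smul_smul]; norm_num
    rw [h1, norm_smul, Real.norm_of_nonneg (by norm_num)]
    have := norm_add_le (dT φ q + dX φ q) (dT φ q - dX φ q)
    linarith [(hbound q hq).1, (hbound q hq).2]
  have hφd : ∀ q, DifferentiableAt ℝ φ q := fun q => hφ.contDiffAt.differentiableAt (by simp)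
  have hrange : ∀ q : ℝ × ℝ, |q.1| + |q.2| < r → φ q ∈ Metric.closedBall z₀ ρ := by
    intro q hq
    have hm : q.1 + c.1 ∈ Metric.ball c.1 r := by
      rw [Metric.mem_ball, Real.dist_eq, add_sub_cancel_right]
      linarith [abs_nonneg q.2]
    have h1 := Convex.norm_image_sub_le_of_norm_hasDerivWithin_le (𝕜 := ℝ)
      (f := fun t => φ (q.1, t)) (f' := fun t => dT φ (q.1, t)) (s := uIcc 0 q.2) (C := C + 1)
      (x := 0) (y := q.2)
      (fun t _ => (dT_eq_deriv (hφd (q.1, t))).hasDerivWithinAt)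
      (fun t ht => hdTb _ (by
        have := abs_sub_add_abs_of_mem_uIcc ht
        change |q.1| + |t| < r
        linarith [abs_nonneg (q.2 - t)]))
      (convex_uIcc _ _) left_mem_uIcc right_mem_uIcc
    rw [hφ₀, he₀ hm, sub_zero, Real.norm_eq_abs] at h1
    have h2 := (hb _ hm).1
    rw [Metric.mem_closedBall, dist_eq_norm]
    have h3 : (C + 1) * |q.2| ≤ (C + 1) * r := by
      gcongr
      linarith [abs_nonneg q.1]
    have h4 := norm_sub_le_norm_sub_add_norm_sub (φ (q.1, q.2)) (ψ₀ (q.1 + c.1)) z₀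
    change ‖φ (q.1, q.2) - z₀‖ ≤ ρ
    linarith
  refine ⟨fun q => φ (q - c), by fun_prop, fun q hq => ?_, fun x hx => ?_⟩
  · have hq' : |(q - c).1| + |(q - c).2| < r := hq
    refine ⟨hrange _ hq', ?_⟩
    rw [waveOp_comp_sub, dT_comp_sub, dX_comp_sub, hφe]
    exact heq _ (hrange _ hq') _ _ (hbound _ hq').1 (hbound _ hq').2
  · have hx0 : ((x, c.2) : ℝ × ℝ) - c = (x - c.1, 0) := by ext <;> simp
    constructor
    · change φ ((x, c.2) - c) = _
      rw [hx0, hφ₀, sub_add_cancel, he₀ hx]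
    · rw [dT_comp_sub, hx0, hφ₁, sub_add_cancel, he₁ hx]

end LocalExistence

/-! ### Coefficients of the metric and of the two-form in a chart. -/

section ChartGeometry

open Set Filter Topology

section instances

variable {V : Type*} [NormedAddCommGroup V] [NormedSpace ℝ V]

set_option synthInstance.maxHeartbeats 200000 in
/-- A shortcut for instance search. -/
noncomputable instance instNormedAddCommGroupBilin : NormedAddCommGroup (V →L[ℝ] V →L[ℝ] ℝ) :=
  ContinuousLinearMap.toNormedAddCommGroup

set_option synthInstance.maxHeartbeats 200000 in
/-- A shortcut for instance search. -/
noncomputable instance instNormedSpaceBilin : NormedSpace ℝ (V →L[ℝ] V →L[ℝ] ℝ) :=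
  ContinuousLinearMap.toNormedSpace

end instances

variable {n : ℕ} {N : Type*} [TopologicalSpace N] [ChartedSpace (EuclideanSpace ℝ (Fin n)) N]
  [IsManifold (𝓡 n) ∞ N]

lemma contMDiffOn_coordField {e : OpenPartialHomeomorph N (EuclideanSpace ℝ (Fin n))}
    (he : e ∈ IsManifold.maximalAtlas (𝓡 n) ∞ N) (v : EuclideanSpace ℝ (Fin n)) :
    ContMDiffOn (𝓡 n) (𝓡 n).tangent ∞
      (fun z => (⟨e.symm z, mfderiv (𝓡 n) (𝓡 n) e.symm z v⟩ : TangentBundle (𝓡 n) N))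
      e.target := by
  have h1 := (contMDiffOn_symm_of_mem_maximalAtlas he).contMDiffOn_tangentMapWithin (m := ∞)
    (by simp) e.open_target.uniqueMDiffOn
  have h2 : ContMDiff (𝓡 n) (𝓡 n).tangent ∞
      (fun z => (⟨z, v⟩ : TangentBundle (𝓡 n) (EuclideanSpace ℝ (Fin n)))) :=
    contMDiff_vectorSpace_iff_contDiff.2 contDiff_const
  have h3 := h1.comp (h2.contMDiffOn (s := e.target)) (fun z hz => hz)
  refine h3.congr fun z hz => ?_
  simp only [Function.comp, tangentMapWithin]
  rw [mfderivWithin_of_isOpen e.open_target hz]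

section metric

variable [RiemannianBundle (fun x : N => TangentSpace (𝓡 n) x)]
  [IsContMDiffRiemannianBundle (𝓡 n) ∞ (EuclideanSpace ℝ (Fin n))
      (fun x : N => TangentSpace (𝓡 n) x)]

lemma contDiffOn_metricCoeff {e : OpenPartialHomeomorph N (EuclideanSpace ℝ (Fin n))}
    (he : e ∈ IsManifold.maximalAtlas (𝓡 n) ∞ N) (A B : Fin n) :
    ContDiffOn ℝ ∞ (fun z => metricCoeff e z A B) e.target := by
  rw [← contMDiffOn_iff_contDiffOn]
  exact ContMDiffOn.inner_bundle (IB := 𝓡 n) (E := fun x : N => TangentSpace (𝓡 n) x)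
    (contMDiffOn_coordField he (EuclideanSpace.single A 1))
    (contMDiffOn_coordField he (EuclideanSpace.single B 1))

end metric

lemma TwoForm.contDiffOn_coeff (p : TwoForm n N)
    {e : OpenPartialHomeomorph N (EuclideanSpace ℝ (Fin n))}
    (he : e ∈ IsManifold.maximalAtlas (𝓡 n) ∞ N) (A B : Fin n) :
    ContDiffOn ℝ ∞ (fun z => p.coeff e z A B) e.target := by
  rw [← contMDiffOn_iff_contDiffOn]
  have h1 := p.smooth.comp_contMDiffOn (contMDiffOn_symm_of_mem_maximalAtlas he)
  have h2 : ContMDiffOn (𝓡 n) ((𝓡 n).prod 𝓘(ℝ)) ∞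
      (fun z => TotalSpace.mk' ℝ (E := Bundle.Trivial N ℝ) (e.symm z)
        (p.form (e.symm z) (coordVec e z A) (coordVec e z B))) e.target := by
    intro z hz
    apply ContMDiffWithinAt.clm_bundle_apply₂ (F₁ := EuclideanSpace ℝ (Fin n))
      (F₂ := EuclideanSpace ℝ (Fin n)) (E₁ := fun x : N => TangentSpace (𝓡 n) x)
      (E₂ := fun x : N => TangentSpace (𝓡 n) x)
    · exact h1 z hz
    · exact contMDiffOn_coordField he (EuclideanSpace.single A 1) z hz
    · exact contMDiffOn_coordField he (EuclideanSpace.single B 1) z hz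
  intro z hz
  have h3 := h2 z hz
  simp only [contMDiffWithinAt_totalSpace] at h3
  exact h3.2

/-- The bilinear form on `ℝⁿ` with a given matrix. -/
noncomputable def formOf (M : Fin n → Fin n → ℝ) :
    EuclideanSpace ℝ (Fin n) →L[ℝ] EuclideanSpace ℝ (Fin n) →L[ℝ] ℝ :=
  ∑ A, ∑ B, M A B • (EuclideanSpace.proj (𝕜 := ℝ) A : EuclideanSpace ℝ (Fin n) →L[ℝ] ℝ).smulRight
    (EuclideanSpace.proj (𝕜 := ℝ) B : EuclideanSpace ℝ (Fin n) →L[ℝ] ℝ)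

lemma formOf_apply (M : Fin n → Fin n → ℝ) (v w : EuclideanSpace ℝ (Fin n)) :
    formOf M v w = ∑ A, ∑ B, M A B * v A * w B := by
  simp [formOf, mul_assoc]

lemma contDiffOn_sum_sum_smul {X W : Type*} [NormedAddCommGroup X] [NormedSpace ℝ X]
    [NormedAddCommGroup W] [NormedSpace ℝ W] {M : X → Fin n → Fin n → ℝ} {s : Set X}
    (T : Fin n → Fin n → W) (h : ∀ A B, ContDiffOn ℝ ∞ (fun z => M z A B) s) :
    ContDiffOn ℝ ∞ (fun z => ∑ A, ∑ B, M z A B • T A B) s :=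
  ContDiffOn.sum fun A _ => ContDiffOn.sum fun B _ => (h A B).smul contDiffOn_const

lemma fderiv_sum_sum_smul_apply {X W : Type*} [NormedAddCommGroup X] [NormedSpace ℝ X]
    [NormedAddCommGroup W] [NormedSpace ℝ W] {M : X → Fin n → Fin n → ℝ} {z : X}
    (T : Fin n → Fin n → W) (h : ∀ A B, DifferentiableAt ℝ (fun z => M z A B) z) (u : X) :
    fderiv ℝ (fun z => ∑ A, ∑ B, M z A B • T A B) z u
      = ∑ A, ∑ B, fderiv ℝ (fun z => M z A B) z u • T A B := by
  have h1 : HasFDerivAt (fun z => ∑ A, ∑ B, M z A B • T A B) (∑ B, ∑ C,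
      (fderiv ℝ (fun z => M z B C) z).smulRight (T B C)) z :=
    HasFDerivAt.fun_sum fun B _ => HasFDerivAt.fun_sum fun C _ =>
      (h B C).hasFDerivAt.smul_const _
  rw [h1.fderiv]
  simp

lemma contDiffOn_formOf {M : EuclideanSpace ℝ (Fin n) → Fin n → Fin n → ℝ}
    {s : Set (EuclideanSpace ℝ (Fin n))} (h : ∀ A B, ContDiffOn ℝ ∞ (fun z => M z A B) s) :
    ContDiffOn ℝ ∞ (fun z => formOf (M z)) s :=
  contDiffOn_sum_sum_smul _ h

lemma eq_sum_single (v : EuclideanSpace ℝ (Fin n)) :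
    v = ∑ A, v A • EuclideanSpace.single A (1 : ℝ) := by
  ext B
  simp [Pi.single_apply]

lemma fderiv_formOf_apply {M : EuclideanSpace ℝ (Fin n) → Fin n → Fin n → ℝ}
    {z : EuclideanSpace ℝ (Fin n)} (h : ∀ A B, DifferentiableAt ℝ (fun z => M z A B) z)
    (u v w : EuclideanSpace ℝ (Fin n)) :
    fderiv ℝ (fun z => formOf (M z)) z u v w
      = ∑ A, ∑ B, ∑ C, coordDeriv A (fun z => M z B C) z * u A * v B * w C := by
  have h1 : fderiv ℝ (fun z => formOf (M z)) z u
      = formOf fun B C => fderiv ℝ (fun z => M z B C) z u := fderiv_sum_sum_smul_apply _ h u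
  rw [h1, formOf_apply]
  conv_rhs => rw [Finset.sum_comm]
  refine Finset.sum_congr rfl fun B _ => ?_
  conv_rhs => rw [Finset.sum_comm]
  refine Finset.sum_congr rfl fun C _ => ?_
  have h2 : fderiv ℝ (fun z => M z B C) z u
      = ∑ A, u A * coordDeriv A (fun z => M z B C) z := by
    conv_lhs => rw [eq_sum_single u]
    simp [coordDeriv]
  rw [h2, Finset.sum_mul, Finset.sum_mul]
  exact Finset.sum_congr rfl fun A _ => by ring

/-- A bilinear form on a fibre, pulled back to `ℝⁿ` by a linear map, in terms of its matrix. -/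
lemma formOf_eq_of_bilinear {W : Type*} [AddCommGroup W] [Module ℝ W]
    (L : EuclideanSpace ℝ (Fin n) →ₗ[ℝ] W) (b : W →ₗ[ℝ] W →ₗ[ℝ] ℝ)
    (v w : EuclideanSpace ℝ (Fin n)) :
    formOf (fun A B => b (L (EuclideanSpace.single A 1)) (L (EuclideanSpace.single B 1))) v w
      = b (L v) (L w) := by
  rw [formOf_apply]
  conv_rhs => rw [eq_sum_single v, eq_sum_single w]
  simp only [map_sum, LinearMap.sum_apply, map_smul, LinearMap.smul_apply, smul_eq_mul]
  rw [Finset.sum_comm]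
  refine Finset.sum_congr rfl fun A _ => ?_
  rw [Finset.mul_sum]
  exact Finset.sum_congr rfl fun B _ => by ring

lemma TwoForm.formOf_coeff (p : TwoForm n N)
    (e : OpenPartialHomeomorph N (EuclideanSpace ℝ (Fin n))) (z v w : EuclideanSpace ℝ (Fin n)) :
    formOf (p.coeff e z) v w = p.form (e.symm z) (mfderiv (𝓡 n) (𝓡 n) e.symm z v)
      (mfderiv (𝓡 n) (𝓡 n) e.symm z w) := by
  have := formOf_eq_of_bilinear (mfderiv (𝓡 n) (𝓡 n) e.symm z).toLinearMap
    (ContinuousLinearMap.toLinearMap₁₂ (p.form (e.symm z))) v w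
  exact this

section metric

variable [RiemannianBundle (fun x : N => TangentSpace (𝓡 n) x)]

omit [IsManifold (𝓡 n) ∞ N] in
lemma formOf_metricCoeff (e : OpenPartialHomeomorph N (EuclideanSpace ℝ (Fin n)))
    (z v w : EuclideanSpace ℝ (Fin n)) :
    formOf (metricCoeff e z) v w = inner ℝ (mfderiv (𝓡 n) (𝓡 n) e.symm z v)
      (mfderiv (𝓡 n) (𝓡 n) e.symm z w) := by
  have := formOf_eq_of_bilinear (mfderiv (𝓡 n) (𝓡 n) e.symm z).toLinearMap
    (innerₗ (TangentSpace (𝓡 n) (e.symm z))) v w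
  exact this

omit [IsManifold (𝓡 n) ∞ N] [RiemannianBundle fun x : N => TangentSpace (𝓡 n) x] in
lemma injective_mfderiv_symm {e : OpenPartialHomeomorph N (EuclideanSpace ℝ (Fin n))}
    (he : e ∈ IsManifold.maximalAtlas (𝓡 n) ∞ N) {z : EuclideanSpace ℝ (Fin n)}
    (hz : z ∈ e.target) : Function.Injective (mfderiv (𝓡 n) (𝓡 n) e.symm z) := by
  have h1 : MDifferentiableAt (𝓡 n) (𝓡 n) e.symm z :=
    (contMDiffAt_symm_of_mem_maximalAtlas he hz).mdifferentiableAt (by simp)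
  have h2 : MDifferentiableAt (𝓡 n) (𝓡 n) e (e.symm z) :=
    (contMDiffAt_of_mem_maximalAtlas he (e.map_target hz)).mdifferentiableAt (by simp)
  have h3 : mfderiv (𝓡 n) (𝓡 n) (e ∘ e.symm) z
      = (mfderiv (𝓡 n) (𝓡 n) e (e.symm z)).comp (mfderiv (𝓡 n) (𝓡 n) e.symm z) :=
    mfderiv_comp z h2 h1
  have h4 : mfderiv (𝓡 n) (𝓡 n) (e ∘ e.symm) z = ContinuousLinearMap.id ℝ _ := by
    rw [← mfderiv_id]
    apply Filter.EventuallyEq.mfderiv_eq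
    filter_upwards [e.open_target.mem_nhds hz] with y hy
    exact e.right_inv hy
  intro v w hvw
  have h5 : ∀ v, mfderiv (𝓡 n) (𝓡 n) e (e.symm z) (mfderiv (𝓡 n) (𝓡 n) e.symm z v) = v := by
    intro v
    have := congrArg (fun L => L v) (h3.symm.trans h4)
    exact this
  rw [← h5 v, ← h5 w, hvw]

end metric

end ChartGeometry

/-! ### The equation with lowered index: coordinate changes and null energies. -/

section ChartCalculus

open Set Filter Topology

variable {V : Type*} [NormedAddCommGroup V] [NormedSpace ℝ V]

/-- The Christoffel symbols of the first kind of a field of bilinear forms. -/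
noncomputable def koszul (G : V → V →L[ℝ] V →L[ℝ] ℝ) (z u v w : V) : ℝ :=
  1 / 2 * (fderiv ℝ G z u v w + fderiv ℝ G z v u w - fderiv ℝ G z w u v)

/-- The exterior derivative of a two-form. -/
noncomputable def extDTwo (P : V → V →L[ℝ] V →L[ℝ] ℝ) (z w u v : V) : ℝ :=
  fderiv ℝ P z w u v + fderiv ℝ P z u v w + fderiv ℝ P z v w u

/-- The torsion wave map equation in coordinates, with the free index lowered and in terms of the
null derivatives `∂_t ψ ± ∂_x ψ`. -/
def LoweredEqAt (G P : V → V →L[ℝ] V →L[ℝ] ℝ) (c : ℝ) (ψ : ℝ × ℝ → V) (q : ℝ × ℝ) : Prop :=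
  ∀ w, G (ψ q) w (waveOp ψ q) = -koszul G (ψ q) (dT ψ q + dX ψ q) (dT ψ q - dX ψ q) w
    + c / 2 * extDTwo P (ψ q) w (dT ψ q + dX ψ q) (dT ψ q - dX ψ q)

lemma fderiv_bilin_comp_apply {X : Type*} [NormedAddCommGroup X] [NormedSpace ℝ X]
    {B : X → V →L[ℝ] V →L[ℝ] ℝ} {B' : X →L[ℝ] V →L[ℝ] V →L[ℝ] ℝ} {v w : X → V}
    {v' w' : X →L[ℝ] V} {x : X} (hB : HasFDerivAt B B' x) (hv : HasFDerivAt v v' x)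
    (hw : HasFDerivAt w w' x) (u : X) :
    fderiv ℝ (fun y => B y (v y) (w y)) x u
      = B' u (v x) (w x) + B x (v' u) (w x) + B x (v x) (w' u) := by
  rw [((hB.clm_apply hv).clm_apply hw).fderiv]
  simp
  ring

lemma fderiv_bilin_apply {X : Type*} [NormedAddCommGroup X] [NormedSpace ℝ X]
    {B : X → V →L[ℝ] V →L[ℝ] ℝ} {x : X} (hB : DifferentiableAt ℝ B x) (u : X) (v w : V) :
    fderiv ℝ B x u v w = fderiv ℝ (fun y => B y v w) x u := by
  rw [fderiv_bilin_comp_apply hB.hasFDerivAt (hasFDerivAt_const v x) (hasFDerivAt_const w x)]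
  simp

lemma fderiv_bilin_symm {G : V → V →L[ℝ] V →L[ℝ] ℝ} {z : V} (hG : DifferentiableAt ℝ G z)
    (hs : ∀ᶠ y in 𝓝 z, ∀ v w, G y v w = G y w v) (u v w : V) :
    fderiv ℝ G z u v w = fderiv ℝ G z u w v := by
  rw [fderiv_bilin_apply hG, fderiv_bilin_apply hG]
  congr 1
  apply Filter.EventuallyEq.fderiv_eq
  filter_upwards [hs] with y hy using hy v w

lemma fderiv_bilin_skew {P : V → V →L[ℝ] V →L[ℝ] ℝ} {z : V} (hP : DifferentiableAt ℝ P z)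
    (hs : ∀ᶠ y in 𝓝 z, ∀ v w, P y v w = -P y w v) (u v w : V) :
    fderiv ℝ P z u v w = -fderiv ℝ P z u w v := by
  rw [fderiv_bilin_apply hP, fderiv_bilin_apply hP]
  have : (fun y => P y v w) =ᶠ[𝓝 z] fun y => -P y w v := by
    filter_upwards [hs] with y hy using hy v w
  rw [this.fderiv_eq, fderiv_fun_neg]
  rfl

/-- The derivative of the pull-back of a field of bilinear forms. -/
lemma fderiv_pullback {B B' : V → V →L[ℝ] V →L[ℝ] ℝ} {f : V → V} {z : V}
    (hB : DifferentiableAt ℝ B z) (hB' : DifferentiableAt ℝ B' (f z)) (hf : ContDiffAt ℝ ∞ f z)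
    (h : ∀ᶠ y in 𝓝 z, ∀ v w, B y v w = B' (f y) (fderiv ℝ f y v) (fderiv ℝ f y w)) (u v w : V) :
    fderiv ℝ B z u v w
      = fderiv ℝ B' (f z) (fderiv ℝ f z u) (fderiv ℝ f z v) (fderiv ℝ f z w)
        + B' (f z) (fderiv ℝ (fderiv ℝ f) z u v) (fderiv ℝ f z w)
        + B' (f z) (fderiv ℝ f z v) (fderiv ℝ (fderiv ℝ f) z u w) := by
  have hfd : DifferentiableAt ℝ f z := hf.differentiableAt (by simp)
  have hfd2 : DifferentiableAt ℝ (fderiv ℝ f) z :=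
    (hf.fderiv_right (m := ∞) (by simp)).differentiableAt (by simp)
  rw [fderiv_bilin_apply hB]
  have h1 : (fun y => B y v w) =ᶠ[𝓝 z]
      fun y => B' (f y) (fderiv ℝ f y v) (fderiv ℝ f y w) := by
    filter_upwards [h] with y hy using hy v w
  have h2 : ∀ v, HasFDerivAt (fun y => fderiv ℝ f y v)
      ((fderiv ℝ (fderiv ℝ f) z).flip v) z := fun v => by
    have := hfd2.hasFDerivAt.clm_apply (hasFDerivAt_const v z)
    convert! this using 1
    simp
  rw [h1.fderiv_eq, fderiv_bilin_comp_apply (B := fun y => B' (f y)) (hB'.hasFDerivAt.comp z hfd.hasFDerivAt) (h2 v) (h2 w)]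
  simp

lemma fderiv_comp_apply {f : V → V} {ψ : ℝ × ℝ → V} {q : ℝ × ℝ}
    (hf : DifferentiableAt ℝ f (ψ q)) (hψ : DifferentiableAt ℝ ψ q) (v : ℝ × ℝ) :
    fderiv ℝ (f ∘ ψ) q v = fderiv ℝ f (ψ q) (fderiv ℝ ψ q v) := by
  rw [fderiv_comp q hf hψ]
  rfl

lemma ContDiffAt.eventually_differentiableAt {X Y : Type*} [NormedAddCommGroup X] [NormedSpace ℝ X]
    [NormedAddCommGroup Y] [NormedSpace ℝ Y] {f : X → Y} {x : X} (hf : ContDiffAt ℝ ∞ f x) :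
    ∀ᶠ y in 𝓝 x, DifferentiableAt ℝ f y := by
  filter_upwards [(hf.of_le (m := 1) (by simp)).eventually (by simp)] with y hy
    using hy.differentiableAt one_ne_zero

lemma second_fderiv_comp_apply {f : V → V} {ψ : ℝ × ℝ → V} {q : ℝ × ℝ}
    (hf : ContDiffAt ℝ ∞ f (ψ q)) (hψ : ContDiffAt ℝ ∞ ψ q) (v : ℝ × ℝ) :
    fderiv ℝ (fun p => fderiv ℝ (f ∘ ψ) p v) q v
      = fderiv ℝ (fderiv ℝ f) (ψ q) (fderiv ℝ ψ q v) (fderiv ℝ ψ q v)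
        + fderiv ℝ f (ψ q) (fderiv ℝ (fun p => fderiv ℝ ψ p v) q v) := by
  have h1 : (fun p => fderiv ℝ (f ∘ ψ) p v) =ᶠ[𝓝 q] fun p => fderiv ℝ f (ψ p) (fderiv ℝ ψ p v) := by
    filter_upwards [hψ.continuousAt.eventually hf.eventually_differentiableAt,
      hψ.eventually_differentiableAt] with p h1 h2 using fderiv_comp_apply h1 h2 v
  have hfd2 : DifferentiableAt ℝ (fderiv ℝ f) (ψ q) :=
    (hf.fderiv_right (m := ∞) (by simp)).differentiableAt (by simp)
  have hψd2 : DifferentiableAt ℝ (fun p => fderiv ℝ ψ p v) q :=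
    ((hψ.fderiv_right (m := ∞) (by simp)).clm_apply contDiffAt_const).differentiableAt (by simp)
  have hψd : DifferentiableAt ℝ ψ q := hψ.differentiableAt (by simp)
  have h2 : HasFDerivAt (fun p => fderiv ℝ f (ψ p) (fderiv ℝ ψ p v)) _ q :=
    (hfd2.hasFDerivAt.comp q hψd.hasFDerivAt).clm_apply hψd2.hasFDerivAt
  rw [h1.fderiv_eq, h2.fderiv]
  simp [add_comm]

/-- The wave operator of a composition. -/
lemma waveOp_comp {f : V → V} {ψ : ℝ × ℝ → V} {q : ℝ × ℝ}
    (hf : ContDiffAt ℝ ∞ f (ψ q)) (hψ : ContDiffAt ℝ ∞ ψ q) :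
    waveOp (f ∘ ψ) q = fderiv ℝ f (ψ q) (waveOp ψ q)
      + fderiv ℝ (fderiv ℝ f) (ψ q) (dT ψ q + dX ψ q) (dT ψ q - dX ψ q) := by
  have hsymm : IsSymmSndFDerivAt ℝ f (ψ q) :=
    (hf.of_le (m := 2) (WithTop.coe_le_coe.2 le_top)).isSymmSndFDerivAt (by simp)
  have h1 : dT (dT (f ∘ ψ)) q = _ := second_fderiv_comp_apply hf hψ (0, 1)
  have h2 : dX (dX (f ∘ ψ)) q = _ := second_fderiv_comp_apply hf hψ (1, 0)
  have h3 : fderiv ℝ (fderiv ℝ f) (ψ q) (dX ψ q) (dT ψ q)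
      = fderiv ℝ (fderiv ℝ f) (ψ q) (dT ψ q) (dX ψ q) := hsymm.eq _ _
  have h4 : waveOp ψ q = fderiv ℝ (fun p => fderiv ℝ ψ p (0, 1)) q (0, 1)
    - fderiv ℝ (fun p => fderiv ℝ ψ p (1, 0)) q (1, 0) := rfl
  rw [waveOp, h1, h2, h4]
  simp only [map_add, map_sub, add_apply, h3]
  simp only [dT, dX]
  abel

/-- Invariance of the torsion wave map equation under coordinate changes. -/
lemma LoweredEqAt.comp {G P G' P' : V → V →L[ℝ] V →L[ℝ] ℝ} {c : ℝ} {f : V → V} {ψ : ℝ × ℝ → V}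
    {q : ℝ × ℝ} (h : LoweredEqAt G P c ψ q) (hf : ContDiffAt ℝ ∞ f (ψ q))
    (hψ : ContDiffAt ℝ ∞ ψ q) (hG : DifferentiableAt ℝ G (ψ q)) (hP : DifferentiableAt ℝ P (ψ q))
    (hG' : DifferentiableAt ℝ G' (f (ψ q))) (hP' : DifferentiableAt ℝ P' (f (ψ q)))
    (hGs : ∀ v w, G' (f (ψ q)) v w = G' (f (ψ q)) w v)
    (hPs : ∀ v w, P' (f (ψ q)) v w = -P' (f (ψ q)) w v)
    (hGG : ∀ᶠ y in 𝓝 (ψ q), ∀ v w, G y v w = G' (f y) (fderiv ℝ f y v) (fderiv ℝ f y w))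
    (hPP : ∀ᶠ y in 𝓝 (ψ q), ∀ v w, P y v w = P' (f y) (fderiv ℝ f y v) (fderiv ℝ f y w))
    (hsurj : Function.Surjective (fderiv ℝ f (ψ q))) :
    LoweredEqAt G' P' c (f ∘ ψ) q := by
  intro w'
  obtain ⟨w, rfl⟩ := hsurj w'
  have hw := h w
  have eT : dT (f ∘ ψ) q = fderiv ℝ f (ψ q) (dT ψ q) := fderiv_comp_apply (hf.differentiableAt (by simp)) (hψ.differentiableAt (by simp)) _
  have eX : dX (f ∘ ψ) q = fderiv ℝ f (ψ q) (dX ψ q) := fderiv_comp_apply (hf.differentiableAt (by simp)) (hψ.differentiableAt (by simp)) _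
  have hsymm : IsSymmSndFDerivAt ℝ f (ψ q) :=
    (hf.of_le (m := 2) (WithTop.coe_le_coe.2 le_top)).isSymmSndFDerivAt (by simp)
  have hD2 : ∀ u v, fderiv ℝ (fderiv ℝ f) (ψ q) u v = fderiv ℝ (fderiv ℝ f) (ψ q) v u :=
    fun u v => hsymm.eq u v
  rw [waveOp_comp hf hψ, eT, eX, ← map_add, ← map_sub]
  set a := dT ψ q + dX ψ q
  set b := dT ψ q - dX ψ q
  have eG := fderiv_pullback hG hG' hf hGG
  have eP := fderiv_pullback hP hP' hf hPP
  have e1 := hGG.self_of_nhds w (waveOp ψ q)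
  simp only [koszul, extDTwo, eG, eP] at hw
  simp only [koszul, extDTwo, Function.comp, map_add]
  rw [← e1, hw]
  -- The second derivative `D` of the coordinate change enters through the wave operator and through
  -- the derivatives of the pulled-back forms. By the symmetry of `D` and of `G'`, the Koszul
  -- expression keeps only `G' (L w) (D a b)`, which cancels the term from `waveOp_comp`. In the
  -- cyclic sum for `P'` the `D`-terms cancel in pairs by skewness.
  rw [hD2 b a, hD2 w a, hD2 w b]
  set L := fderiv ℝ f (ψ q)
  set D := fderiv ℝ (fderiv ℝ f) (ψ q)
  linear_combination hGs (L w) (D a b) + 1 / 2 * hGs (D a w) (L b) + c / 2 * hPs (D a w) (L b)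
    + c / 2 * hPs (L a) (D b w) + c / 2 * hPs (D a b) (L w)

lemma fderiv_energy {G : V → V →L[ℝ] V →L[ℝ] ℝ} {ψ a : ℝ × ℝ → V} {q : ℝ × ℝ}
    (hG : DifferentiableAt ℝ G (ψ q)) (hs : ∀ v w, G (ψ q) v w = G (ψ q) w v)
    (hψ : DifferentiableAt ℝ ψ q) (ha : DifferentiableAt ℝ a q) (v : ℝ × ℝ) :
    fderiv ℝ (fun p => G (ψ p) (a p) (a p)) q v
      = fderiv ℝ G (ψ q) (fderiv ℝ ψ q v) (a q) (a q) + 2 * G (ψ q) (a q) (fderiv ℝ a q v) := by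
  rw [fderiv_bilin_comp_apply (B := fun p => G (ψ p)) (hG.hasFDerivAt.comp q hψ.hasFDerivAt) ha.hasFDerivAt ha.hasFDerivAt]
  rw [hs (fderiv ℝ a q v)]
  simp
  ring

/-- Conservation of the density of one null derivative along the characteristics of the other. -/
lemma LoweredEqAt.energy_add {G P : V → V →L[ℝ] V →L[ℝ] ℝ} {c : ℝ} {ψ : ℝ × ℝ → V} {q : ℝ × ℝ}
    (h : LoweredEqAt G P c ψ q) (hψ : ContDiffAt ℝ ∞ ψ q) (hG : DifferentiableAt ℝ G (ψ q))
    (hP : DifferentiableAt ℝ P (ψ q)) (hGs : ∀ᶠ y in 𝓝 (ψ q), ∀ v w, G y v w = G y w v)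
    (hPs : ∀ᶠ y in 𝓝 (ψ q), ∀ v w, P y v w = -P y w v) :
    fderiv ℝ (fun p => G (ψ p) (dT ψ p + dX ψ p) (dT ψ p + dX ψ p)) q (-1, 1) = 0 := by
  have hd : DifferentiableAt ℝ (fun p => dT ψ p + dX ψ p) q :=
    (hψ.dT.add hψ.dX).differentiableAt (by simp)
  rw [fderiv_energy hG hGs.self_of_nhds (hψ.differentiableAt (by simp)) hd]
  have e1 : fderiv ℝ (fun p => dT ψ p + dX ψ p) q (-1, 1) = waveOp ψ q := by
    rw [fderiv_eq_dX_dT, ← dT_sub_dX_of_add hψ]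
    simp [sub_eq_neg_add]
  have e2 : fderiv ℝ ψ q (-1, 1) = dT ψ q - dX ψ q := by
    rw [fderiv_eq_dX_dT]
    simp [sub_eq_neg_add]
  -- The equation is tested with `w = a`. The Koszul term is then half the derivative of `G (a, a)`
  -- in the direction `b`, which cancels the derivative of the metric, and the exterior derivative
  -- vanishes because `a` appears in it twice.
  rw [e1, e2, h]
  set a := dT ψ q + dX ψ q
  set b := dT ψ q - dX ψ q
  have s1 := fderiv_bilin_symm hG hGs a a b
  have k1 := fderiv_bilin_skew hP hPs a a b
  have k2 := fderiv_bilin_skew hP hPs b a a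
  simp only [koszul, extDTwo]
  linear_combination s1 + c * k1 + c / 2 * k2

/-- The mirror image of `LoweredEqAt.energy_add`: the equation is tested with `b`, and `b` appears
twice in the exterior derivative. -/
lemma LoweredEqAt.energy_sub {G P : V → V →L[ℝ] V →L[ℝ] ℝ} {c : ℝ} {ψ : ℝ × ℝ → V} {q : ℝ × ℝ}
    (h : LoweredEqAt G P c ψ q) (hψ : ContDiffAt ℝ ∞ ψ q) (hG : DifferentiableAt ℝ G (ψ q))
    (hP : DifferentiableAt ℝ P (ψ q)) (hGs : ∀ᶠ y in 𝓝 (ψ q), ∀ v w, G y v w = G y w v)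
    (hPs : ∀ᶠ y in 𝓝 (ψ q), ∀ v w, P y v w = -P y w v) :
    fderiv ℝ (fun p => G (ψ p) (dT ψ p - dX ψ p) (dT ψ p - dX ψ p)) q (1, 1) = 0 := by
  have hd : DifferentiableAt ℝ (fun p => dT ψ p - dX ψ p) q :=
    (hψ.dT.sub hψ.dX).differentiableAt (by simp)
  rw [fderiv_energy hG hGs.self_of_nhds (hψ.differentiableAt (by simp)) hd]
  have e1 : fderiv ℝ (fun p => dT ψ p - dX ψ p) q (1, 1) = waveOp ψ q := by
    rw [fderiv_eq_dX_dT, ← dT_add_dX_of_sub hψ, one_smul, one_smul, add_comm]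
  have e2 : fderiv ℝ ψ q (1, 1) = dT ψ q + dX ψ q := by
    rw [fderiv_eq_dX_dT, one_smul, one_smul, add_comm]
  rw [e1, e2, h]
  set a := dT ψ q + dX ψ q
  set b := dT ψ q - dX ψ q
  have k1 := fderiv_bilin_skew hP hPs b b a
  have k2 := fderiv_bilin_skew hP hPs a b b
  simp only [koszul, extDTwo]
  linear_combination c * k1 + c / 2 * k2

end ChartCalculus

/-! ### The torsion wave map equation in one chart. -/

section ChartEquation

open Set Filter Topology

variable {n : ℕ} {N : Type*} [TopologicalSpace N] [ChartedSpace (EuclideanSpace ℝ (Fin n)) N]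
  [IsManifold (𝓡 n) ∞ N] [RiemannianBundle (fun x : N => TangentSpace (𝓡 n) x)]
  {e : OpenPartialHomeomorph N (EuclideanSpace ℝ (Fin n))}

omit [IsManifold (𝓡 n) ∞ N] in
lemma metricCoeff_symm (e : OpenPartialHomeomorph N (EuclideanSpace ℝ (Fin n)))
    (z : EuclideanSpace ℝ (Fin n)) (A B : Fin n) : metricCoeff e z A B = metricCoeff e z B A := by
  simp only [metricCoeff, Matrix.of_apply]
  exact real_inner_comm _ _

omit [IsManifold (𝓡 n) ∞ N] in
lemma formOf_metricCoeff_apply (e : OpenPartialHomeomorph N (EuclideanSpace ℝ (Fin n)))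
    (z v w : EuclideanSpace ℝ (Fin n)) :
    formOf (metricCoeff e z) v w = ∑ A, ∑ B, metricCoeff e z A B * v A * w B :=
  formOf_apply _ _ _

omit [RiemannianBundle (fun x : N => TangentSpace (𝓡 n) x)] in
lemma TwoForm.form_skew (p : TwoForm n N) (x : N) (v w : TangentSpace (𝓡 n) x) :
    p.form x v w = -p.form x w v := by
  have h := p.alt x (v + w)
  simp only [map_add, add_apply, p.alt, zero_add, add_zero] at h
  linarith

omit [IsManifold (𝓡 n) ∞ N] in
lemma formOf_metricCoeff_symm (e : OpenPartialHomeomorph N (EuclideanSpace ℝ (Fin n)))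
    (z v w : EuclideanSpace ℝ (Fin n)) :
    formOf (metricCoeff e z) v w = formOf (metricCoeff e z) w v := by
  rw [formOf_metricCoeff, formOf_metricCoeff, real_inner_comm]

omit [RiemannianBundle (fun x : N => TangentSpace (𝓡 n) x)] in
lemma TwoForm.formOf_coeff_skew (p : TwoForm n N)
    (e : OpenPartialHomeomorph N (EuclideanSpace ℝ (Fin n)))
    (z v w : EuclideanSpace ℝ (Fin n)) :
    formOf (p.coeff e z) v w = -formOf (p.coeff e z) w v := by
  rw [p.formOf_coeff, p.formOf_coeff, p.form_skew]

omit [IsManifold (𝓡 n) ∞ N] in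
lemma formOf_metricCoeff_pos (he : e ∈ IsManifold.maximalAtlas (𝓡 n) ∞ N)
    {z : EuclideanSpace ℝ (Fin n)} (hz : z ∈ e.target) {v : EuclideanSpace ℝ (Fin n)}
    (hv : v ≠ 0) : 0 < formOf (metricCoeff e z) v v := by
  rw [formOf_metricCoeff]
  refine real_inner_self_pos.2 fun h => hv ?_
  exact injective_mfderiv_symm he hz (h.trans (map_zero _).symm)

omit [IsManifold (𝓡 n) ∞ N] in
lemma eq_of_forall_formOf_metricCoeff (he : e ∈ IsManifold.maximalAtlas (𝓡 n) ∞ N)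
    {z : EuclideanSpace ℝ (Fin n)} (hz : z ∈ e.target) {v v' : EuclideanSpace ℝ (Fin n)}
    (h : ∀ w, formOf (metricCoeff e z) w v = formOf (metricCoeff e z) w v') : v = v' := by
  by_contra hne
  have := formOf_metricCoeff_pos he hz (sub_ne_zero.2 hne)
  rw [map_sub, h, sub_self] at this
  exact lt_irrefl _ this

-- A vector in the kernel of the matrix would have length zero.
omit [IsManifold (𝓡 n) ∞ N] in
lemma isUnit_det_metricCoeff (he : e ∈ IsManifold.maximalAtlas (𝓡 n) ∞ N)
    {z : EuclideanSpace ℝ (Fin n)} (hz : z ∈ e.target) : IsUnit (metricCoeff e z).det := by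
  rw [isUnit_iff_ne_zero]
  intro h0
  obtain ⟨v, hv, hv0⟩ := Matrix.exists_mulVec_eq_zero_iff.2 h0
  have hv' : WithLp.toLp 2 v ≠ 0 := by simpa using hv
  have := formOf_metricCoeff_pos he hz hv'
  rw [formOf_metricCoeff_apply] at this
  have h2 : ∀ A, ∑ B, metricCoeff e z A B * v B = 0 := fun A => congrFun hv0 A
  refine this.ne' (Finset.sum_eq_zero fun A _ => ?_)
  rw [← mul_zero (v A), ← h2 A, Finset.mul_sum]
  exact Finset.sum_congr rfl fun B _ => by ring

-- The identity `g g⁻¹ = 1` in the shape of the sums that define `christoffel` and `torsionCoeff`,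
-- for which `k` is `1 / 2` and `3 / 2`.
omit [IsManifold (𝓡 n) ∞ N] in
lemma sum_metricCoeff_mul_inv (he : e ∈ IsManifold.maximalAtlas (𝓡 n) ∞ N)
    {z : EuclideanSpace ℝ (Fin n)} (hz : z ∈ e.target) (k : ℝ) (X : Fin n → ℝ) (D : Fin n) :
    ∑ A, metricCoeff e z D A * ∑ D', k * (metricCoeff e z)⁻¹ A D' * X D' = k * X D := by
  have h1 : metricCoeff e z * (metricCoeff e z)⁻¹ = 1 :=
    Matrix.mul_nonsing_inv _ (isUnit_det_metricCoeff he hz)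
  have h2 := congrFun (congrArg (fun M => Matrix.mulVec M X) h1) D
  simp only [← Matrix.mulVec_mulVec, Matrix.one_mulVec] at h2
  rw [← h2]
  simp only [Matrix.mulVec, dotProduct, Finset.mul_sum]
  exact Finset.sum_congr rfl fun A _ => Finset.sum_congr rfl fun B _ => by ring

/-- The right-hand side of the equation for the coordinate functions, as a function of the point
and of the two null derivatives. -/
noncomputable def waveMapSource (p : TwoForm n N) (c : ℝ)
    (e : OpenPartialHomeomorph N (EuclideanSpace ℝ (Fin n)))
    (y : EuclideanSpace ℝ (Fin n) × EuclideanSpace ℝ (Fin n) × EuclideanSpace ℝ (Fin n)) :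
    EuclideanSpace ℝ (Fin n) :=
  WithLp.toLp 2 fun A => ∑ B, ∑ C,
    (-christoffel e y.1 A B C + c * torsionCoeff p e y.1 A B C) * (y.2.1 B * y.2.2 C)

section Smooth

variable [IsContMDiffRiemannianBundle (𝓡 n) ∞ (EuclideanSpace ℝ (Fin n))
      (fun x : N => TangentSpace (𝓡 n) x)]

omit [IsManifold (𝓡 n) ∞ N] [RiemannianBundle (fun x : N => TangentSpace (𝓡 n) x)] in
lemma contDiffOn_det {X : Type*} [NormedAddCommGroup X] [NormedSpace ℝ X] {s : Set X}
    {M : X → Matrix (Fin n) (Fin n) ℝ} (h : ∀ A B, ContDiffOn ℝ ∞ (fun z => M z A B) s) :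
    ContDiffOn ℝ ∞ (fun z => (M z).det) s := by
  simp only [Matrix.det_apply]
  exact ContDiffOn.sum fun σ _ => (contDiffOn_prod fun i _ => h _ _).const_smul _

lemma contDiffOn_inv_metricCoeff (he : e ∈ IsManifold.maximalAtlas (𝓡 n) ∞ N) (A B : Fin n) :
    ContDiffOn ℝ ∞ (fun z => (metricCoeff e z)⁻¹ A B) e.target := by
  have h0 := contDiffOn_metricCoeff he
  have h1 : ContDiffOn ℝ ∞ (fun z => (metricCoeff e z).det⁻¹) e.target :=
    (contDiffOn_det h0).inv fun z hz => (isUnit_det_metricCoeff he hz).ne_zero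
  have h2 : ContDiffOn ℝ ∞ (fun z => (metricCoeff e z).adjugate A B) e.target := by
    simp only [Matrix.adjugate_apply]
    refine contDiffOn_det fun C D => ?_
    simp only [Matrix.updateRow_apply]
    split_ifs
    · exact contDiffOn_const
    · exact h0 C D
  refine (h1.mul h2).congr fun z _ => ?_
  rw [Matrix.inv_def, Ring.inverse_eq_inv']
  rfl

omit [TopologicalSpace N] [ChartedSpace (EuclideanSpace ℝ (Fin n)) N] [IsManifold (𝓡 n) ∞ N]
  [RiemannianBundle (fun x : N => TangentSpace (𝓡 n) x)] in
lemma contDiffOn_coordDeriv {f : EuclideanSpace ℝ (Fin n) → ℝ}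
    {s : Set (EuclideanSpace ℝ (Fin n))} (hs : IsOpen s) (hf : ContDiffOn ℝ ∞ f s) (A : Fin n) :
    ContDiffOn ℝ ∞ (coordDeriv A f) s :=
  (hf.fderiv_of_isOpen hs (m := ∞) (by simp)).clm_apply contDiffOn_const

lemma contDiffOn_christoffel (he : e ∈ IsManifold.maximalAtlas (𝓡 n) ∞ N) (A B C : Fin n) :
    ContDiffOn ℝ ∞ (fun z => christoffel e z A B C) e.target := by
  have h := fun A B C => contDiffOn_coordDeriv e.open_target (contDiffOn_metricCoeff he A B) C
  exact ContDiffOn.sum fun D _ => (contDiffOn_const.mul (contDiffOn_inv_metricCoeff he A D)).mul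
    (((h D C B).add (h D B C)).sub (h B C D))

lemma contDiffOn_torsionCoeff (p : TwoForm n N) (he : e ∈ IsManifold.maximalAtlas (𝓡 n) ∞ N)
    (A B C : Fin n) : ContDiffOn ℝ ∞ (fun z => torsionCoeff p e z A B C) e.target := by
  have h := fun A B C => contDiffOn_coordDeriv e.open_target (p.contDiffOn_coeff he A B) C
  exact ContDiffOn.sum fun D _ => (contDiffOn_const.mul (contDiffOn_inv_metricCoeff he A D)).mul
    (contDiffOn_const.mul (((h B C D).add (h C D B)).add (h D B C)))

lemma contDiffOn_waveMapSource (p : TwoForm n N) (c : ℝ)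
    (he : e ∈ IsManifold.maximalAtlas (𝓡 n) ∞ N) :
    ContDiffOn ℝ ∞ (waveMapSource p c e) (e.target ×ˢ univ) := by
  refine contDiffOn_euclidean.2 fun A => ?_
  simp only [waveMapSource]
  refine ContDiffOn.sum fun B _ => ContDiffOn.sum fun C _ => ?_
  have hm : MapsTo (Prod.fst : EuclideanSpace ℝ (Fin n) × EuclideanSpace ℝ (Fin n) ×
      EuclideanSpace ℝ (Fin n) → _) (e.target ×ˢ univ) e.target := fun y hy => hy.1
  refine ContDiffOn.mul (ContDiffOn.add ?_ (contDiffOn_const.mul ?_)) ?_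
  · exact ((contDiffOn_christoffel he A B C).comp contDiffOn_fst hm).neg
  · exact (contDiffOn_torsionCoeff p he A B C).comp contDiffOn_fst hm
  · have h1 : ∀ A : Fin n, ContDiff ℝ ∞ fun z : EuclideanSpace ℝ (Fin n) => z A := fun A =>
      (EuclideanSpace.proj (𝕜 := ℝ) A : EuclideanSpace ℝ (Fin n) →L[ℝ] ℝ).contDiff
    exact (((h1 B).comp (contDiff_fst.comp contDiff_snd)).mul
      ((h1 C).comp (contDiff_snd.comp contDiff_snd))).contDiffOn

lemma contDiffAt_formOf_metricCoeff (he : e ∈ IsManifold.maximalAtlas (𝓡 n) ∞ N)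
    {z : EuclideanSpace ℝ (Fin n)} (hz : z ∈ e.target) :
    ContDiffAt ℝ ∞ (fun z => formOf (metricCoeff e z)) z :=
  (contDiffOn_formOf (contDiffOn_metricCoeff he)).contDiffAt (e.open_target.mem_nhds hz)

omit [RiemannianBundle (fun x : N => TangentSpace (𝓡 n) x)]
  [IsContMDiffRiemannianBundle (𝓡 n) ∞ (EuclideanSpace ℝ (Fin n))
      (fun x : N => TangentSpace (𝓡 n) x)] in
lemma TwoForm.contDiffAt_formOf_coeff (p : TwoForm n N)
    (he : e ∈ IsManifold.maximalAtlas (𝓡 n) ∞ N)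
    {z : EuclideanSpace ℝ (Fin n)} (hz : z ∈ e.target) :
    ContDiffAt ℝ ∞ (fun z => formOf (p.coeff e z)) z :=
  (contDiffOn_formOf (p.contDiffOn_coeff he)).contDiffAt (e.open_target.mem_nhds hz)

/-- Lowering the index of the source. -/
lemma formOf_metricCoeff_waveMapSource (p : TwoForm n N) (c : ℝ)
    (he : e ∈ IsManifold.maximalAtlas (𝓡 n) ∞ N) {z : EuclideanSpace ℝ (Fin n)}
    (hz : z ∈ e.target) (a b w : EuclideanSpace ℝ (Fin n)) :
    formOf (metricCoeff e z) w (waveMapSource p c e (z, a, b))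
      = -koszul (fun z => formOf (metricCoeff e z)) z a b w
        + c / 2 * extDTwo (fun z => formOf (p.coeff e z)) z w a b := by
  have hg : ∀ A B, DifferentiableAt ℝ (fun z => metricCoeff e z A B) z := fun A B =>
    ((contDiffOn_metricCoeff he A B).contDiffAt (e.open_target.mem_nhds hz)).differentiableAt
      (by simp)
  have hp : ∀ A B, DifferentiableAt ℝ (fun z => p.coeff e z A B) z := fun A B =>
    ((p.contDiffOn_coeff he A B).contDiffAt (e.open_target.mem_nhds hz)).differentiableAt
      (by simp)
  set g : Fin n → Fin n → Fin n → ℝ := fun A B C =>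
    coordDeriv A (fun z => metricCoeff e z B C) z with hgdef
  set q : Fin n → Fin n → Fin n → ℝ := fun A B C =>
    coordDeriv A (fun z => p.coeff e z B C) z with hqdef
  have lΓ : ∀ D B C, ∑ A, metricCoeff e z D A * christoffel e z A B C
      = 1 / 2 * (g B D C + g C D B - g D B C) := fun D B C =>
    sum_metricCoeff_mul_inv he hz (1 / 2) (fun D => g B D C + g C D B - g D B C) D
  have lQ : ∀ D B C, ∑ A, metricCoeff e z D A * torsionCoeff p e z A B C
      = 3 / 2 * (1 / 3 * (q D B C + q B C D + q C D B)) := fun D B C =>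
    sum_metricCoeff_mul_inv he hz (3 / 2) (fun D => 1 / 3 * (q D B C + q B C D + q C D B)) D
  have e1 : formOf (metricCoeff e z) w (waveMapSource p c e (z, a, b))
      = ∑ D, ∑ B, ∑ C, (-(1 / 2 * (g B D C + g C D B - g D B C))
        + c * (3 / 2 * (1 / 3 * (q D B C + q B C D + q C D B)))) * (w D * a B * b C) := by
    rw [formOf_metricCoeff_apply]
    refine Finset.sum_congr rfl fun D _ => ?_
    simp only [← lΓ, ← lQ, waveMapSource, Finset.mul_sum]
    rw [Finset.sum_comm]
    refine Finset.sum_congr rfl fun B _ => ?_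
    rw [Finset.sum_comm]
    refine Finset.sum_congr rfl fun C _ => ?_
    rw [← Finset.sum_neg_distrib, ← Finset.sum_add_distrib, Finset.sum_mul]
    exact Finset.sum_congr rfl fun A _ => by ring
  have k1 : ∀ u v w : EuclideanSpace ℝ (Fin n), fderiv ℝ (fun z => formOf (metricCoeff e z)) z u v w
      = ∑ A, ∑ B, ∑ C, g A B C * u A * v B * w C := fderiv_formOf_apply hg
  have k2 : ∀ u v w : EuclideanSpace ℝ (Fin n), fderiv ℝ (fun z => formOf (p.coeff e z)) z u v w
      = ∑ A, ∑ B, ∑ C, q A B C * u A * v B * w C := fderiv_formOf_apply hp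
  -- The trilinear expressions put the index of differentiation first. These rotations bring every
  -- sum to the common order `D, B, C`, with `D` contracted with `w`, `B` with `a` and `C` with `b`,
  -- after which the summands can be compared.
  have rot1 : ∀ f : Fin n → Fin n → Fin n → ℝ,
      ∑ B, ∑ C, ∑ D, f B C D = ∑ D, ∑ B, ∑ C, f B C D := by
    intro f
    conv_rhs => rw [Finset.sum_comm]
    exact Finset.sum_congr rfl fun B _ => Finset.sum_comm
  have rot2 : ∀ f : Fin n → Fin n → Fin n → ℝ,
      ∑ C, ∑ D, ∑ B, f C D B = ∑ D, ∑ B, ∑ C, f C D B := by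
    intro f
    rw [Finset.sum_comm]
    exact Finset.sum_congr rfl fun D _ => Finset.sum_comm
  have rot3 : ∀ f : Fin n → Fin n → Fin n → ℝ,
      ∑ C, ∑ B, ∑ D, f C B D = ∑ D, ∑ B, ∑ C, f C B D := by
    intro f
    rw [rot1]
    exact Finset.sum_congr rfl fun D _ => Finset.sum_comm
  have swap : ∀ (z : EuclideanSpace ℝ (Fin n)) (A B : Fin n),
      metricCoeff e z A B = metricCoeff e z B A := metricCoeff_symm e
  have gs : ∀ A B C, g A B C = g A C B := fun A B C => by
    simp only [hgdef]
    congr 1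
    funext y
    exact swap y B C
  rw [e1, koszul, extDTwo]
  simp only [k1, k2]
  rw [rot1 (fun B C D => g B C D * a B * b C * w D), rot3 (fun C B D => g C B D * b C * a B * w D),
    rot1 (fun B C D => q B C D * a B * b C * w D), rot2 (fun C D B => q C D B * b C * w D * a B)]
  simp only [← Finset.sum_add_distrib, ← Finset.sum_sub_distrib, Finset.mul_sum,
    ← Finset.sum_neg_distrib]
  refine Finset.sum_congr rfl fun D _ => Finset.sum_congr rfl fun B _ =>
    Finset.sum_congr rfl fun C _ => ?_
  rw [gs B D C, gs C D B]
  ring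

/-- Lowering the index loses nothing because the metric is definite. The lowered form contains no
inverse matrix, which keeps the change of chart and the energy identities polynomial. -/
lemma waveOp_eq_iff_loweredEqAt (p : TwoForm n N) (c : ℝ)
    (he : e ∈ IsManifold.maximalAtlas (𝓡 n) ∞ N) {ψ : ℝ × ℝ → EuclideanSpace ℝ (Fin n)}
    {q : ℝ × ℝ} (hz : ψ q ∈ e.target) :
    waveOp ψ q = waveMapSource p c e (ψ q, dT ψ q + dX ψ q, dT ψ q - dX ψ q) ↔
      LoweredEqAt (fun z => formOf (metricCoeff e z)) (fun z => formOf (p.coeff e z)) c ψ q := by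
  constructor
  · intro h w
    rw [h, ← formOf_metricCoeff_waveMapSource p c he hz]
  · intro h
    refine eq_of_forall_formOf_metricCoeff he hz fun w => ?_
    rw [formOf_metricCoeff_waveMapSource p c he hz]
    exact h w

end Smooth

/-- The coordinate form of the torsion wave map equation in the chart `e` at the point `q`. -/
def ChartEqAt (p : TwoForm n N) (lam vy : ℝ)
    (e : OpenPartialHomeomorph N (EuclideanSpace ℝ (Fin n))) (φ : ℝ × ℝ → N) (q : ℝ × ℝ) : Prop :=
  ∀ A : Fin n,
    (∑ α, ∑ β, minkowski α β * baseDeriv α (baseDeriv β (fun r => e (φ r) A)) q)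
      + ∑ B, ∑ C, ∑ α, ∑ β,
          (christoffel e (e (φ q)) A B C + torsionCoeff p e (e (φ q)) A B C)
            * baseDeriv α (fun r => e (φ r) B) q * baseDeriv β (fun r => e (φ r) C) q
            * (minkowski α β + lam * vy * leviCivita α β) = 0

omit [IsManifold (𝓡 n) ∞ N] in
lemma christoffel_symm (e : OpenPartialHomeomorph N (EuclideanSpace ℝ (Fin n)))
    (z : EuclideanSpace ℝ (Fin n)) (A B C : Fin n) :
    christoffel e z A B C = christoffel e z A C B := by
  have h : ∀ B C, (fun w => metricCoeff e w B C) = fun w => metricCoeff e w C B := fun B C =>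
    funext fun w => metricCoeff_symm e w B C
  refine Finset.sum_congr rfl fun D _ => ?_
  rw [h B C]
  ring

lemma torsionCoeff_skew (p : TwoForm n N)
    (e : OpenPartialHomeomorph N (EuclideanSpace ℝ (Fin n)))
    (z : EuclideanSpace ℝ (Fin n)) (A B C : Fin n) :
    torsionCoeff p e z A B C = -torsionCoeff p e z A C B := by
  have h : ∀ A B C, coordDeriv A (fun w => p.coeff e w B C) z
      = -coordDeriv A (fun w => p.coeff e w C B) z := fun A B C => by
    have : (fun w => p.coeff e w B C) = fun w => -p.coeff e w C B :=
      funext fun w => p.form_skew _ _ _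
    rw [this, coordDeriv, coordDeriv, fderiv_fun_neg]
    rfl
  rw [torsionCoeff, torsionCoeff, ← Finset.sum_neg_distrib]
  refine Finset.sum_congr rfl fun D _ => ?_
  rw [h D B C, h B C D, h C D B]
  ring

lemma sum_sum_eq_zero_of_skew {f : Fin n → Fin n → ℝ} (h : ∀ B C, f B C = -f C B) :
    ∑ B, ∑ C, f B C = 0 := by
  have h1 : ∑ B, ∑ C, f B C = -∑ B, ∑ C, f B C := by
    conv_lhs => rw [Finset.sum_comm]
    simp only [← Finset.sum_neg_distrib]
    exact Finset.sum_congr rfl fun B _ => Finset.sum_congr rfl fun C _ => h C B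
  linarith

lemma fderiv_coord_apply {ψ : ℝ × ℝ → EuclideanSpace ℝ (Fin n)} {q : ℝ × ℝ}
    (h : DifferentiableAt ℝ ψ q) (A : Fin n) (v : ℝ × ℝ) :
    fderiv ℝ (fun r => ψ r A) q v = (fderiv ℝ ψ q v) A := by
  have := ((EuclideanSpace.proj (𝕜 := ℝ) A : EuclideanSpace ℝ (Fin n) →L[ℝ] ℝ).hasFDerivAt.comp q
    h.hasFDerivAt).fderiv
  exact congrArg (fun L => L v) this

/-- `Γ` is symmetric and sees only `γ`, while `Q` is skew and sees only `ε`; the surviving quadratic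
terms are those of the product `a^B b^C` of null derivatives. -/
lemma chartEqAt_iff (p : TwoForm n N) (lam vy : ℝ)
    (e : OpenPartialHomeomorph N (EuclideanSpace ℝ (Fin n))) {φ : ℝ × ℝ → N} {q : ℝ × ℝ}
    (hψ : ContDiffAt ℝ ∞ (e ∘ φ) q) :
    ChartEqAt p lam vy e φ q ↔ waveOp (e ∘ φ) q = waveMapSource p (lam * vy) e
      ((e ∘ φ) q, dT (e ∘ φ) q + dX (e ∘ φ) q, dT (e ∘ φ) q - dX (e ∘ φ) q) := by
  set ψ := e ∘ φ with hψdef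
  have hd := hψ.differentiableAt (by simp)
  have b0 : ∀ A, baseDeriv 0 (fun r => e (φ r) A) q = dX ψ q A := fun A => fderiv_coord_apply hd A _
  have b1 : ∀ A, baseDeriv 1 (fun r => e (φ r) A) q = dT ψ q A := fun A => fderiv_coord_apply hd A _
  have b00 : ∀ A, baseDeriv 0 (baseDeriv 0 (fun r => e (φ r) A)) q = dX (dX ψ) q A := fun A => by
    have h1 : baseDeriv 0 (fun r => e (φ r) A) =ᶠ[𝓝 q] fun r => dX ψ r A := by
      filter_upwards [hψ.eventually_differentiableAt] with r hr using fderiv_coord_apply hr A _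
    rw [baseDeriv, h1.fderiv_eq]
    exact fderiv_coord_apply (hψ.dX.differentiableAt (by simp)) A _
  have b11 : ∀ A, baseDeriv 1 (baseDeriv 1 (fun r => e (φ r) A)) q = dT (dT ψ) q A := fun A => by
    have h1 : baseDeriv 1 (fun r => e (φ r) A) =ᶠ[𝓝 q] fun r => dT ψ r A := by
      filter_upwards [hψ.eventually_differentiableAt] with r hr using fderiv_coord_apply hr A _
    rw [baseDeriv, h1.fderiv_eq]
    exact fderiv_coord_apply (hψ.dT.differentiableAt (by simp)) A _
  have key : ∀ A, (∑ α, ∑ β, minkowski α β * baseDeriv α (baseDeriv β (fun r => e (φ r) A)) q)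
      + ∑ B, ∑ C, ∑ α, ∑ β,
          (christoffel e (e (φ q)) A B C + torsionCoeff p e (e (φ q)) A B C)
            * baseDeriv α (fun r => e (φ r) B) q * baseDeriv β (fun r => e (φ r) C) q
            * (minkowski α β + lam * vy * leviCivita α β)
      = -(waveOp ψ q A) + waveMapSource p (lam * vy) e
        (ψ q, dT ψ q + dX ψ q, dT ψ q - dX ψ q) A := by
    intro A
    simp only [Fin.sum_univ_two, b0, b1, b00, b11]
    -- This sum is the exact difference between the two sides. For `Γ`, the `lam * vy` comes from
    -- contracting with `ε` and the 1 from expanding `a^B b^C`; for `Q`, the 1 comes from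
    -- contracting with `γ` and the `lam * vy` from the expansion.
    have h0 := sum_sum_eq_zero_of_skew (f := fun B C => (1 + lam * vy) *
      (christoffel e (e (φ q)) A B C * (dX ψ q B * dT ψ q C - dT ψ q B * dX ψ q C)
        + torsionCoeff p e (e (φ q)) A B C * (dX ψ q B * dX ψ q C - dT ψ q B * dT ψ q C)))
      (fun B C => by
        rw [christoffel_symm e _ A B C, torsionCoeff_skew p e _ A B C]
        ring)
    rw [← add_zero (waveMapSource p (lam * vy) e (ψ q, dT ψ q + dX ψ q, dT ψ q - dX ψ q) A), ← h0]
    simp only [waveMapSource, waveOp, ← Finset.sum_add_distrib]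
    congr 1
    · simp [minkowski]
      ring
    · refine Finset.sum_congr rfl fun B _ => Finset.sum_congr rfl fun C _ => ?_
      simp [minkowski, leviCivita, hψdef]
      ring
  constructor
  · intro h
    ext A
    have := key A
    rw [h A] at this
    linarith
  · intro h A
    rw [key A, h]
    ring

end ChartEquation

set_option linter.unusedSectionVars false

/-! ### Solutions on open sets, independently of charts. -/

section SolutionsOnOpenSets

open Set Filter Topology

variable {n : ℕ} {N : Type*} [TopologicalSpace N] [ChartedSpace (EuclideanSpace ℝ (Fin n)) N]
  [IsManifold (𝓡 n) ∞ N] {e e' : OpenPartialHomeomorph N (EuclideanSpace ℝ (Fin n))}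

-- The base points are only propositionally equal. Since every tangent space unfolds to the model
-- space, the vectors are typed there and no transport between fibres is needed.
omit [IsManifold (𝓡 n) ∞ N] in
lemma fibre_bilin_congr (B : ∀ x : N, TangentSpace (𝓡 n) x → TangentSpace (𝓡 n) x → ℝ) {x x' : N}
    (hx : x = x') {v w v' w' : EuclideanSpace ℝ (Fin n)} (hv : v = v') (hw : w = w') :
    B x v w = B x' v' w' := by
  subst hx hv hw
  rfl

lemma contDiffAt_chart_comp (he : e ∈ IsManifold.maximalAtlas (𝓡 n) ∞ N) {φ : ℝ × ℝ → N}
    {q : ℝ × ℝ} (hq : φ q ∈ e.source) (hφ : ContMDiffAt 𝓘(ℝ, ℝ × ℝ) (𝓡 n) ∞ φ q) :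
    ContDiffAt ℝ ∞ (e ∘ φ) q :=
  ((contMDiffAt_of_mem_maximalAtlas he hq).comp q hφ).contDiffAt

lemma contDiffAt_chart_change (he : e ∈ IsManifold.maximalAtlas (𝓡 n) ∞ N)
    (he' : e' ∈ IsManifold.maximalAtlas (𝓡 n) ∞ N) {z : EuclideanSpace ℝ (Fin n)}
    (hz : z ∈ e.target) (hz' : e.symm z ∈ e'.source) : ContDiffAt ℝ ∞ (e' ∘ e.symm) z :=
  ((contMDiffAt_of_mem_maximalAtlas he' hz').comp z
    (contMDiffAt_symm_of_mem_maximalAtlas he hz)).contDiffAt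

lemma mfderiv_symm_comp_chart_change (he : e ∈ IsManifold.maximalAtlas (𝓡 n) ∞ N)
    (he' : e' ∈ IsManifold.maximalAtlas (𝓡 n) ∞ N) {z : EuclideanSpace ℝ (Fin n)}
    (hz : z ∈ e.target) (hz' : e.symm z ∈ e'.source) (v : EuclideanSpace ℝ (Fin n)) :
    (mfderiv (𝓡 n) (𝓡 n) e.symm z v : EuclideanSpace ℝ (Fin n))
      = mfderiv (𝓡 n) (𝓡 n) e'.symm (e' (e.symm z)) (fderiv ℝ (e' ∘ e.symm) z v) := by
  have h1 : (e'.symm ∘ (e' ∘ e.symm)) =ᶠ[𝓝 z] e.symm := by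
    filter_upwards [(e.isOpen_inter_preimage_symm e'.open_source).mem_nhds ⟨hz, hz'⟩] with y hy
    exact e'.left_inv hy.2
  have h2 : MDifferentiableAt (𝓡 n) (𝓡 n) e'.symm ((e' ∘ e.symm) z) :=
    (contMDiffAt_symm_of_mem_maximalAtlas he' (e'.map_source hz')).mdifferentiableAt (by simp)
  have h3 : MDifferentiableAt (𝓡 n) (𝓡 n) (e' ∘ e.symm) z :=
    ((contDiffAt_chart_change he he' hz hz').differentiableAt (by simp)).mdifferentiableAt
  have h4 := mfderiv_comp z h2 h3
  rw [mfderiv_eq_fderiv] at h4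
  have h5 := h1.mfderiv_eq (I := 𝓡 n) (I' := 𝓡 n)
  exact congrArg (fun L : EuclideanSpace ℝ (Fin n) →L[ℝ] EuclideanSpace ℝ (Fin n) => L v)
    (h5.symm.trans h4)

/-- Around a point of continuity, a map into `N` is recovered from its coordinates. -/
lemma symm_comp_eventuallyEq {φ : ℝ × ℝ → N} {q : ℝ × ℝ} (hφ : ContinuousAt φ q)
    (hq : φ q ∈ e.source) : (e.symm ∘ (e ∘ φ)) =ᶠ[𝓝 q] φ := by
  filter_upwards [hφ.preimage_mem_nhds (e.open_source.mem_nhds hq)] with r hr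
  exact e.left_inv hr

lemma mfderiv_eq_symm_comp (he : e ∈ IsManifold.maximalAtlas (𝓡 n) ∞ N) {φ : ℝ × ℝ → N}
    {q : ℝ × ℝ} (hq : φ q ∈ e.source) (hφ : ContMDiffAt 𝓘(ℝ, ℝ × ℝ) (𝓡 n) ∞ φ q) (v : ℝ × ℝ) :
    (mfderiv 𝓘(ℝ, ℝ × ℝ) (𝓡 n) φ q v : EuclideanSpace ℝ (Fin n))
      = mfderiv (𝓡 n) (𝓡 n) e.symm (e (φ q)) (fderiv ℝ (e ∘ φ) q v) := by
  have h2 : MDifferentiableAt (𝓡 n) (𝓡 n) e.symm ((e ∘ φ) q) :=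
    (contMDiffAt_symm_of_mem_maximalAtlas he (e.map_source hq)).mdifferentiableAt (by simp)
  have h3 : MDifferentiableAt 𝓘(ℝ, ℝ × ℝ) (𝓡 n) (e ∘ φ) q :=
    ((contDiffAt_chart_comp he hq hφ).differentiableAt (by simp)).mdifferentiableAt
  have h4 := mfderiv_comp q h2 h3
  rw [mfderiv_eq_fderiv] at h4
  have h5 := (symm_comp_eventuallyEq hφ.continuousAt hq).mfderiv_eq
    (I := 𝓘(ℝ, ℝ × ℝ)) (I' := 𝓡 n)
  exact congrArg (fun L : ℝ × ℝ →L[ℝ] EuclideanSpace ℝ (Fin n) => L v) (h5.symm.trans h4)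

variable [RiemannianBundle (fun x : N => TangentSpace (𝓡 n) x)]

lemma formOf_metricCoeff_chart_change (he : e ∈ IsManifold.maximalAtlas (𝓡 n) ∞ N)
    (he' : e' ∈ IsManifold.maximalAtlas (𝓡 n) ∞ N) {z : EuclideanSpace ℝ (Fin n)}
    (hz : z ∈ e.target) (hz' : e.symm z ∈ e'.source) (v w : EuclideanSpace ℝ (Fin n)) :
    formOf (metricCoeff e z) v w = formOf (metricCoeff e' ((e' ∘ e.symm) z))
      (fderiv ℝ (e' ∘ e.symm) z v) (fderiv ℝ (e' ∘ e.symm) z w) := by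
  rw [formOf_metricCoeff, formOf_metricCoeff]
  exact fibre_bilin_congr (fun x v w => inner ℝ v w) (e'.left_inv hz').symm
    (mfderiv_symm_comp_chart_change he he' hz hz' v)
    (mfderiv_symm_comp_chart_change he he' hz hz' w)

omit [RiemannianBundle (fun x : N => TangentSpace (𝓡 n) x)] in
lemma TwoForm.formOf_coeff_chart_change (p : TwoForm n N)
    (he : e ∈ IsManifold.maximalAtlas (𝓡 n) ∞ N)
    (he' : e' ∈ IsManifold.maximalAtlas (𝓡 n) ∞ N) {z : EuclideanSpace ℝ (Fin n)}
    (hz : z ∈ e.target) (hz' : e.symm z ∈ e'.source) (v w : EuclideanSpace ℝ (Fin n)) :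
    formOf (p.coeff e z) v w = formOf (p.coeff e' ((e' ∘ e.symm) z))
      (fderiv ℝ (e' ∘ e.symm) z v) (fderiv ℝ (e' ∘ e.symm) z w) := by
  rw [p.formOf_coeff, p.formOf_coeff]
  exact fibre_bilin_congr (fun x v w => p.form x v w) (e'.left_inv hz').symm
    (mfderiv_symm_comp_chart_change he he' hz hz' v)
    (mfderiv_symm_comp_chart_change he he' hz hz' w)

omit [IsManifold (𝓡 n) ∞ N] [TopologicalSpace N] [ChartedSpace (EuclideanSpace ℝ (Fin n)) N]
  [RiemannianBundle (fun x : N => TangentSpace (𝓡 n) x)] in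
lemma LoweredEqAt.congr {V : Type*} [NormedAddCommGroup V] [NormedSpace ℝ V]
    {G P : V → V →L[ℝ] V →L[ℝ] ℝ} {c : ℝ} {ψ ψ' : ℝ × ℝ → V} {q : ℝ × ℝ}
    (h : LoweredEqAt G P c ψ q) (hψ : ψ =ᶠ[𝓝 q] ψ') : LoweredEqAt G P c ψ' q := by
  intro w
  rw [← hψ.eq_of_nhds, ← hψ.dX.eq_of_nhds, ← hψ.dT.eq_of_nhds, waveOp, ← hψ.dX.dX.eq_of_nhds,
    ← hψ.dT.dT.eq_of_nhds]
  exact h w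

variable (n) in
/-- The energy density of `φ` in the direction `v`. -/
noncomputable def energyDensity (φ : ℝ × ℝ → N) (v q : ℝ × ℝ) : ℝ :=
  inner ℝ (mfderiv 𝓘(ℝ, ℝ × ℝ) (𝓡 n) φ q v) (mfderiv 𝓘(ℝ, ℝ × ℝ) (𝓡 n) φ q v)

lemma energyDensity_eq (he : e ∈ IsManifold.maximalAtlas (𝓡 n) ∞ N) {φ : ℝ × ℝ → N}
    {q : ℝ × ℝ} (hq : φ q ∈ e.source) (hφ : ContMDiffAt 𝓘(ℝ, ℝ × ℝ) (𝓡 n) ∞ φ q) (v : ℝ × ℝ) :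
    energyDensity n φ v q = formOf (metricCoeff e ((e ∘ φ) q)) (fderiv ℝ (e ∘ φ) q v)
      (fderiv ℝ (e ∘ φ) q v) := by
  rw [formOf_metricCoeff]
  exact fibre_bilin_congr (fun x v w => inner ℝ v w) (e.left_inv hq).symm
    (mfderiv_eq_symm_comp he hq hφ v) (mfderiv_eq_symm_comp he hq hφ v)

/-- `φ` is a smooth solution of the torsion wave map equation on the open set `O`. -/
structure IsSolutionOn (p : TwoForm n N) (lam vy : ℝ) (O : Set (ℝ × ℝ)) (φ : ℝ × ℝ → N) :
    Prop where
  smooth : ∀ q ∈ O, ContMDiffAt 𝓘(ℝ, ℝ × ℝ) (𝓡 n) ∞ φ q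
  eqn : ∀ q ∈ O, ∀ e ∈ IsManifold.maximalAtlas (𝓡 n) ∞ N, φ q ∈ e.source →
    ChartEqAt p lam vy e φ q

lemma IsSolutionOn.mono {p : TwoForm n N} {lam vy : ℝ} {O O' : Set (ℝ × ℝ)} {φ : ℝ × ℝ → N}
    (h : IsSolutionOn p lam vy O φ) (hO : O' ⊆ O) : IsSolutionOn p lam vy O' φ :=
  ⟨fun q hq => h.smooth q (hO hq), fun q hq => h.eqn q (hO hq)⟩

lemma ChartEqAt.congr {p : TwoForm n N} {lam vy : ℝ} {φ φ' : ℝ × ℝ → N} {q : ℝ × ℝ}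
    (h : ChartEqAt p lam vy e φ q) (hφ : φ =ᶠ[𝓝 q] φ') : ChartEqAt p lam vy e φ' q := by
  have h0 : ∀ A : Fin n, (fun r => e (φ r) A) =ᶠ[𝓝 q] fun r => e (φ' r) A := fun A =>
    hφ.mono fun r hr => by simp only [hr]
  have h1 : ∀ (A : Fin n) (α : Fin 2), baseDeriv α (fun r => e (φ r) A) =ᶠ[𝓝 q]
      baseDeriv α (fun r => e (φ' r) A) := fun A α =>
    (h0 A).fderiv.mono fun r hr => by rw [baseDeriv, baseDeriv, hr]
  have h2 : ∀ (A : Fin n) (α β : Fin 2), baseDeriv α (baseDeriv β (fun r => e (φ r) A)) q =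
      baseDeriv α (baseDeriv β (fun r => e (φ' r) A)) q := fun A α β => by
    rw [baseDeriv, baseDeriv, (h1 A β).fderiv_eq]
  intro A
  have := h A
  simpa only [h2, (h1 _ _).eq_of_nhds, hφ.eq_of_nhds] using this

/-- Being a solution depends only on germs; this is the tool for gluing. -/
lemma isSolutionOn_of_eventuallyEq {p : TwoForm n N} {lam vy : ℝ} {O : Set (ℝ × ℝ)}
    {φ : ℝ × ℝ → N}
    (h : ∀ q ∈ O, ∃ O' φ', q ∈ O' ∧ IsSolutionOn p lam vy O' φ' ∧ φ' =ᶠ[𝓝 q] φ) :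
    IsSolutionOn p lam vy O φ := by
  constructor
  · intro q hq
    obtain ⟨O', φ', hq', hs, hφ⟩ := h q hq
    exact (hs.smooth q hq').congr_of_eventuallyEq hφ.symm
  · intro q hq e he hqe
    obtain ⟨O', φ', hq', hs, hφ⟩ := h q hq
    rw [← hφ.eq_of_nhds] at hqe
    exact (hs.eqn q hq' e he hqe).congr hφ

variable [IsContMDiffRiemannianBundle (𝓡 n) ∞ (EuclideanSpace ℝ (Fin n))
      (fun x : N => TangentSpace (𝓡 n) x)]

lemma chartEqAt_iff_loweredEqAt (p : TwoForm n N) (lam vy : ℝ)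
    (he : e ∈ IsManifold.maximalAtlas (𝓡 n) ∞ N) {φ : ℝ × ℝ → N} {q : ℝ × ℝ}
    (hq : φ q ∈ e.source) (hφ : ContMDiffAt 𝓘(ℝ, ℝ × ℝ) (𝓡 n) ∞ φ q) :
    ChartEqAt p lam vy e φ q ↔ LoweredEqAt (fun z => formOf (metricCoeff e z))
      (fun z => formOf (p.coeff e z)) (lam * vy) (e ∘ φ) q := by
  rw [chartEqAt_iff p lam vy e (contDiffAt_chart_comp he hq hφ)]
  exact waveOp_eq_iff_loweredEqAt p _ he (e.map_source hq)

/-- The equation does not depend on the chart. -/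
lemma ChartEqAt.change {p : TwoForm n N} {lam vy : ℝ} {φ : ℝ × ℝ → N} {q : ℝ × ℝ}
    (h : ChartEqAt p lam vy e φ q) (he : e ∈ IsManifold.maximalAtlas (𝓡 n) ∞ N)
    (he' : e' ∈ IsManifold.maximalAtlas (𝓡 n) ∞ N) (hq : φ q ∈ e.source)
    (hq' : φ q ∈ e'.source) (hφ : ContMDiffAt 𝓘(ℝ, ℝ × ℝ) (𝓡 n) ∞ φ q) :
    ChartEqAt p lam vy e' φ q := by
  rw [chartEqAt_iff_loweredEqAt p lam vy he' hq' hφ]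
  rw [chartEqAt_iff_loweredEqAt p lam vy he hq hφ] at h
  have hz : (e ∘ φ) q ∈ e.target := e.map_source hq
  have hs : e.symm ((e ∘ φ) q) = φ q := e.left_inv hq
  have hz' : e.symm ((e ∘ φ) q) ∈ e'.source := hs ▸ hq'
  have hw : (e' ∘ e.symm) ((e ∘ φ) q) ∈ e'.target := e'.map_source hz'
  have hev : ∀ᶠ y in 𝓝 ((e ∘ φ) q), y ∈ e.target ∧ e.symm y ∈ e'.source :=
    (e.isOpen_inter_preimage_symm e'.open_source).mem_nhds ⟨hz, hz'⟩
  -- The metric in `e` is the pull-back of the metric in `e'`, so a vector in the kernel has length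
  -- zero. Equality of dimensions then gives surjectivity.
  have hinj : Function.Injective (fderiv ℝ (e' ∘ e.symm) ((e ∘ φ) q)) := by
    refine (injective_iff_map_eq_zero _).2 fun v hv => ?_
    by_contra h0
    have := formOf_metricCoeff_pos he hz h0
    rw [formOf_metricCoeff_chart_change he he' hz hz', hv] at this
    simp at this
  have hsurj : Function.Surjective (fderiv ℝ (e' ∘ e.symm) ((e ∘ φ) q)) :=
    LinearMap.surjective_of_injective
      (f := (fderiv ℝ (e' ∘ e.symm) ((e ∘ φ) q)).toLinearMap) hinj
  have := h.comp (f := e' ∘ e.symm) (G' := fun z => formOf (metricCoeff e' z))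
    (P' := fun z => formOf (p.coeff e' z))
    (contDiffAt_chart_change he he' hz hz') (contDiffAt_chart_comp he hq hφ)
    ((contDiffAt_formOf_metricCoeff he hz).differentiableAt (by simp))
    ((p.contDiffAt_formOf_coeff he hz).differentiableAt (by simp))
    ((contDiffAt_formOf_metricCoeff he' hw).differentiableAt (by simp))
    ((p.contDiffAt_formOf_coeff he' hw).differentiableAt (by simp))
    (formOf_metricCoeff_symm e' _) (p.formOf_coeff_skew e' _)
    (hev.mono fun y hy => formOf_metricCoeff_chart_change he he' hy.1 hy.2)
    (hev.mono fun y hy => p.formOf_coeff_chart_change he he' hy.1 hy.2) hsurj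
  refine this.congr ?_
  filter_upwards [symm_comp_eventuallyEq hφ.continuousAt hq] with r hr
  exact congrArg e' hr

lemma IsSolutionOn.waveOp_eq {p : TwoForm n N} {lam vy : ℝ} {O : Set (ℝ × ℝ)} {φ : ℝ × ℝ → N}
    (h : IsSolutionOn p lam vy O φ) (he : e ∈ IsManifold.maximalAtlas (𝓡 n) ∞ N) {q : ℝ × ℝ}
    (hq : q ∈ O) (hqe : φ q ∈ e.source) : waveOp (e ∘ φ) q = waveMapSource p (lam * vy) e
      ((e ∘ φ) q, dT (e ∘ φ) q + dX (e ∘ φ) q, dT (e ∘ φ) q - dX (e ∘ φ) q) :=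
  (chartEqAt_iff p lam vy e (contDiffAt_chart_comp he hqe (h.smooth q hq))).1 (h.eqn q hq e he hqe)

/-- By `ChartEqAt.change`, the equation in the single chart `e` implies it in all others. -/
lemma isSolutionOn_symm_comp {p : TwoForm n N} {lam vy : ℝ} {O : Set (ℝ × ℝ)} (hO : IsOpen O)
    (he : e ∈ IsManifold.maximalAtlas (𝓡 n) ∞ N) {ψ : ℝ × ℝ → EuclideanSpace ℝ (Fin n)}
    (hψ : ∀ q ∈ O, ContDiffAt ℝ ∞ ψ q) (hm : ∀ q ∈ O, ψ q ∈ e.target)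
    (heq : ∀ q ∈ O, waveOp ψ q
      = waveMapSource p (lam * vy) e (ψ q, dT ψ q + dX ψ q, dT ψ q - dX ψ q)) :
    IsSolutionOn p lam vy O (e.symm ∘ ψ) := by
  have hs : ∀ q ∈ O, ContMDiffAt 𝓘(ℝ, ℝ × ℝ) (𝓡 n) ∞ (e.symm ∘ ψ) q := fun q hq =>
    (contMDiffAt_symm_of_mem_maximalAtlas he (hm q hq)).comp q (hψ q hq).contMDiffAt
  refine ⟨hs, fun q hq e' he' hqe' => ?_⟩
  have hqe : (e.symm ∘ ψ) q ∈ e.source := e.map_target (hm q hq)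
  refine ChartEqAt.change ?_ he he' hqe hqe' (hs q hq)
  rw [chartEqAt_iff_loweredEqAt p lam vy he hqe (hs q hq)]
  have hev : ψ =ᶠ[𝓝 q] e ∘ (e.symm ∘ ψ) := by
    filter_upwards [hO.mem_nhds hq] with r hr
    exact (e.right_inv (hm r hr)).symm
  exact ((waveOp_eq_iff_loweredEqAt p _ he (hm q hq)).1 (heq q hq)).congr hev

lemma differentiableAt_energyDensity {φ : ℝ × ℝ → N} {q : ℝ × ℝ}
    (hφ : ∀ᶠ r in 𝓝 q, ContMDiffAt 𝓘(ℝ, ℝ × ℝ) (𝓡 n) ∞ φ r) (v : ℝ × ℝ) :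
    DifferentiableAt ℝ (energyDensity n φ v) q := by
  have he := IsManifold.chart_mem_maximalAtlas (I := 𝓡 n) (n := ∞) (φ q)
  set e := chartAt (EuclideanSpace ℝ (Fin n)) (φ q)
  have hq : φ q ∈ e.source := mem_chart_source _ _
  have hc := hφ.self_of_nhds
  have hψ := contDiffAt_chart_comp he hq hc
  have hev : energyDensity n φ v =ᶠ[𝓝 q] fun r => formOf (metricCoeff e ((e ∘ φ) r))
      (fderiv ℝ (e ∘ φ) r v) (fderiv ℝ (e ∘ φ) r v) := by
    filter_upwards [hφ, hc.continuousAt.preimage_mem_nhds (e.open_source.mem_nhds hq)] with r h1 h2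
    exact energyDensity_eq he h2 h1 v
  refine DifferentiableAt.congr_of_eventuallyEq ?_ hev
  have hG := ((contDiffAt_formOf_metricCoeff he (e.map_source hq)).differentiableAt
    (by simp)).comp q (hψ.differentiableAt (by simp))
  have hd : DifferentiableAt ℝ (fun r => fderiv ℝ (e ∘ φ) r v) q :=
    ((hψ.fderiv_right (m := ∞) (by simp)).differentiableAt (by simp)).clm_apply
      (differentiableAt_const _)
  exact (hG.clm_apply hd).clm_apply hd

/-- Near `q` the densities are the coordinate expressions of `LoweredEqAt.energy_add` and
`LoweredEqAt.energy_sub` in a chart at `φ q`. -/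
lemma IsSolutionOn.fderiv_energyDensity {p : TwoForm n N} {lam vy : ℝ} {O : Set (ℝ × ℝ)}
    (hO : IsOpen O) {φ : ℝ × ℝ → N} (h : IsSolutionOn p lam vy O φ) {q : ℝ × ℝ} (hqO : q ∈ O) :
    fderiv ℝ (energyDensity n φ (1, 1)) q (-1, 1) = 0 ∧
      fderiv ℝ (energyDensity n φ (-1, 1)) q (1, 1) = 0 := by
  have he := IsManifold.chart_mem_maximalAtlas (I := 𝓡 n) (n := ∞) (φ q)
  set e := chartAt (EuclideanSpace ℝ (Fin n)) (φ q)
  have hq : φ q ∈ e.source := mem_chart_source _ _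
  have hc := h.smooth q hqO
  have hψ := contDiffAt_chart_comp he hq hc
  have hev : ∀ v, energyDensity n φ v =ᶠ[𝓝 q] fun r => formOf (metricCoeff e ((e ∘ φ) r))
      (fderiv ℝ (e ∘ φ) r v) (fderiv ℝ (e ∘ φ) r v) := fun v => by
    filter_upwards [hO.mem_nhds hqO, hc.continuousAt.preimage_mem_nhds
      (e.open_source.mem_nhds hq)] with r h1 h2
    exact energyDensity_eq he h2 (h.smooth r h1) v
  have hlow := (chartEqAt_iff_loweredEqAt p lam vy he hq hc).1 (h.eqn q hqO e he hq)
  have hG := (contDiffAt_formOf_metricCoeff he (e.map_source hq)).differentiableAt (by simp)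
  have hP := (p.contDiffAt_formOf_coeff he (e.map_source hq)).differentiableAt (by simp)
  have hGs : ∀ᶠ y in 𝓝 ((e ∘ φ) q), ∀ v w,
      formOf (metricCoeff e y) v w = formOf (metricCoeff e y) w v :=
    Eventually.of_forall fun y => formOf_metricCoeff_symm e y
  have hPs : ∀ᶠ y in 𝓝 ((e ∘ φ) q), ∀ v w, formOf (p.coeff e y) v w = -formOf (p.coeff e y) w v :=
    Eventually.of_forall fun y => p.formOf_coeff_skew e y
  constructor
  · rw [(hev _).fderiv_eq, ← hlow.energy_add hψ hG hP hGs hPs]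
    simp only [fderiv_eq_dX_dT, one_smul, add_comm]
  · rw [(hev _).fderiv_eq, ← hlow.energy_sub hψ hG hP hGs hPs]
    simp only [fderiv_eq_dX_dT, one_smul, neg_smul, neg_add_eq_sub]

end SolutionsOnOpenSets

/-! ### Triangles of dependence. -/

section Cones

open Set Filter Topology

/-- The parameters of the points of a triangle of dependence. -/
def coneParam : Set (ℝ × ℝ) := {k | |k.1| + k.2 ≤ 1 ∧ 0 ≤ k.2}

/-- The point with parameter `k` in the triangle with apex `r` and base on the line `t = c`. -/
def conePt (c : ℝ) (r k : ℝ × ℝ) : ℝ × ℝ := (r.1 + k.1 * (r.2 - c), c + k.2 * (r.2 - c))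

/-- The triangle of dependence of `r` with base on the line `t = c`. -/
def cone (c : ℝ) (r : ℝ × ℝ) : Set (ℝ × ℝ) := conePt c r '' coneParam

lemma isCompact_coneParam : IsCompact coneParam := by
  refine Metric.isCompact_of_isClosed_isBounded ?_ ?_
  · exact (isClosed_le ((continuous_abs.comp continuous_fst).add continuous_snd) continuous_const).inter
      (isClosed_le continuous_const continuous_snd)
  · refine (Metric.isBounded_iff_subset_closedBall 0).2 ⟨1, fun k hk => ?_⟩
    have h1 := hk.1
    have h2 := hk.2
    have h3 := abs_nonneg k.1
    rw [mem_closedBall_zero_iff, Prod.norm_def, Real.norm_eq_abs, Real.norm_eq_abs,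
      abs_of_nonneg h2]
    exact max_le (by linarith) (by linarith)

lemma continuous_conePt (c : ℝ) : Continuous fun p : (ℝ × ℝ) × (ℝ × ℝ) => conePt c p.1 p.2 := by
  unfold conePt
  fun_prop

lemma isCompact_cone (c : ℝ) (r : ℝ × ℝ) : IsCompact (cone c r) :=
  isCompact_coneParam.image ((continuous_conePt c).comp (by fun_prop : Continuous fun k => (r, k)))

lemma conePt_apex (c : ℝ) (r : ℝ × ℝ) : conePt c r (0, 1) = r := by
  simp [conePt]

lemma self_mem_cone (c : ℝ) (r : ℝ × ℝ) : r ∈ cone c r :=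
  ⟨(0, 1), by simp [coneParam], conePt_apex c r⟩

lemma cone_subset_of_mem {c : ℝ} {r r' : ℝ × ℝ} (h : r' ∈ cone c r) : cone c r' ⊆ cone c r := by
  obtain ⟨k, ⟨hk1, hk2⟩, rfl⟩ := h
  rintro _ ⟨l, ⟨hl1, hl2⟩, rfl⟩
  refine ⟨(k.1 + l.1 * k.2, l.2 * k.2), ⟨?_, mul_nonneg hl2 hk2⟩, ?_⟩
  · have h1 := abs_add_le k.1 (l.1 * k.2)
    rw [abs_mul, abs_of_nonneg hk2] at h1
    simp only
    nlinarith
  · simp only [conePt, Prod.mk.injEq]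
    constructor <;> ring

/-- The parameters are scaled by the signed height `r.2 - c`, so one definition serves the triangles
on both sides of the base line; on that line the scale is zero. -/
lemma cone_of_eq {c : ℝ} {r : ℝ × ℝ} (h : r.2 = c) : cone c r = {r} := by
  refine Subset.antisymm ?_ (singleton_subset_iff.2 (self_mem_cone c r))
  rintro _ ⟨k, -, rfl⟩
  simp [conePt, ← h]

lemma abs_lt_of_mem_cone {c : ℝ} {r r' : ℝ × ℝ} (h : r' ∈ cone c r) (hne : r' ≠ r) :
    |r'.2 - c| < |r.2 - c| := by
  have hc : r.2 - c ≠ 0 := fun h0 => by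
    rw [cone_of_eq (sub_eq_zero.1 h0)] at h
    exact hne h
  obtain ⟨k, ⟨hk1, hk2⟩, rfl⟩ := h
  have h1 : k.2 < 1 := by
    refine lt_of_le_of_ne (by linarith [abs_nonneg k.1]) fun h1 => hne ?_
    have h0 : k.1 = 0 := abs_nonpos_iff.1 (by linarith)
    have h3 : k = (0, 1) := Prod.ext h0 h1
    rw [h3, conePt_apex]
  have h2 := abs_pos.2 hc
  simp only [conePt, add_sub_cancel_left, abs_mul, abs_of_nonneg hk2]
  nlinarith

/-- Induction along the triangles of dependence. -/
lemma cone_subset_of_forall {c : ℝ} {q : ℝ × ℝ} {E : Set (ℝ × ℝ)} (hE : IsOpen E)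
    (h : ∀ r ∈ cone c q, cone c r \ {r} ⊆ E → r ∈ E) : cone c q ⊆ E := by
  by_contra hne
  obtain ⟨r₀, hr₀, hr₀E⟩ := not_subset.1 hne
  -- A point outside `E` that is nearest to the base line. Every other point of its own triangle is
  -- nearer still, hence in `E`, so the hypothesis applies to it.
  obtain ⟨r, ⟨hr, hrE⟩, hmin⟩ := ((isCompact_cone c q).diff hE).exists_isMinOn ⟨r₀, hr₀, hr₀E⟩
    (f := fun r => |r.2 - c|) (by fun_prop)
  refine hrE (h r hr fun r' hr' => ?_)
  by_contra hr'E
  have h1 := abs_lt_of_mem_cone hr'.1 hr'.2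
  have h2 := hmin (a := r') ⟨cone_subset_of_mem hr hr'.1, hr'E⟩
  exact absurd h1 (not_lt.2 h2)

/-- The tube lemma for the compact set of parameters. -/
lemma eventually_cone_subset {c : ℝ} {r : ℝ × ℝ} {O : Set (ℝ × ℝ)} (hO : IsOpen O)
    (h : cone c r ⊆ O) : ∀ᶠ r' in 𝓝 r, cone c r' ⊆ O := by
  have h1 : ∀ k ∈ coneParam, ∀ᶠ p : (ℝ × ℝ) × (ℝ × ℝ) in 𝓝 r ×ˢ 𝓝 k, conePt c p.1 p.2 ∈ O := by
    intro k hk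
    rw [← nhds_prod_eq]
    exact (continuous_conePt c).continuousAt.preimage_mem_nhds
      (hO.mem_nhds (h ⟨k, hk, rfl⟩))
  have h2 := isCompact_coneParam.eventually_forall_of_forall_eventually (x₀ := r)
    (P := fun r' k => conePt c r' k ∈ O) (fun k hk => by rw [nhds_prod_eq]; exact h1 k hk)
  filter_upwards [h2] with r' hr'
  rintro _ ⟨k, hk, rfl⟩
  exact hr' k hk

lemma cone_subset_cone {c μ : ℝ} {r : ℝ × ℝ} (h0 : 0 ≤ μ) (h1 : μ ≤ 1) :
    cone (c + μ * (r.2 - c)) r ⊆ cone c r := by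
  rintro _ ⟨k, ⟨hk1, hk2⟩, rfl⟩
  refine ⟨(k.1 * (1 - μ), μ + k.2 * (1 - μ)), ⟨?_, ?_⟩, ?_⟩
  · simp only [abs_mul, abs_of_nonneg (sub_nonneg.2 h1)]
    nlinarith
  · have := mul_nonneg hk2 (sub_nonneg.2 h1)
    simp only
    linarith
  · simp only [conePt, Prod.mk.injEq]
    constructor <;> ring

lemma cone_subset_openDiamond {x m R : ℝ} {r : ℝ × ℝ} (h : r ∈ openDiamond (x, m) R) :
    cone m r ⊆ openDiamond (x, m) R := by
  rintro _ ⟨k, ⟨hk1, hk2⟩, rfl⟩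
  have h' : |r.1 - x| + |r.2 - m| < R := h
  have h1 := abs_add_le (r.1 - x) (k.1 * (r.2 - m))
  have h2 := abs_nonneg (r.2 - m)
  rw [abs_mul] at h1
  change |r.1 + k.1 * (r.2 - m) - x| + |m + k.2 * (r.2 - m) - m| < R
  rw [add_sub_cancel_left, abs_mul, abs_of_nonneg hk2, add_sub_right_comm]
  nlinarith

/-- The apex is an extreme point of the triangle. Convexity of the rest turns a bound on the
derivative into a Lipschitz bound before anything is known at the apex. -/
lemma convex_cone_diff (c : ℝ) (r : ℝ × ℝ) : Convex ℝ (cone c r \ {r}) := by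
  rintro _ ⟨⟨k, ⟨hk1, hk2⟩, rfl⟩, hk⟩ _ ⟨⟨l, ⟨hl1, hl2⟩, rfl⟩, hl⟩ a b ha hb hab
  have hmem : a • conePt c r k + b • conePt c r l = conePt c r (a • k + b • l) := by
    obtain rfl : b = 1 - a := by linarith
    simp only [conePt, Prod.smul_mk, Prod.mk_add_mk, Prod.fst_add, Prod.snd_add, Prod.smul_fst,
      Prod.smul_snd, smul_eq_mul, Prod.mk.injEq]
    constructor <;> ring
  have hc : r.2 - c ≠ 0 := fun h0 => by
    refine hk ?_
    simp [conePt, sub_eq_zero.1 h0 |>.symm]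
  have hlt : ∀ k : ℝ × ℝ, |k.1| + k.2 ≤ 1 → conePt c r k ∉ ({r} : Set (ℝ × ℝ)) → k.2 < 1 := by
    intro k h1 hk
    refine lt_of_le_of_ne (by linarith [abs_nonneg k.1]) fun h2 => hk ?_
    have h0 : k.1 = 0 := abs_nonpos_iff.1 (by linarith)
    have : k = (0, 1) := Prod.ext h0 h2
    rw [this, conePt_apex]
    rfl
  have hk3 := hlt k hk1 hk
  have hl3 := hlt l hl1 hl
  rw [hmem]
  refine ⟨⟨a • k + b • l, ⟨?_, ?_⟩, rfl⟩, fun h => ?_⟩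
  · have h1 := abs_add_le (a * k.1) (b * l.1)
    rw [abs_mul, abs_mul, abs_of_nonneg ha, abs_of_nonneg hb] at h1
    simp only [Prod.fst_add, Prod.snd_add, Prod.smul_fst, Prod.smul_snd, smul_eq_mul]
    nlinarith
  · simp only [Prod.snd_add, Prod.smul_snd, smul_eq_mul]
    positivity
  · have h1 : c + (a * k.2 + b * l.2) * (r.2 - c) = r.2 := congrArg Prod.snd h
    have h2 : (a * k.2 + b * l.2 - 1) * (r.2 - c) = 0 := by linarith
    have h3 := (mul_eq_zero.1 h2).resolve_right hc
    rcases ha.eq_or_lt with rfl | ha'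
    · simp_all
    · nlinarith

lemma conePt_mem_cone_diff {c : ℝ} {r : ℝ × ℝ} (hr : r.2 ≠ c) {u v : ℝ} (h1 : |u| + v ≤ 1)
    (h0 : 0 ≤ v) (hv : v < 1) : conePt c r (u, v) ∈ cone c r \ {r} := by
  refine ⟨⟨(u, v), ⟨h1, h0⟩, rfl⟩, fun h => ?_⟩
  have h2 : c + v * (r.2 - c) = r.2 := congrArg Prod.snd h
  have h3 : (v - 1) * (r.2 - c) = 0 := by linarith
  rcases mul_eq_zero.1 h3 with h4 | h4
  · linarith
  · exact hr (sub_eq_zero.1 h4)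

lemma self_mem_closure_cone_diff {c : ℝ} {r : ℝ × ℝ} (hr : r.2 ≠ c) :
    r ∈ closure (cone c r \ {r}) := by
  have h1 : Tendsto (fun v : ℝ => conePt c r (0, v)) (𝓝[<] 1) (𝓝 r) := by
    have : Continuous fun v : ℝ => conePt c r (0, v) := by
      unfold conePt
      fun_prop
    have h2 := this.tendsto 1
    rw [conePt_apex] at h2
    exact h2.mono_left nhdsWithin_le_nhds
  refine mem_closure_of_tendsto h1 ?_
  filter_upwards [Ioo_mem_nhdsLT (zero_lt_one' ℝ)] with v hv
  exact conePt_mem_cone_diff hr (by simpa using hv.2.le) hv.1.le hv.2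

/-- Below the apex of a triangle there are small diamonds around it whose waist line lies in a
given neighbourhood of the rest of the triangle. -/
lemma exists_openDiamond {c : ℝ} {r : ℝ × ℝ} (hr : r.2 ≠ c) {E : Set (ℝ × ℝ)} (hE : IsOpen E)
    (h : cone c r \ {r} ⊆ E) {ρ : ℝ} (hρ : 0 < ρ) :
    ∃ μ R R' : ℝ, 0 < μ ∧ μ < 1 ∧ 0 < R ∧ R < R' ∧ R ≤ ρ ∧
      r ∈ openDiamond (r.1, c + μ * (r.2 - c)) R ∧
      openDiamond (r.1, c + μ * (r.2 - c)) R ⊆ Metric.ball r ρ ∧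
      ∀ x ∈ Metric.ball r.1 R', (x, c + μ * (r.2 - c)) ∈ E ∩ Metric.ball r ρ := by
  have hτ : 0 < |r.2 - c| := abs_pos.2 (sub_ne_zero.2 hr)
  -- The waist line lies at distance `δ = θ |r.2 - c|` from the apex and cuts the triangle in the
  -- closed interval of radius `δ` around `r.1`. That interval is compact in the open set `E`, so it
  -- may be widened by some `ε'`. The radius `δ + ε' / 2` exceeds `δ`, which puts `r` inside the
  -- diamond; the quarters of `ρ` keep everything in the ball.
  obtain ⟨θ, hθ0, hθ⟩ : ∃ θ, 0 < θ ∧ θ < min 1 (ρ / (4 * |r.2 - c|)) :=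
    exists_between (lt_min one_pos (by positivity))
  have hθ1 := hθ.trans_le (min_le_left _ _)
  have hθ2 : θ * |r.2 - c| < ρ / 4 := by
    have := hθ.trans_le (min_le_right _ _)
    rw [lt_div_iff₀ (by positivity)] at this
    linarith
  set m := c + (1 - θ) * (r.2 - c) with hm
  have hmr : |r.2 - m| = θ * |r.2 - c| := by
    have : r.2 - m = θ * (r.2 - c) := by rw [hm]; ring
    rw [this, abs_mul, abs_of_pos hθ0]
  set δ := θ * |r.2 - c| with hδ
  have hδ0 : 0 < δ := by positivity
  have hopen : IsOpen {x : ℝ | (x, m) ∈ E} := hE.preimage (by fun_prop)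
  have hsub : Metric.closedBall r.1 δ ⊆ {x : ℝ | (x, m) ∈ E} := by
    intro x hx
    rw [Metric.mem_closedBall, Real.dist_eq] at hx
    have hne : r.2 - c ≠ 0 := sub_ne_zero.2 hr
    have h1 : |(x - r.1) / (r.2 - c)| ≤ θ := by
      rw [abs_div, div_le_iff₀ hτ]
      exact hx
    have h2 := h (conePt_mem_cone_diff hr (u := (x - r.1) / (r.2 - c)) (v := 1 - θ)
      (by linarith) (by linarith) (by linarith))
    have h3 : conePt c r ((x - r.1) / (r.2 - c), 1 - θ) = (x, m) := by
      simp only [conePt, hm, div_mul_cancel₀ _ hne]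
      simp
    rwa [h3] at h2
  obtain ⟨ε, hε, hεs⟩ := (isCompact_closedBall r.1 δ).exists_thickening_subset_open hopen hsub
  rw [thickening_closedBall hε hδ0.le] at hεs
  set ε' := min ε (ρ / 4) with hε'
  have hε'0 : 0 < ε' := by positivity
  have hε'1 := min_le_left ε (ρ / 4)
  have hε'2 := min_le_right ε (ρ / 4)
  refine ⟨1 - θ, δ + ε' / 2, δ + ε', by linarith, by linarith, by positivity, by linarith,
    by linarith, ?_, ?_, fun x hx => ?_⟩
  · change |r.1 - r.1| + |r.2 - m| < _
    rw [sub_self, abs_zero, hmr]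
    linarith
  · intro q hq
    have hq' : |q.1 - r.1| + |q.2 - m| < δ + ε' / 2 := hq
    have h1 := abs_nonneg (q.1 - r.1)
    have h2 := abs_nonneg (q.2 - m)
    rw [Metric.mem_ball, Prod.dist_eq, Real.dist_eq, Real.dist_eq, max_lt_iff]
    refine ⟨by linarith, ?_⟩
    have h3 := abs_sub_le q.2 m r.2
    rw [abs_sub_comm m, hmr] at h3
    linarith
  · refine ⟨hεs (Metric.ball_subset_ball (by linarith) hx), ?_⟩
    rw [Metric.mem_ball] at hx
    rw [Metric.mem_ball, Prod.dist_eq, max_lt_iff]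
    refine ⟨by simp only; linarith, ?_⟩
    rw [dist_comm, Real.dist_eq, hmr]
    linarith

lemma openDiamond_subset_ball (c : ℝ × ℝ) (R : ℝ) : openDiamond c R ⊆ Metric.ball c R := by
  intro q hq
  have hq' : |q.1 - c.1| + |q.2 - c.2| < R := hq
  have h1 := abs_nonneg (q.1 - c.1)
  have h2 := abs_nonneg (q.2 - c.2)
  rw [Metric.mem_ball, Prod.dist_eq, Real.dist_eq, Real.dist_eq, max_lt_iff]
  constructor <;> linarith

lemma openDiamond_subset_ball_line {x₀ t x R : ℝ} (h : (x, t) ∈ openDiamond (x₀, t) R) :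
    x ∈ Metric.ball x₀ R := by
  simpa [openDiamond, Real.dist_eq] using h

lemma self_mem_openDiamond {c : ℝ × ℝ} {R : ℝ} (hR : 0 < R) : c ∈ openDiamond c R := by
  simpa [openDiamond] using hR

end Cones

/-! ### Uniqueness on triangles, and local existence in a chart. -/

section UniquenessOnCones

open Set Filter Topology

variable {n : ℕ} {N : Type*} [TopologicalSpace N] [ChartedSpace (EuclideanSpace ℝ (Fin n)) N]
  [IsManifold (𝓡 n) ∞ N] {e : OpenPartialHomeomorph N (EuclideanSpace ℝ (Fin n))}

lemma dT_chart_comp (he : e ∈ IsManifold.maximalAtlas (𝓡 n) ∞ N) {φ : ℝ × ℝ → N} {q : ℝ × ℝ}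
    (hq : φ q ∈ e.source) (hφ : ContMDiffAt 𝓘(ℝ, ℝ × ℝ) (𝓡 n) ∞ φ q) :
    dT (e ∘ φ) q = mfderiv (𝓡 n) (𝓡 n) e (timeVelocity (n := n) φ q.1 q.2).proj
      (timeVelocity (n := n) φ q.1 q.2).2 := by
  have h1 := dT_eq_deriv ((contDiffAt_chart_comp he hq hφ).differentiableAt (by simp))
  have h2 : MDifferentiableAt (𝓡 n) (𝓡 n) e (φ (q.1, q.2)) :=
    (contMDiffAt_of_mem_maximalAtlas he hq).mdifferentiableAt (by simp)
  have h3 : ContMDiffAt 𝓘(ℝ, ℝ) 𝓘(ℝ, ℝ × ℝ) ∞ (fun s : ℝ => ((q.1, s) : ℝ × ℝ)) q.2 :=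
    (contDiffAt_const.prodMk contDiffAt_id).contMDiffAt
  have h4 : MDifferentiableAt 𝓘(ℝ, ℝ) (𝓡 n) (fun s : ℝ => φ (q.1, s)) q.2 :=
    (ContMDiffAt.comp q.2 (g := φ) hφ h3).mdifferentiableAt (by simp)
  have h5 := mfderiv_comp q.2 h2 h4
  rw [mfderiv_eq_fderiv] at h5
  have h6 := congrArg (fun L : ℝ →L[ℝ] EuclideanSpace ℝ (Fin n) => L 1) h5
  exact h1.deriv.symm.trans h6

lemma timeVelocity_congr {φ φ' : ℝ × ℝ → N} {x t : ℝ} (h : φ =ᶠ[𝓝 (x, t)] φ') :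
    timeVelocity (n := n) φ x t = timeVelocity φ' x t := by
  have h1 : (fun s => φ (x, s)) =ᶠ[𝓝 t] fun s => φ' (x, s) :=
    (Continuous.tendsto (by fun_prop : Continuous fun s : ℝ => (x, s)) t).eventually h
  have h2 := h1.mfderiv_eq (I := 𝓘(ℝ, ℝ)) (I' := 𝓡 n)
  exact TotalSpace.ext h.eq_of_nhds (heq_of_eq
    (congrArg (fun L : ℝ →L[ℝ] EuclideanSpace ℝ (Fin n) => L 1) h2))

lemma mk_mfderiv_symm_congr (e : OpenPartialHomeomorph N (EuclideanSpace ℝ (Fin n)))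
    {z z' w w' : EuclideanSpace ℝ (Fin n)} (hz : z = z') (hw : w = w') :
    (⟨e.symm z, mfderiv (𝓡 n) (𝓡 n) e.symm z w⟩ : TangentBundle (𝓡 n) N)
      = ⟨e.symm z', mfderiv (𝓡 n) (𝓡 n) e.symm z' w'⟩ := by
  subst hz hw
  rfl

lemma timeVelocity_symm_comp (he : e ∈ IsManifold.maximalAtlas (𝓡 n) ∞ N)
    {ψ : ℝ × ℝ → EuclideanSpace ℝ (Fin n)} {x t : ℝ} (hψ : DifferentiableAt ℝ ψ (x, t))
    (ht : ψ (x, t) ∈ e.target) : timeVelocity (n := n) (e.symm ∘ ψ) x t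
      = ⟨e.symm (ψ (x, t)), mfderiv (𝓡 n) (𝓡 n) e.symm (ψ (x, t)) (dT ψ (x, t))⟩ := by
  have h3 : MDifferentiableAt (𝓡 n) (𝓡 n) e.symm (ψ (x, t)) :=
    (contMDiffAt_symm_of_mem_maximalAtlas he ht).mdifferentiableAt (by simp)
  have h4 := dT_eq_deriv hψ
  have h5 := mfderiv_comp (I := 𝓘(ℝ, ℝ)) t h3 h4.differentiableAt.mdifferentiableAt
  rw [mfderiv_eq_fderiv] at h5
  refine TotalSpace.ext rfl (heq_of_eq ?_)
  have h6 := congrArg (fun L : ℝ →L[ℝ] EuclideanSpace ℝ (Fin n) => L 1) h5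
  refine h6.trans ?_
  have h7 : fderiv ℝ (fun t => ψ (x, t)) t 1 = dT ψ (x, t) := h4.deriv
  exact congrArg (mfderiv (𝓡 n) (𝓡 n) e.symm (ψ (x, t))) h7

lemma timeVelocity_eq_symm_comp (he : e ∈ IsManifold.maximalAtlas (𝓡 n) ∞ N) {φ : ℝ × ℝ → N}
    {x t : ℝ} (hq : φ (x, t) ∈ e.source)
    (hφ : ContMDiffAt 𝓘(ℝ, ℝ × ℝ) (𝓡 n) ∞ φ (x, t)) :
    timeVelocity (n := n) φ x t = ⟨e.symm ((e ∘ φ) (x, t)),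
      mfderiv (𝓡 n) (𝓡 n) e.symm ((e ∘ φ) (x, t)) (dT (e ∘ φ) (x, t))⟩ :=
  (timeVelocity_congr (symm_comp_eventuallyEq hφ.continuousAt hq).symm).trans
    (timeVelocity_symm_comp he ((contDiffAt_chart_comp he hq hφ).differentiableAt (by simp))
      (e.map_source hq))

lemma eventually_chart_bounds (he : e ∈ IsManifold.maximalAtlas (𝓡 n) ∞ N) {φ : ℝ × ℝ → N}
    {q : ℝ × ℝ} (hq : φ q ∈ e.source) (hφ : ContMDiffAt 𝓘(ℝ, ℝ × ℝ) (𝓡 n) ∞ φ q) {ρ C : ℝ}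
    (hρ : 0 < ρ) (ha : ‖dT (e ∘ φ) q + dX (e ∘ φ) q‖ < C)
    (hb : ‖dT (e ∘ φ) q - dX (e ∘ φ) q‖ < C) :
    ∀ᶠ r in 𝓝 q, φ r ∈ e.source ∧ (e ∘ φ) r ∈ Metric.closedBall (e (φ q)) ρ ∧
      ‖dT (e ∘ φ) r + dX (e ∘ φ) r‖ ≤ C ∧ ‖dT (e ∘ φ) r - dX (e ∘ φ) r‖ ≤ C := by
  have hψ := contDiffAt_chart_comp he hq hφ
  filter_upwards [hφ.continuousAt.preimage_mem_nhds (e.open_source.mem_nhds hq),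
    hψ.continuousAt.preimage_mem_nhds (Metric.closedBall_mem_nhds _ hρ),
    (hψ.dT.add hψ.dX).continuousAt.norm.eventually_lt continuousAt_const ha,
    (hψ.dT.sub hψ.dX).continuousAt.norm.eventually_lt continuousAt_const hb] with r h1 h2 h3 h4
  exact ⟨h1, h2, h3.le, h4.le⟩

variable [RiemannianBundle (fun x : N => TangentSpace (𝓡 n) x)]
  [IsContMDiffRiemannianBundle (𝓡 n) ∞ (EuclideanSpace ℝ (Fin n))
      (fun x : N => TangentSpace (𝓡 n) x)]

/-- Near a common value both solutions stay in one chart and in the range where the localised source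
is the true one, so `eq_on_openDiamond` applies. The radius serves all diamonds in the ball,
including those whose waist does not pass through `q`; this is what allows uniqueness to be carried
past an apex. -/
lemma IsSolutionOn.exists_eq_on_openDiamond {p : TwoForm n N} {lam vy : ℝ} {O : Set (ℝ × ℝ)}
    (hO : IsOpen O) {φ φ' : ℝ × ℝ → N} (h : IsSolutionOn p lam vy O φ)
    (h' : IsSolutionOn p lam vy O φ') {q : ℝ × ℝ} (hq : q ∈ O) (hqq : φ q = φ' q) :
    ∃ ρ > 0, ∀ c r, openDiamond c r ⊆ Metric.ball q ρ →
      (∀ x, |x - c.1| < r → timeVelocity (n := n) φ x c.2 = timeVelocity φ' x c.2) →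
      ∀ q' ∈ openDiamond c r, φ q' = φ' q' := by
  have he := IsManifold.chart_mem_maximalAtlas (I := 𝓡 n) (n := ∞) (φ q)
  have hqe : φ q ∈ (chartAt (EuclideanSpace ℝ (Fin n)) (φ q)).source := mem_chart_source _ _
  generalize chartAt (EuclideanSpace ℝ (Fin n)) (φ q) = e at he hqe
  obtain ⟨ρ₀, hρ₀, -, hloc⟩ := exists_lipschitz_localisation e.open_target
    (contDiffOn_waveMapSource p (lam * vy) he) (e.map_source hqe)
  obtain ⟨C, hC⟩ := exists_gt (max (max ‖dT (e ∘ φ) q + dX (e ∘ φ) q‖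
    ‖dT (e ∘ φ) q - dX (e ∘ φ) q‖) (max ‖dT (e ∘ φ') q + dX (e ∘ φ') q‖
    ‖dT (e ∘ φ') q - dX (e ∘ φ') q‖))
  simp only [max_lt_iff] at hC
  obtain ⟨⟨hC1, hC2⟩, hC3, hC4⟩ := hC
  obtain ⟨H, -, ⟨K, hK0, hK⟩, -, hH⟩ := hloc C ((norm_nonneg _).trans_lt hC1)
  have hqe' : φ' q ∈ e.source := hqq ▸ hqe
  have hev := (eventually_chart_bounds he hqe (h.smooth q hq) hρ₀ hC1 hC2).and
    ((eventually_chart_bounds he hqe' (h'.smooth q hq) hρ₀ hC3 hC4).and (hO.mem_nhds hq))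
  rw [← hqq] at hev
  obtain ⟨ρ, hρ, hball⟩ := Metric.eventually_nhds_iff_ball.1 hev
  refine ⟨ρ, hρ, fun c r hsub hdata q' hq' => ?_⟩
  have hd : ∀ p ∈ openDiamond c r, _ := fun p hp => hball p (hsub hp)
  have key := eq_on_openDiamond (c := c) (r := r) (ψ := e ∘ φ) (ψ' := e ∘ φ') hK0 hK
    (fun p hp => contDiffAt_chart_comp he (hd p hp).1.1 (h.smooth p (hd p hp).2.2))
    (fun p hp => contDiffAt_chart_comp he (hd p hp).2.1.1 (h'.smooth p (hd p hp).2.2))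
    (fun p hp => by
      obtain ⟨⟨h1, h2, h3, h4⟩, -, h5⟩ := hd p hp
      rw [hH _ h2 _ _ h3 h4]
      exact h.waveOp_eq he h5 h1)
    (fun p hp => by
      obtain ⟨-, ⟨h1, h2, h3, h4⟩, h5⟩ := hd p hp
      rw [hH _ h2 _ _ h3 h4]
      exact h'.waveOp_eq he h5 h1)
    (fun x hx => congrArg e (congrArg TotalSpace.proj (hdata x hx)))
    (fun x hx => by
      have hp : ((x, c.2) : ℝ × ℝ) ∈ openDiamond c r := by simpa [openDiamond] using hx
      rw [dT_chart_comp he (hd _ hp).1.1 (h.smooth _ (hd _ hp).2.2),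
        dT_chart_comp he (hd _ hp).2.1.1 (h'.smooth _ (hd _ hp).2.2), hdata x hx])
  exact e.injOn (hd q' hq').1.1 (hd q' hq').2.1.1 (key q' hq')

/-- Two solutions with the same Cauchy data on the line `t = c` agree around each triangle of
dependence. -/
lemma IsSolutionOn.cone_subset_interior [T2Space N] {p : TwoForm n N} {lam vy c : ℝ}
    {O : Set (ℝ × ℝ)} (hO : IsOpen O) {φ φ' : ℝ × ℝ → N} (h : IsSolutionOn p lam vy O φ)
    (h' : IsSolutionOn p lam vy O φ')
    (hdata : ∀ x, (x, c) ∈ O → timeVelocity (n := n) φ x c = timeVelocity φ' x c) {q : ℝ × ℝ}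
    (hq : cone c q ⊆ O) : cone c q ⊆ interior {r | φ r = φ' r} := by
  refine cone_subset_of_forall isOpen_interior fun r hr hsub => ?_
  have hrO : r ∈ O := hq hr
  by_cases hrc : r.2 = c
  · obtain ⟨x, t⟩ := r
    obtain rfl : t = c := hrc
    obtain ⟨ρ, hρ, hloc⟩ := h.exists_eq_on_openDiamond hO h' hrO
      (congrArg TotalSpace.proj (hdata x hrO))
    obtain ⟨ρ', hρ', hballO⟩ := Metric.isOpen_iff.1 hO _ hrO
    have hmin : 0 < min ρ ρ' := lt_min hρ hρ'
    have := hloc (x, t) (min ρ ρ') ((openDiamond_subset_ball _ _).trans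
      (Metric.ball_subset_ball (min_le_left _ _))) (fun y hy => hdata y (hballO (by
        refine Metric.ball_subset_ball (min_le_right ρ ρ') (openDiamond_subset_ball _ _ ?_)
        simpa [openDiamond] using hy)))
    exact mem_interior.2 ⟨_, this, isOpen_openDiamond _ _, self_mem_openDiamond hmin⟩
  -- Off the base line, agreement on the triangle without its apex passes to the apex by continuity
  -- and the Hausdorff property. A small diamond containing `r`, with its waist where the solutions
  -- already agree on an open set, then gives agreement around `r`.
  · have hrr : φ r = φ' r := by
      have hcl := closure_mono (hsub.trans interior_subset) (self_mem_closure_cone_diff hrc)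
      have hne : (𝓝[{r | φ r = φ' r}] r).NeBot := mem_closure_iff_nhdsWithin_neBot.1 hcl
      have t1 : Tendsto φ (𝓝[{r | φ r = φ' r}] r) (𝓝 (φ r)) :=
        (h.smooth r hrO).continuousAt.tendsto.mono_left nhdsWithin_le_nhds
      have t2 : Tendsto φ' (𝓝[{r | φ r = φ' r}] r) (𝓝 (φ' r)) :=
        (h'.smooth r hrO).continuousAt.tendsto.mono_left nhdsWithin_le_nhds
      refine tendsto_nhds_unique (t1.congr' ?_) t2
      filter_upwards [self_mem_nhdsWithin] with s hs using hs
    obtain ⟨ρ, hρ, hloc⟩ := h.exists_eq_on_openDiamond hO h' hrO hrr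
    obtain ⟨μ, R, R', -, -, -, hRR', -, hmem, hball, hline⟩ :=
      exists_openDiamond hrc isOpen_interior hsub hρ
    refine mem_interior.2 ⟨_, hloc _ R hball fun x hx => ?_, isOpen_openDiamond _ _, hmem⟩
    refine timeVelocity_congr ?_
    have := (hline x (by rw [Metric.mem_ball, Real.dist_eq]; exact hx.trans hRR')).1
    exact mem_of_superset (isOpen_interior.mem_nhds this) interior_subset

/-- Local existence for data in a chart, on diamonds of a size that depends only on bounds for the
data. -/
lemma exists_isSolutionOn_openDiamond (p : TwoForm n N) (lam vy : ℝ)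
    (he : e ∈ IsManifold.maximalAtlas (𝓡 n) ∞ N) {y : N} (hy : y ∈ e.source) {C : ℝ}
    (hC : 0 < C) : ∃ ρ > 0, Metric.closedBall (e y) ρ ⊆ e.target ∧ ∃ δ > 0,
      ∀ (c : ℝ × ℝ) (r r' : ℝ), 0 < r → r < r' → r ≤ δ →
      ∀ ψ₀ ψ₁ : ℝ → EuclideanSpace ℝ (Fin n), ContDiffOn ℝ ∞ ψ₀ (Metric.ball c.1 r') →
      ContDiffOn ℝ ∞ ψ₁ (Metric.ball c.1 r') →
      (∀ x ∈ Metric.ball c.1 r, ‖ψ₀ x - e y‖ ≤ ρ / 2 ∧ ‖ψ₁ x + deriv ψ₀ x‖ ≤ C ∧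
        ‖ψ₁ x - deriv ψ₀ x‖ ≤ C) →
      ∃ φ : ℝ × ℝ → N, IsSolutionOn p lam vy (openDiamond c r) φ ∧
        ∀ x ∈ Metric.ball c.1 r, timeVelocity (n := n) φ x c.2
          = ⟨e.symm (ψ₀ x), mfderiv (𝓡 n) (𝓡 n) e.symm (ψ₀ x) (ψ₁ x)⟩ := by
  obtain ⟨ρ, hρ, hsub, δ, hδ, hloc⟩ := exists_local_waveOp_eq e.open_target
    (contDiffOn_waveMapSource p (lam * vy) he) (e.map_source hy) hC
  refine ⟨ρ, hρ, hsub, δ, hδ, fun c r r' hr hrr' hrδ ψ₀ ψ₁ h₀ h₁ hb => ?_⟩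
  obtain ⟨ψ, hψ, hψe, hψd⟩ := hloc c r r' hr hrr' hrδ ψ₀ ψ₁ h₀ h₁ hb
  have ht : ∀ q ∈ openDiamond c r, ψ q ∈ e.target := fun q hq => hsub (hψe q hq).1
  refine ⟨e.symm ∘ ψ, isSolutionOn_symm_comp (isOpen_openDiamond c r) he
    (fun q _ => hψ.contDiffAt) ht fun q hq => (hψe q hq).2, fun x hx => ?_⟩
  have hq : ((x, c.2) : ℝ × ℝ) ∈ openDiamond c r := by
    simpa [openDiamond, Real.dist_eq] using hx
  obtain ⟨h1, h2⟩ := hψd x hx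
  exact (timeVelocity_symm_comp he (hψ.differentiable (by simp) (x, c.2)) (ht _ hq)).trans
    (mk_mfderiv_symm_congr e h1 h2)

end UniquenessOnCones

/-! ### Bounds from the conserved null energies. -/

section ConservationLaws

open Set Filter Topology

section topological

variable {n : ℕ} {N : Type*} [TopologicalSpace N] [ChartedSpace (EuclideanSpace ℝ (Fin n)) N]
  [IsManifold (𝓡 n) ∞ N] [RiemannianBundle (fun x : N => TangentSpace (𝓡 n) x)]
  [IsContMDiffRiemannianBundle (𝓡 n) ∞ (EuclideanSpace ℝ (Fin n))
      (fun x : N => TangentSpace (𝓡 n) x)]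

lemma conePt_side_mem {l v : ℝ} (hl : |l| = 1) (hv : v ∈ Icc (0 : ℝ) 1) :
    (l * (1 - v), v) ∈ coneParam := by
  refine ⟨?_, hv.1⟩
  simp only [abs_mul, hl, abs_of_nonneg (sub_nonneg.2 hv.2)]
  linarith

/-- The null energy densities are constant along the sides of the triangles of dependence. -/
lemma IsSolutionOn.energyDensity_eq_foot {p : TwoForm n N} {lam vy c : ℝ} {O : Set (ℝ × ℝ)}
    (hO : IsOpen O) {φ : ℝ × ℝ → N} (h : IsSolutionOn p lam vy O φ) {r : ℝ × ℝ}
    (hr : cone c r ⊆ O) :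
    energyDensity n φ (1, 1) r = energyDensity n φ (1, 1) (conePt c r (1, 0)) ∧
      energyDensity n φ (-1, 1) r = energyDensity n φ (-1, 1) (conePt c r (-1, 0)) := by
  have key : ∀ l : ℝ, |l| = 1 → ∀ F : ℝ × ℝ → ℝ, (∀ q ∈ O, DifferentiableAt ℝ F q) →
      (∀ q ∈ O, fderiv ℝ F q (-l, 1) = 0) → F r = F (conePt c r (l, 0)) := by
    intro l hl F hF hF0
    -- One side of the triangle, from its foot at `v = 0` to the apex at `v = 1`, with velocity a
    -- multiple of `(-l, 1)`.
    have hline : ∀ v : ℝ, HasDerivAt (fun v => conePt c r (l * (1 - v), v))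
        ((r.2 - c) • (-l, 1)) v := by
      intro v
      refine HasDerivAt.prodMk ?_ ?_
      · have := (((((hasDerivAt_id v).const_sub 1).const_mul l).mul_const (r.2 - c)).const_add r.1)
        convert! this using 1
        simp
        ring
      · have := ((hasDerivAt_id v).mul_const (r.2 - c)).const_add c
        convert! this using 1
        simp
    have hd : ∀ v ∈ Icc (0 : ℝ) 1, HasDerivWithinAt
        (fun v => F (conePt c r (l * (1 - v), v))) 0 (Icc 0 1) v := by
      intro v hv
      have hq : conePt c r (l * (1 - v), v) ∈ O := hr ⟨_, conePt_side_mem hl hv, rfl⟩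
      have h1 := (hF _ hq).hasFDerivAt.comp_hasDerivAt v (hline v)
      rw [map_smul, hF0 _ hq, smul_zero] at h1
      exact h1.hasDerivWithinAt
    have h2 := (convex_Icc (0 : ℝ) 1).norm_image_sub_le_of_norm_hasDerivWithin_le (C := 0) hd
      (fun v _ => by simp) (left_mem_Icc.2 zero_le_one) (right_mem_Icc.2 zero_le_one)
    rw [zero_mul] at h2
    have h3 := sub_eq_zero.1 (norm_le_zero_iff.1 h2)
    simpa [conePt_apex] using h3
  have hev : ∀ q ∈ O, ∀ᶠ s in 𝓝 q, ContMDiffAt 𝓘(ℝ, ℝ × ℝ) (𝓡 n) ∞ φ s := fun q hq =>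
    mem_of_superset (hO.mem_nhds hq) h.smooth
  refine ⟨key 1 (by simp) _ (fun q hq => differentiableAt_energyDensity (hev q hq) _)
    fun q hq => (h.fderiv_energyDensity hO hq).1,
    key (-1) (by simp) _ (fun q hq => differentiableAt_energyDensity (hev q hq) _)
    fun q hq => ?_⟩
  rw [neg_neg]
  exact (h.fderiv_energyDensity hO hq).2

lemma cone_subset_cone_diff {c : ℝ} {r s : ℝ × ℝ} (hs : s ∈ cone c r \ {r}) :
    cone c s ⊆ cone c r \ {r} := by
  intro s' hs'
  refine ⟨cone_subset_of_mem hs.1 hs', fun h => ?_⟩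
  rw [mem_singleton_iff.1 h] at hs'
  have h1 := abs_lt_of_mem_cone hs.1 hs.2
  by_cases h2 : r = s
  · exact hs.2 h2.symm
  · exact lt_asymm h1 (abs_lt_of_mem_cone hs' h2)

/-- Below the apex of a triangle of dependence, the derivative of a solution is bounded. -/
lemma IsSolutionOn.exists_norm_mfderiv_le {p : TwoForm n N} {lam vy c : ℝ} {O : Set (ℝ × ℝ)}
    (hO : IsOpen O) {φ : ℝ × ℝ → N} (h : IsSolutionOn p lam vy O φ) {r : ℝ × ℝ} (hrc : r.2 ≠ c)
    (hr : cone c r \ {r} ⊆ O) :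
    ∃ M : ℝ, 0 ≤ M ∧ ∀ s ∈ cone c r \ {r},
      ‖mfderiv 𝓘(ℝ, ℝ × ℝ) (𝓡 n) φ s ((1, 1) : ℝ × ℝ)‖ ≤ M ∧
      ‖mfderiv 𝓘(ℝ, ℝ × ℝ) (𝓡 n) φ s ((-1, 1) : ℝ × ℝ)‖ ≤ M := by
  -- Near the apex there is no compactness, but the base is a compact part of `O`, as `r` is not on
  -- it. The densities at any other point of the triangle equal their values at two feet on this
  -- base.
  have hK : IsCompact (cone c r ∩ {q | q.2 = c}) :=
    (isCompact_cone c r).inter_right (isClosed_eq continuous_snd continuous_const)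
  have hKO : cone c r ∩ {q | q.2 = c} ⊆ O := fun q hq => hr ⟨hq.1, fun hqr => hrc (by
    rw [← mem_singleton_iff.1 hqr]; exact hq.2)⟩
  have hcont : ∀ v, ContinuousOn (energyDensity n φ v) (cone c r ∩ {q | q.2 = c}) :=
    fun v q hq => (differentiableAt_energyDensity
      (mem_of_superset (hO.mem_nhds (hKO hq)) h.smooth) v).continuousAt.continuousWithinAt
  obtain ⟨M₁, hM₁⟩ := hK.bddAbove_image (hcont (1, 1))
  obtain ⟨M₂, hM₂⟩ := hK.bddAbove_image (hcont (-1, 1))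
  have hnorm : ∀ (v q : ℝ × ℝ) (M : ℝ), energyDensity n φ v q ≤ M →
      ‖mfderiv 𝓘(ℝ, ℝ × ℝ) (𝓡 n) φ q v‖ ≤ √M := by
    intro v q M hM
    refine Real.le_sqrt_of_sq_le ?_
    rw [← real_inner_self_eq_norm_sq]
    exact hM
  refine ⟨√(max M₁ M₂), Real.sqrt_nonneg _, fun s hs => ?_⟩
  have hsO : cone c s ⊆ O := (cone_subset_cone_diff hs).trans hr
  have hfoot : ∀ l : ℝ, |l| = 1 → conePt c s (l, 0) ∈ cone c r ∩ {q | q.2 = c} := by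
    intro l hl
    refine ⟨cone_subset_of_mem hs.1 ⟨(l, 0), ⟨?_, le_rfl⟩, rfl⟩, ?_⟩
    · simp [hl]
    · simp [conePt]
  obtain ⟨h1, h2⟩ := h.energyDensity_eq_foot hO hsO
  constructor
  · refine hnorm _ _ _ (h1.le.trans ?_)
    exact (hM₁ ⟨_, hfoot 1 (by simp), rfl⟩).trans (le_max_left _ _)
  · refine hnorm _ _ _ (h2.le.trans ?_)
    exact (hM₂ ⟨_, hfoot (-1) (by simp), rfl⟩).trans (le_max_right _ _)

lemma norm_le_of_null {W : Type*} [SeminormedAddCommGroup W] [NormedSpace ℝ W]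
    (L : (ℝ × ℝ) →ₗ[ℝ] W) {M : ℝ} (h1 : ‖L (1, 1)‖ ≤ M) (h2 : ‖L (-1, 1)‖ ≤ M) (w : ℝ × ℝ) :
    ‖L w‖ ≤ 2 * M * ‖w‖ := by
  have hw : w = ((w.1 + w.2) / 2) • ((1, 1) : ℝ × ℝ) + ((w.2 - w.1) / 2) • ((-1, 1) : ℝ × ℝ) := by
    ext <;> simp <;> ring
  have n1 : |w.1| ≤ ‖w‖ := norm_fst_le w
  have n2 : |w.2| ≤ ‖w‖ := norm_snd_le w
  have m1 : |(w.1 + w.2) / 2| ≤ ‖w‖ := by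
    rw [abs_le] at n1 n2 ⊢
    constructor <;> linarith
  have m2 : |(w.2 - w.1) / 2| ≤ ‖w‖ := by
    rw [abs_le] at n1 n2 ⊢
    constructor <;> linarith
  have hlin : L w = ((w.1 + w.2) / 2) • L (1, 1) + ((w.2 - w.1) / 2) • L (-1, 1) := by
    rw [← map_smul, ← map_smul, ← map_add, ← hw]
  rw [hlin]
  refine (norm_add_le _ _).trans ?_
  rw [norm_smul, norm_smul, Real.norm_eq_abs, Real.norm_eq_abs]
  have := mul_le_mul m1 h1 (norm_nonneg _) (norm_nonneg _)
  have := mul_le_mul m2 h2 (norm_nonneg _) (norm_nonneg _)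
  linarith

lemma norm_mfderiv_le_of_null {φ : ℝ × ℝ → N} {q : ℝ × ℝ} {M : ℝ}
    (h1 : ‖mfderiv 𝓘(ℝ, ℝ × ℝ) (𝓡 n) φ q ((1, 1) : ℝ × ℝ)‖ ≤ M)
    (h2 : ‖mfderiv 𝓘(ℝ, ℝ × ℝ) (𝓡 n) φ q ((-1, 1) : ℝ × ℝ)‖ ≤ M) (w : ℝ × ℝ) :
    ‖mfderiv 𝓘(ℝ, ℝ × ℝ) (𝓡 n) φ q w‖ ≤ 2 * M * ‖w‖ :=
  norm_le_of_null (mfderiv 𝓘(ℝ, ℝ × ℝ) (𝓡 n) φ q).toLinearMap h1 h2 w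

-- The energy bound is in the Riemannian norm at a moving point. This compares it, near `y`, with
-- the Euclidean norm of the components in the fixed chart at `y`, the norm used by the local
-- existence result.
attribute [local instance] normedAddCommGroupTangentSpaceVectorSpace
  normedSpaceTangentSpaceVectorSpace in
lemma exists_norm_mfderiv_chart_le (y : N) :
    ∃ C > 0, ∀ᶠ y' in 𝓝 y, ∀ (v : TangentSpace (𝓡 n) y')
      (w : EuclideanSpace ℝ (Fin n)),
      w = mfderiv (𝓡 n) (𝓡 n) (chartAt (EuclideanSpace ℝ (Fin n)) y) y' v → ‖w‖ ≤ C * ‖v‖ := by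
  have : IsManifold (𝓡 n) 1 N := IsManifold.of_le (n := ∞) (by simp)
  have : IsContinuousRiemannianBundle (EuclideanSpace ℝ (Fin n))
      (fun x : N => TangentSpace (𝓡 n) x) := by
    obtain ⟨g, hg, h⟩ := IsContMDiffRiemannianBundle.exists_contMDiff (IB := 𝓡 n) (n := ∞)
      (F := EuclideanSpace ℝ (Fin n)) (E := fun x : N => TangentSpace (𝓡 n) x)
    exact ⟨g, hg.continuous, h⟩
  obtain ⟨C, hC, h⟩ := eventually_norm_mfderiv_extChartAt_lt (𝓡 n) y
  refine ⟨C, hC, h.mono fun y' hy' v w hw => ?_⟩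
  subst hw
  exact ContinuousLinearMap.le_of_opNorm_le _ hy'.le v

end topological

variable {n : ℕ} {N : Type*} [EMetricSpace N] [ChartedSpace (EuclideanSpace ℝ (Fin n)) N]
  [IsManifold (𝓡 n) ∞ N] [RiemannianBundle (fun x : N => TangentSpace (𝓡 n) x)]
  [IsContMDiffRiemannianBundle (𝓡 n) ∞ (EuclideanSpace ℝ (Fin n))
      (fun x : N => TangentSpace (𝓡 n) x)]
  [IsRiemannianManifold (𝓡 n) N]

-- The distance of `N` is the infimum of the lengths of curves, and the image of a segment in `s`
-- has length at most `K` times that of the segment.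
open scoped NNReal in
lemma lipschitzOnWith_of_norm_mfderiv_le {φ : ℝ × ℝ → N} {s : Set (ℝ × ℝ)} (hs : Convex ℝ s)
    (hφ : ∀ q ∈ s, ContMDiffAt 𝓘(ℝ, ℝ × ℝ) (𝓡 n) ∞ φ q) {K : ℝ≥0}
    (hK : ∀ q ∈ s, ∀ w : ℝ × ℝ, ‖mfderiv 𝓘(ℝ, ℝ × ℝ) (𝓡 n) φ q w‖ ≤ K * ‖w‖) :
    LipschitzOnWith K φ s := by
  intro q hq q' hq'
  rw [IsRiemannianManifold.out (I := 𝓡 n) (φ q) (φ q')]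
  set γ : ℝ → ℝ × ℝ := fun t => AffineMap.lineMap q q' t with hγ
  have hγs : ∀ t ∈ Icc (0 : ℝ) 1, γ t ∈ s := fun t ht => hs.lineMap_mem hq hq' ht
  have hγd : ∀ t, HasDerivAt γ (q' - q) t := fun t => AffineMap.hasDerivAt_lineMap
  have hγc : ContMDiff 𝓘(ℝ, ℝ) 𝓘(ℝ, ℝ × ℝ) ∞ γ := by
    refine contMDiff_iff_contDiff.2 ?_
    simp only [hγ, AffineMap.lineMap_apply_module']
    fun_prop
  have hc : ∀ t ∈ Icc (0 : ℝ) 1, ContMDiffAt 𝓘(ℝ, ℝ) (𝓡 n) ∞ (φ ∘ γ) t := fun t ht =>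
    (hφ _ (hγs t ht)).comp t hγc.contMDiffAt
  refine (riemannianEDist_le_pathELength (I := 𝓡 n) (γ := φ ∘ γ) (a := 0) (b := 1)
    (fun t ht => ((hc t ht).of_le (by simp)).contMDiffWithinAt) (by simp [hγ]) (by simp [hγ])
    zero_le_one).trans ?_
  rw [pathELength_eq_lintegral_mfderiv_Icc]
  have hb : ∀ t ∈ Icc (0 : ℝ) 1,
      ‖mfderiv 𝓘(ℝ, ℝ) (𝓡 n) (φ ∘ γ) t (1 : ℝ)‖ₑ ≤ K * edist q q' := by
    intro t ht
    have h1 : mfderiv 𝓘(ℝ, ℝ) (𝓡 n) (φ ∘ γ) t (1 : ℝ)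
        = mfderiv 𝓘(ℝ, ℝ × ℝ) (𝓡 n) φ (γ t) (q' - q) := by
      have h2 := mfderiv_comp (I := 𝓘(ℝ, ℝ)) t
        ((hφ _ (hγs t ht)).mdifferentiableAt (by simp)) (hγd t).differentiableAt.mdifferentiableAt
      rw [mfderiv_eq_fderiv] at h2
      have h3 := congrArg (fun L : ℝ →L[ℝ] EuclideanSpace ℝ (Fin n) => L 1) h2
      have h4 : fderiv ℝ γ t 1 = q' - q := (hγd t).deriv
      refine h3.trans ?_
      change mfderiv 𝓘(ℝ, ℝ × ℝ) (𝓡 n) φ (γ t) (fderiv ℝ γ t 1) = _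
      rw [h4]
    rw [h1, edist_comm, edist_eq_enorm_sub, ← ofReal_norm, ← ofReal_norm,
      ← ENNReal.ofReal_coe_nnreal]
    refine (ENNReal.ofReal_le_ofReal (hK _ (hγs t ht) _)).trans ?_
    rw [ENNReal.ofReal_mul K.coe_nonneg]
  refine (MeasureTheory.setLIntegral_mono measurable_const hb).trans ?_
  simp

/-- A uniformly continuous map sends the Cauchy filter at `r` to a Cauchy filter. Through this lemma
the completeness of `N` enters. -/
lemma exists_tendsto_of_lipschitzOnWith {X : Type*} [EMetricSpace X] [CompleteSpace X]
    {φ : ℝ × ℝ → X} {s : Set (ℝ × ℝ)} {r : ℝ × ℝ} {K : NNReal} (h : LipschitzOnWith K φ s)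
    (hr : r ∈ closure s) : ∃ y, Tendsto φ (𝓝[s] r) (𝓝 y) := by
  have hne : (𝓝[s] r).NeBot := mem_closure_iff_nhdsWithin_neBot.1 hr
  have h1 : Cauchy (𝓝[s] r) := cauchy_nhds.mono nhdsWithin_le_nhds
  have h2 : Cauchy (map φ (𝓝[s] r)) := by
    refine ⟨hne.map φ, ?_⟩
    rw [prod_map_map_eq]
    have h3 := h.uniformContinuousOn
    refine Tendsto.mono_left h3 ?_
    refine le_inf h1.2 ?_
    rw [le_principal_iff]
    exact prod_mem_prod self_mem_nhdsWithin self_mem_nhdsWithin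
  exact CompleteSpace.complete h2

end ConservationLaws

/-! ### Continuation past the apex and global existence. -/

section Continuation

open Set Filter Topology

section topological

variable {n : ℕ} {N : Type*} [TopologicalSpace N] [ChartedSpace (EuclideanSpace ℝ (Fin n)) N]
  [IsManifold (𝓡 n) ∞ N] {e : OpenPartialHomeomorph N (EuclideanSpace ℝ (Fin n))}

lemma mk_mfderiv_symm_mfderiv (he : e ∈ IsManifold.maximalAtlas (𝓡 n) ∞ N)
    {P : TangentBundle (𝓡 n) N} (hP : P.proj ∈ e.source) :
    (⟨e.symm (e P.proj), mfderiv (𝓡 n) (𝓡 n) e.symm (e P.proj)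
      (mfderiv (𝓡 n) (𝓡 n) e P.proj P.2)⟩ : TangentBundle (𝓡 n) N) = P := by
  have h1 : MDifferentiableAt (𝓡 n) (𝓡 n) e P.proj :=
    (contMDiffAt_of_mem_maximalAtlas he hP).mdifferentiableAt (by simp)
  have h2 : MDifferentiableAt (𝓡 n) (𝓡 n) e.symm (e P.proj) :=
    (contMDiffAt_symm_of_mem_maximalAtlas he (e.map_source hP)).mdifferentiableAt (by simp)
  have h3 := mfderiv_comp P.proj h2 h1
  have h4 : (e.symm ∘ e) =ᶠ[𝓝 P.proj] id := by
    filter_upwards [e.open_source.mem_nhds hP] with y hy using e.left_inv hy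
  have h5 := h4.mfderiv_eq (I := 𝓡 n) (I' := 𝓡 n)
  have h6 := mfderiv_id (I := 𝓡 n) (x := P.proj)
  refine TotalSpace.ext (e.left_inv hP) (heq_of_eq ?_)
  exact congrArg (fun L : EuclideanSpace ℝ (Fin n) →L[ℝ] EuclideanSpace ℝ (Fin n) => L P.2)
    ((h3.symm.trans h5).trans h6)

lemma contDiffAt_snd_tangentMap (he : e ∈ IsManifold.maximalAtlas (𝓡 n) ∞ N)
    {θ₀ : ℝ → TangentBundle (𝓡 n) N} (hθ : ContMDiff 𝓘(ℝ, ℝ) (𝓡 n).tangent ∞ θ₀) {x : ℝ}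
    (hx : (θ₀ x).proj ∈ e.source) :
    ContDiffAt ℝ ∞ (fun x => (mfderiv (𝓡 n) (𝓡 n) e (θ₀ x).proj (θ₀ x).2 :
      EuclideanSpace ℝ (Fin n))) x := by
  have h1 := (contMDiffOn_of_mem_maximalAtlas he).contMDiffOn_tangentMapWithin (m := ∞)
    (by simp) e.open_source.uniqueMDiffOn
  have hopen : IsOpen (TotalSpace.proj ⁻¹' e.source : Set (TangentBundle (𝓡 n) N)) :=
    e.open_source.preimage (FiberBundle.continuous_proj _ _)
  have h2 : ContMDiffAt (𝓡 n).tangent (𝓡 n).tangent ∞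
      (tangentMapWithin (𝓡 n) (𝓡 n) e e.source) (θ₀ x) := h1.contMDiffAt (hopen.mem_nhds hx)
  have h3 := (contMDiff_snd_tangentBundle_modelSpace (n := ∞) (EuclideanSpace ℝ (Fin n))
    (𝓡 n)).contMDiffAt.comp x (h2.comp x hθ.contMDiffAt)
  refine (contMDiffAt_iff_contDiffAt.1 h3).congr_of_eventuallyEq ?_
  have h4 : ∀ᶠ y in 𝓝 x, (θ₀ y).proj ∈ e.source :=
    hθ.continuous.continuousAt.preimage_mem_nhds (hopen.mem_nhds hx)
  filter_upwards [h4] with y hy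
  simp only [Function.comp, tangentMapWithin]
  rw [mfderivWithin_of_isOpen e.open_source hy]

variable [RiemannianBundle (fun x : N => TangentSpace (𝓡 n) x)]
  [IsContMDiffRiemannianBundle (𝓡 n) ∞ (EuclideanSpace ℝ (Fin n))
      (fun x : N => TangentSpace (𝓡 n) x)]

/-- Local existence for smooth initial data. -/
lemma IsSmoothData.exists_isSolutionOn (p : TwoForm n N) (lam vy : ℝ) {φ₀ : ℝ → N}
    {θ₀ : ℝ → TangentBundle (𝓡 n) N} (h : IsSmoothData φ₀ θ₀) (x₀ t₀ : ℝ) :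
    ∃ R > 0, ∃ φ : ℝ × ℝ → N, IsSolutionOn p lam vy (openDiamond (x₀, t₀) R) φ ∧
      ∀ x ∈ Metric.ball x₀ R, timeVelocity (n := n) φ x t₀ = θ₀ x := by
  have he := IsManifold.chart_mem_maximalAtlas (I := 𝓡 n) (n := ∞) (φ₀ x₀)
  have hye : φ₀ x₀ ∈ (chartAt (EuclideanSpace ℝ (Fin n)) (φ₀ x₀)).source := mem_chart_source _ _
  generalize chartAt (EuclideanSpace ℝ (Fin n)) (φ₀ x₀) = e at he hye
  set ψ₁ : ℝ → EuclideanSpace ℝ (Fin n) :=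
    fun x => mfderiv (𝓡 n) (𝓡 n) e (θ₀ x).proj (θ₀ x).2 with hψ₁
  have c0 : ∀ x, φ₀ x ∈ e.source → ContDiffAt ℝ ∞ (e ∘ φ₀) x := fun x hx =>
    ((contMDiffAt_of_mem_maximalAtlas he hx).comp x h.smooth_pos.contMDiffAt).contDiffAt
  have c1 : ∀ x, φ₀ x ∈ e.source → ContDiffAt ℝ ∞ ψ₁ x := fun x hx =>
    contDiffAt_snd_tangentMap he h.smooth_vel (by rw [h.proj_eq]; exact hx)
  have c2 : ContinuousAt (deriv (e ∘ φ₀)) x₀ := by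
    have h1 := ((c0 x₀ hye).fderiv_right (m := ∞) (by simp)).continuousAt
    exact h1.clm_apply continuousAt_const
  obtain ⟨C, hC⟩ := exists_gt (max ‖ψ₁ x₀ + deriv (e ∘ φ₀) x₀‖ ‖ψ₁ x₀ - deriv (e ∘ φ₀) x₀‖)
  rw [max_lt_iff] at hC
  obtain ⟨ρ, hρ, -, δ, hδ, hloc⟩ := exists_isSolutionOn_openDiamond p lam vy he hye
    ((norm_nonneg _).trans_lt hC.1)
  have hev : ∀ᶠ x in 𝓝 x₀, φ₀ x ∈ e.source ∧ ‖(e ∘ φ₀) x - e (φ₀ x₀)‖ ≤ ρ / 2 ∧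
      ‖ψ₁ x + deriv (e ∘ φ₀) x‖ ≤ C ∧ ‖ψ₁ x - deriv (e ∘ φ₀) x‖ ≤ C := by
    filter_upwards [h.smooth_pos.continuous.continuousAt.preimage_mem_nhds
        (e.open_source.mem_nhds hye),
      (c0 x₀ hye).continuousAt.preimage_mem_nhds (Metric.closedBall_mem_nhds _ (half_pos hρ)),
      ((c1 x₀ hye).continuousAt.add c2).norm.eventually_lt continuousAt_const hC.1,
      ((c1 x₀ hye).continuousAt.sub c2).norm.eventually_lt continuousAt_const hC.2]
      with x h1 h2 h3 h4
    exact ⟨h1, mem_closedBall_iff_norm.1 h2, h3.le, h4.le⟩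
  obtain ⟨ρ₁, hρ₁, hball⟩ := Metric.eventually_nhds_iff_ball.1 hev
  set R := min ρ₁ δ / 2 with hR
  have hR0 : 0 < R := by positivity
  have hRρ : 2 * R ≤ ρ₁ := by rw [hR]; linarith [min_le_left ρ₁ δ]
  have hRδ : 2 * R ≤ δ := by rw [hR]; linarith [min_le_right ρ₁ δ]
  obtain ⟨φ, hφ, hd⟩ := hloc (x₀, t₀) R (2 * R) hR0 (by linarith) (by linarith) (e ∘ φ₀) ψ₁
    (fun x hx => (c0 x (hball x (Metric.ball_subset_ball hRρ hx)).1).contDiffWithinAt)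
    (fun x hx => (c1 x (hball x (Metric.ball_subset_ball hRρ hx)).1).contDiffWithinAt)
    (fun x hx => (hball x (Metric.ball_subset_ball (by linarith) hx)).2)
  refine ⟨R, hR0, φ, hφ, fun x hx => (hd x hx).trans ?_⟩
  have hxe := (hball x (Metric.ball_subset_ball (by linarith) hx)).1
  have hP : (θ₀ x).proj ∈ e.source := by rw [h.proj_eq]; exact hxe
  exact (mk_mfderiv_symm_congr e (congrArg e (h.proj_eq x).symm) rfl).trans
    (mk_mfderiv_symm_mfderiv he hP)

end topological

variable {n : ℕ} {N : Type*} [EMetricSpace N] [ChartedSpace (EuclideanSpace ℝ (Fin n)) N]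
  [IsManifold (𝓡 n) ∞ N] [RiemannianBundle (fun x : N => TangentSpace (𝓡 n) x)]
  [IsContMDiffRiemannianBundle (𝓡 n) ∞ (EuclideanSpace ℝ (Fin n))
      (fun x : N => TangentSpace (𝓡 n) x)]
  [IsRiemannianManifold (𝓡 n) N] [CompleteSpace N]

/-- A solution below the apex of a triangle of dependence can be continued past the apex, starting
from a line close to it. -/
lemma IsSolutionOn.exists_openDiamond_solution {p : TwoForm n N} {lam vy c : ℝ}
    {G : Set (ℝ × ℝ)} (hG : IsOpen G) {φ : ℝ × ℝ → N} (h : IsSolutionOn p lam vy G φ) {r : ℝ × ℝ}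
    (hrc : r.2 ≠ c) (hr : cone c r \ {r} ⊆ G) :
    ∃ μ R : ℝ, ∃ χ : ℝ × ℝ → N, 0 < μ ∧ μ < 1 ∧
      r ∈ openDiamond (r.1, c + μ * (r.2 - c)) R ∧
      IsSolutionOn p lam vy (openDiamond (r.1, c + μ * (r.2 - c)) R) χ ∧
      ∀ x ∈ Metric.ball r.1 R, timeVelocity (n := n) χ x (c + μ * (r.2 - c))
        = timeVelocity φ x (c + μ * (r.2 - c)) := by
  obtain ⟨M, hM0, hM⟩ := h.exists_norm_mfderiv_le hG hrc hr
  have hlip := lipschitzOnWith_of_norm_mfderiv_le (K := ⟨2 * M, by positivity⟩)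
    (convex_cone_diff c r) (fun q hq => h.smooth q (hr hq))
    (fun q hq w => norm_mfderiv_le_of_null (hM q hq).1 (hM q hq).2 w)
  -- The limit of the solution at the apex; all that follows takes place in a chart around it.
  obtain ⟨y, hy⟩ := exists_tendsto_of_lipschitzOnWith hlip (self_mem_closure_cone_diff hrc)
  have he := IsManifold.chart_mem_maximalAtlas (I := 𝓡 n) (n := ∞) y
  have hye : y ∈ (chartAt (EuclideanSpace ℝ (Fin n)) y).source := mem_chart_source _ _
  obtain ⟨C₀, hC₀, hchart⟩ := exists_norm_mfderiv_chart_le (n := n) y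
  generalize chartAt (EuclideanSpace ℝ (Fin n)) y = e at he hye hchart
  -- On the triangle near the apex the null derivatives are at most `C₀ * M` in coordinates. The `+
  -- 1` leaves room for the bound to hold in a neighbourhood of each such point. The time of
  -- existence `δ` is fixed before the starting line is chosen, which is why the line can be taken
  -- close enough.
  obtain ⟨ρ, hρ, -, δ, hδ, hloc⟩ := exists_isSolutionOn_openDiamond p lam vy he hye
    (C := C₀ * M + 1) (by positivity)
  set Q : ℝ × ℝ → Prop := fun s => s ∈ G ∧ φ s ∈ e.source ∧
    ‖(e ∘ φ) s - e y‖ ≤ ρ / 2 ∧ ‖dT (e ∘ φ) s + dX (e ∘ φ) s‖ ≤ C₀ * M + 1 ∧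
    ‖dT (e ∘ φ) s - dX (e ∘ φ) s‖ ≤ C₀ * M + 1 with hQ
  have hbound : ∀ s ∈ cone c r \ {r}, φ s ∈ e.source →
      (∀ (v : TangentSpace (𝓡 n) (φ s)) (w : EuclideanSpace ℝ (Fin n)),
        w = mfderiv (𝓡 n) (𝓡 n) e (φ s) v → ‖w‖ ≤ C₀ * ‖v‖) →
      ‖dT (e ∘ φ) s + dX (e ∘ φ) s‖ ≤ C₀ * M ∧ ‖dT (e ∘ φ) s - dX (e ∘ φ) s‖ ≤ C₀ * M := by
    intro s hs hse hv
    have h2 := mfderiv_comp s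
      ((contMDiffAt_of_mem_maximalAtlas he hse).mdifferentiableAt (by simp))
      ((h.smooth s (hr hs)).mdifferentiableAt (by simp))
    rw [mfderiv_eq_fderiv] at h2
    have h3 : ∀ w : ℝ × ℝ, ‖mfderiv 𝓘(ℝ, ℝ × ℝ) (𝓡 n) φ s w‖ ≤ M →
        ‖fderiv ℝ (e ∘ φ) s w‖ ≤ C₀ * M := by
      intro w hw
      have h4 := congrArg (fun L : ℝ × ℝ →L[ℝ] EuclideanSpace ℝ (Fin n) => L w) h2
      exact (hv _ _ h4).trans (mul_le_mul_of_nonneg_left hw hC₀.le)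
    have h4 := h3 _ (hM s hs).1
    have h5 := h3 _ (hM s hs).2
    rw [fderiv_eq_dX_dT, one_smul, one_smul, add_comm] at h4
    rw [fderiv_eq_dX_dT, neg_smul, one_smul, one_smul, neg_add_eq_sub] at h5
    exact ⟨h4, h5⟩
  have hsource : ∀ᶠ s in 𝓝[cone c r \ {r}] r, ∀ᶠ s' in 𝓝 s, Q s' := by
    filter_upwards [self_mem_nhdsWithin, hy.eventually hchart,
      hy.eventually (e.open_source.mem_nhds hye),
      hy.eventually ((e.continuousAt hye).eventually (Metric.ball_mem_nhds (e y) (half_pos hρ)))]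
      with s hs h1 h2 h3
    obtain ⟨h4, h5⟩ := hbound s hs h2 h1
    have hφs := h.smooth s (hr hs)
    have h6 := eventually_chart_bounds he h2 hφs one_pos (h4.trans_lt (lt_add_one _))
      (h5.trans_lt (lt_add_one _))
    filter_upwards [h6, hG.mem_nhds (hr hs), (contDiffAt_chart_comp he h2 hφs).continuousAt
      |>.preimage_mem_nhds (Metric.isOpen_ball.mem_nhds h3)] with s' h7 h8 h9
    exact ⟨h8, h7.1, (mem_ball_iff_norm.1 h9).le, h7.2.2.1, h7.2.2.2⟩
  obtain ⟨ρ₁, hρ₁, hball⟩ := Metric.mem_nhdsWithin_iff.1 hsource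
  -- The bounds `Q` are known only near `r`, whereas `exists_openDiamond` wants an open set around
  -- the whole triangle without its apex. Adding the complement of a closed ball is harmless,
  -- because the line obtained lies in the open ball of the same radius.
  obtain ⟨μ, R, R', hμ0, hμ1, hR0, hRR', hRδ, hmem, -, hline⟩ := exists_openDiamond hrc
    (E := {s | ∀ᶠ s' in 𝓝 s, Q s'} ∪ (Metric.closedBall r (ρ₁ / 2))ᶜ)
    (isOpen_setOfPred_eventually_nhds.union Metric.isClosed_closedBall.isOpen_compl)
    (fun s hs => by
      by_cases hsb : s ∈ Metric.closedBall r (ρ₁ / 2)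
      · exact Or.inl (hball ⟨Metric.closedBall_subset_ball (half_lt_self hρ₁) hsb, hs⟩)
      · exact Or.inr hsb) (lt_min (half_pos hρ₁) hδ)
  set m := c + μ * (r.2 - c) with hm
  have hQline : ∀ x ∈ Metric.ball r.1 R', Q (x, m) := by
    intro x hx
    obtain ⟨h1 | h1, h2⟩ := hline x hx
    · exact Eventually.self_of_nhds h1
    · exact absurd (Metric.ball_subset_closedBall
        (Metric.ball_subset_ball (min_le_left _ _) h2)) h1
  have hsm : ∀ x ∈ Metric.ball r.1 R', ContDiffAt ℝ ∞ (e ∘ φ) (x, m) := fun x hx =>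
    contDiffAt_chart_comp he (hQline x hx).2.1 (h.smooth _ (hQline x hx).1)
  have hslice : ∀ x : ℝ, ContDiffAt ℝ ∞ (fun x : ℝ => ((x, m) : ℝ × ℝ)) x := fun x =>
    contDiffAt_id.prodMk contDiffAt_const
  obtain ⟨χ, hχ, hχd⟩ := hloc (r.1, m) R R' hR0 hRR' (hRδ.trans (min_le_right _ _))
    (fun x => (e ∘ φ) (x, m)) (fun x => dT (e ∘ φ) (x, m))
    (fun x hx => ((hsm x hx).comp x (hslice x)).contDiffWithinAt)
    (fun x hx => (ContDiffAt.comp (g := dT (e ∘ φ)) x (hsm x hx).dT (hslice x)).contDiffWithinAt)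
    (fun x hx => by
      have hx' := Metric.ball_subset_ball hRR'.le hx
      have hq := hQline x hx'
      rw [(dX_eq_deriv ((hsm x hx').differentiableAt (by simp))).deriv]
      exact hq.2.2)
  refine ⟨μ, R, χ, hμ0, hμ1, hmem, hχ, fun x hx => (hχd x hx).trans ?_⟩
  have hq := hQline x (Metric.ball_subset_ball hRR'.le hx)
  exact (timeVelocity_eq_symm_comp he hq.2.1 (h.smooth _ hq.1)).symm

/-- A solution on a set which contains the triangles of dependence of its points can be extended
to the apex of a triangle of dependence. -/
lemma IsSolutionOn.exists_extension {p : TwoForm n N} {lam vy c : ℝ}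
    {G : Set (ℝ × ℝ)} (hG : IsOpen G) (hpast : ∀ q ∈ G, cone c q ⊆ G) {φ : ℝ × ℝ → N}
    (h : IsSolutionOn p lam vy G φ) {r : ℝ × ℝ} (hrc : r.2 ≠ c) (hr : cone c r \ {r} ⊆ G) :
    ∃ (O : Set (ℝ × ℝ)) (φ' : ℝ × ℝ → N), IsOpen O ∧ cone c r ⊆ O ∧ IsSolutionOn p lam vy O φ' ∧
      ∀ x, (x, c) ∈ O → (x, c) ∈ G ∧ timeVelocity (n := n) φ' x c = timeVelocity φ x c := by
  classical
  obtain ⟨μ, R, χ, hμ0, hμ1, hmem, hχ, hχd⟩ := h.exists_openDiamond_solution hG hrc hr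
  set m := c + μ * (r.2 - c) with hm
  -- Multiplication by the signed height `τ` treats both time directions at once. Only the part of
  -- the diamond on the apex side of the line `t = m` is added, so the base line `t = c` acquires no
  -- new points.
  set τ := r.2 - c with hτ
  have hτ0 : τ ≠ 0 := sub_ne_zero.2 hrc
  have hτ2 : 0 < τ * τ := mul_self_pos.2 hτ0
  set D := openDiamond (r.1, m) R
  set D' := {q ∈ D | 0 < (q.2 - m) * τ} with hD'
  have hDo : IsOpen D := isOpen_openDiamond _ _
  have hD'o : IsOpen D' := hDo.inter (isOpen_lt continuous_const
    ((continuous_snd.sub continuous_const).mul continuous_const))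
  -- On the overlap both solutions have the same data on `t = m`, and the triangle of `q` over that
  -- line lies in both domains: in `D` by the shape of a diamond, in `G` as a truncation of the
  -- triangle over `t = c`.
  have hagree : ∀ q ∈ D', q ∈ G → χ =ᶠ[𝓝 q] φ := by
    intro q hq hqG
    have hcone : cone m q ⊆ D ∩ G := by
      -- With `κ` the height of `q` over `t = m` in units of `τ`, that line cuts the triangle of `q`
      -- over `t = c` at the fraction `μ / (κ + μ)` of its height.
      refine subset_inter (cone_subset_openDiamond hq.1) (Subset.trans ?_ (hpast q hqG))
      set κ := (q.2 - m) / τ with hκ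
      have hκ0 : 0 < κ := by
        rw [hκ, ← mul_div_mul_right _ _ hτ0]
        exact div_pos hq.2 hτ2
      have hκe : q.2 - m = κ * τ := (div_mul_cancel₀ _ hτ0).symm
      have hqc : q.2 - c = (κ + μ) * τ := by linear_combination hκe + hm
      have hmq : m = c + μ / (κ + μ) * (q.2 - c) := by
        rw [hqc]
        field_simp
        exact hm
      rw [hmq]
      refine cone_subset_cone (by positivity) ?_
      rw [div_le_one (by positivity)]
      linarith
    have := (hχ.mono inter_subset_left).cone_subset_interior (hDo.inter hG)
      (h.mono inter_subset_right) (fun x hx => hχd x (openDiamond_subset_ball_line hx.1)) hcone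
      (self_mem_cone m q)
    exact mem_interior_iff_mem_nhds.1 this
  set φ' : ℝ × ℝ → N := fun q => if q ∈ G then φ q else χ q with hφ'
  have hφG : ∀ q ∈ G, φ =ᶠ[𝓝 q] φ' := fun q hq => by
    filter_upwards [hG.mem_nhds hq] with s hs
    simp [hφ', hs]
  refine ⟨G ∪ D', φ', hG.union hD'o, fun q hq => ?_, ?_, fun x hx => ?_⟩
  · by_cases hqr : q = r
    · refine Or.inr ⟨hqr ▸ hmem, ?_⟩
      have : (q.2 - m) * τ = (1 - μ) * (τ * τ) := by rw [hqr, hm, hτ]; ring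
      rw [this]
      exact mul_pos (by linarith) hτ2
    · exact Or.inl (hr ⟨hq, hqr⟩)
  · refine isSolutionOn_of_eventuallyEq ?_
    rintro q (hq | hq)
    · exact ⟨G, φ, hq, h, hφG q hq⟩
    · refine ⟨D, χ, hq.1, hχ, ?_⟩
      filter_upwards [hD'o.mem_nhds hq] with s hs
      by_cases hsG : s ∈ G
      · simp only [hφ', if_pos hsG]
        exact (hagree s hs hsG).eq_of_nhds
      · simp only [hφ', if_neg hsG]
  · have hxG : (x, c) ∈ G := by
      refine hx.resolve_right fun hxD => ?_
      have h1 : 0 < (c - m) * τ := hxD.2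
      have h2 : (c - m) * τ = -(μ * (τ * τ)) := by rw [hm]; ring
      rw [h2] at h1
      have := mul_pos hμ0 hτ2
      linarith
    exact ⟨hxG, timeVelocity_congr (hφG _ hxG).symm⟩

/-- Global existence for smooth initial data. -/
lemma IsSmoothData.exists_isSolutionOn_univ (p : TwoForm n N) (lam vy : ℝ) {φ₀ : ℝ → N}
    {θ₀ : ℝ → TangentBundle (𝓡 n) N} (hd : IsSmoothData φ₀ θ₀) (t₀ : ℝ) :
    ∃ φ : ℝ × ℝ → N, IsSolutionOn p lam vy univ φ ∧
      ∀ x, timeVelocity (n := n) φ x t₀ = θ₀ x := by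
  classical
  set S : Set (ℝ × ℝ) → (ℝ × ℝ → N) → Prop := fun O φ => IsOpen O ∧ IsSolutionOn p lam vy O φ ∧
    ∀ x, (x, t₀) ∈ O → timeVelocity (n := n) φ x t₀ = θ₀ x with hS
  -- The points whose whole triangle lies in the domain of some solution with the given data. A
  -- solution `F r` is chosen for each such `r`; uniqueness on triangles makes `q ↦ F q q` agree
  -- locally with each of them, hence a solution on `G`.
  set G : Set (ℝ × ℝ) := {r | ∃ O φ, cone t₀ r ⊆ O ∧ S O φ} with hGdef
  have hex : ∀ r, ∃ φ, r ∈ G → ∃ O, cone t₀ r ⊆ O ∧ S O φ := by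
    intro r
    by_cases hr : r ∈ G
    · obtain ⟨O, φ, h⟩ := hr
      exact ⟨φ, fun _ => ⟨O, h⟩⟩
    · exact ⟨fun _ => φ₀ 0, fun h => absurd h hr⟩
  choose F hF using hex
  have hG : IsOpen G := by
    refine isOpen_iff_mem_nhds.2 fun r hr => ?_
    obtain ⟨O, φ, hO, hSO⟩ := hr
    filter_upwards [eventually_cone_subset hSO.1 hO] with r' hr'
    exact ⟨O, φ, hr', hSO⟩
  have hpast : ∀ q ∈ G, cone t₀ q ⊆ G := by
    rintro q ⟨O, φ, hO, hSO⟩ q' hq'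
    exact ⟨O, φ, (cone_subset_of_mem hq').trans hO, hSO⟩
  have hval : ∀ O φ, S O φ → ∀ r, cone t₀ r ⊆ O → φ r = F r r := by
    intro O φ hSO r hr
    obtain ⟨O', hO', hSO'⟩ := hF r ⟨O, φ, hr, hSO⟩
    have := (hSO.2.1.mono inter_subset_left).cone_subset_interior (hSO.1.inter hSO'.1)
      (hSO'.2.1.mono inter_subset_right)
      (fun x hx => (hSO.2.2 x hx.1).trans (hSO'.2.2 x hx.2).symm) (subset_inter hr hO')
      (self_mem_cone t₀ r)
    have h1 := interior_subset this
    exact h1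
  have hloc : ∀ r ∈ G, ∃ O φ, r ∈ O ∧ S O φ ∧ φ =ᶠ[𝓝 r] fun q => F q q := by
    rintro r ⟨O, φ, hO, hSO⟩
    refine ⟨O, φ, hO (self_mem_cone t₀ r), hSO, ?_⟩
    filter_upwards [eventually_cone_subset hSO.1 hO] with q hq using hval O φ hSO q hq
  have hsol : IsSolutionOn p lam vy G fun q => F q q := by
    refine isSolutionOn_of_eventuallyEq fun q hq => ?_
    obtain ⟨O, φ, h1, h2, h3⟩ := hloc q hq
    exact ⟨O, φ, h1, h2.2.1, h3⟩
  have hdata : ∀ x, (x, t₀) ∈ G → timeVelocity (n := n) (fun q => F q q) x t₀ = θ₀ x := by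
    intro x hx
    obtain ⟨O, φ, h1, h2, h3⟩ := hloc _ hx
    exact (timeVelocity_congr h3.symm).trans (h2.2.2 x h1)
  -- Induction along the triangle of `q`: points of the initial line come from local existence, and
  -- any other point is the apex of a triangle over which the solution on `G` can be extended.
  have huniv : ∀ q, q ∈ G := by
    intro q
    refine cone_subset_of_forall hG (fun r _ hr => ?_) (self_mem_cone t₀ q)
    by_cases hrt : r.2 = t₀
    · obtain ⟨x, t⟩ := r
      obtain rfl : t = t₀ := hrt
      obtain ⟨R, hR, φ, hφ, hφd⟩ := hd.exists_isSolutionOn p lam vy x t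
      refine ⟨_, φ, ?_, isOpen_openDiamond _ _, hφ, fun y hy => hφd y ?_⟩
      · rw [cone_of_eq (r := (x, t)) rfl]
        exact singleton_subset_iff.2 (self_mem_openDiamond hR)
      · exact openDiamond_subset_ball_line hy
    · obtain ⟨O, φ, hO, hcone, hφ, hφd⟩ := hsol.exists_extension hG hpast hrt hr
      exact ⟨O, φ, hcone, hO, hφ, fun x hx => (hφd x hx).2.trans (hdata x (hφd x hx).1)⟩
  refine ⟨fun q => F q q, hsol.mono fun q _ => huniv q, fun x => hdata x (huniv _)⟩

lemma IsSmoothData.existsUnique (p : TwoForm n N) (lam vy t₀ : ℝ) {φ₀ : ℝ → N}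
    {θ₀ : ℝ → TangentBundle (𝓡 n) N} (hd : IsSmoothData φ₀ θ₀) :
    ∃! φ : ℝ × ℝ → N, IsGlobalCauchySolution p lam vy t₀ φ₀ θ₀ φ := by
  obtain ⟨φ, hφ, hφd⟩ := hd.exists_isSolutionOn_univ p lam vy t₀
  refine ⟨φ, ⟨⟨fun q => hφ.smooth q (mem_univ q), fun e he q => hφ.eqn q (mem_univ q) e he⟩,
    fun x => ?_, hφd⟩, fun φ' hφ' => funext fun q => ?_⟩
  · rw [← hd.proj_eq x, ← hφd x]
    rfl
  · have h' : IsSolutionOn p lam vy univ φ' :=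
      ⟨fun q _ => hφ'.waveMap.smooth q, fun q _ e he => hφ'.waveMap.eqn e he q⟩
    have := h'.cone_subset_interior isOpen_univ hφ
      (fun x _ => (hφ'.initial_vel x).trans (hφd x).symm) (subset_univ _) (self_mem_cone t₀ q)
    have h1 := interior_subset this
    exact h1

-- The coefficients of the equation depend on `φ` alone, so translations in `x` preserve it.
omit [IsContMDiffRiemannianBundle (𝓡 n) ∞ (EuclideanSpace ℝ (Fin n))
    (fun x : N => TangentSpace (𝓡 n) x)] [IsRiemannianManifold (𝓡 n) N] [CompleteSpace N] in
lemma IsGlobalCauchySolution.comp_add {p : TwoForm n N} {lam vy t₀ ℓ : ℝ} {φ₀ : ℝ → N}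
    {θ₀ : ℝ → TangentBundle (𝓡 n) N} {φ : ℝ × ℝ → N}
    (h : IsGlobalCauchySolution p lam vy t₀ φ₀ θ₀ φ) :
    IsGlobalCauchySolution p lam vy t₀ (fun x => φ₀ (x + ℓ)) (fun x => θ₀ (x + ℓ))
      (fun q => φ (q.1 + ℓ, q.2)) := by
  have hb : ∀ (α : Fin 2) (f : ℝ × ℝ → ℝ),
      baseDeriv α (fun q => f (q.1 + ℓ, q.2)) = fun q => baseDeriv α f (q.1 + ℓ, q.2) := by
    intro α f
    have h1 : ∀ q : ℝ × ℝ, (q.1 + ℓ, q.2) = q + (ℓ, 0) := fun q => by ext <;> simp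
    funext q
    simp only [baseDeriv, h1, fderiv_comp_add_right]
  have hb1 : ∀ (e : OpenPartialHomeomorph N (EuclideanSpace ℝ (Fin n))) (A : Fin n) (α : Fin 2),
      baseDeriv α (fun q => e (φ (q.1 + ℓ, q.2)) A)
        = fun q => baseDeriv α (fun q => e (φ q) A) (q.1 + ℓ, q.2) := fun e A α =>
    hb α fun q => e (φ q) A
  have hs : ContDiff ℝ ∞ fun q : ℝ × ℝ => (q.1 + ℓ, q.2) :=
    (contDiff_fst.add contDiff_const).prodMk contDiff_snd
  refine ⟨⟨h.waveMap.smooth.comp hs.contMDiff, fun e he q hq A => ?_⟩,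
    fun x => h.initial_pos (x + ℓ), fun x => h.initial_vel (x + ℓ)⟩
  simp only [hb1]
  simp only [hb]
  exact h.waveMap.eqn e he (q.1 + ℓ, q.2) hq A

end Continuation

/-! ### The Cauchy problem on the line and on the circle. -/

theorem theorem1 {n : ℕ} {N : Type*} [EMetricSpace N]
    [ChartedSpace (EuclideanSpace ℝ (Fin n)) N] [IsManifold (𝓡 n) ∞ N]
    [RiemannianBundle (fun x : N => TangentSpace (𝓡 n) x)]
    [IsContMDiffRiemannianBundle (𝓡 n) ∞ (EuclideanSpace ℝ (Fin n))
      (fun x : N => TangentSpace (𝓡 n) x)]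
    [IsRiemannianManifold (𝓡 n) N] [CompleteSpace N]
    (p : TwoForm n N) (lam vy t₀ : ℝ)
    (φ₀ : ℝ → N) (θ₀ : ℝ → TangentBundle (𝓡 n) N) (hdata : IsSmoothData φ₀ θ₀) :
    -- base `Σ = ℝ`
    (IsCompactlySupportedData φ₀ θ₀ →
      ∃! φ : ℝ × ℝ → N, IsGlobalCauchySolution p lam vy t₀ φ₀ θ₀ φ) ∧
    -- base `Σ = S¹ = ℝ / ℓℤ`
    (∀ ℓ : ℝ, 0 < ℓ → (∀ x, φ₀ (x + ℓ) = φ₀ x) → (∀ x, θ₀ (x + ℓ) = θ₀ x) →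
      ∃! φ : ℝ × ℝ → N, IsGlobalCauchySolution p lam vy t₀ φ₀ θ₀ φ ∧
        ∀ x t, φ (x + ℓ, t) = φ (x, t)) := by
  have huniq := hdata.existsUnique p lam vy t₀
  refine ⟨fun _ => huniq, fun ℓ _ hφ hθ => ?_⟩
  obtain ⟨φ, hsol, hu⟩ := huniq
  refine ⟨φ, ⟨hsol, fun x t => ?_⟩, fun φ' hφ' => hu φ' hφ'.1⟩
  -- Periodic data make the translate by `ℓ` a solution of the same Cauchy problem, so it coincides
  -- with the original.
  have h1 := hsol.comp_add (ℓ := ℓ)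
  simp only [hφ, hθ] at h1
  exact congrFun (hu _ h1) (x, t)
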